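/- Let $\mathbb K$ be an algebraically closed field of characteristic zero and let $a\in\mathbb K\setminus\{0,-1\}$. Let $\mathfrak g=\mathfrak g_0\oplus\mathfrak g_1=D(2,1;a)$ be the contragredient Lie superalgebra over $\mathbb K$ with Cartan matrix $$(a_{ij})=\begin{pmatrix}0&1&a\\-1&2&0\\-1&0&2\end{pmatrix},$$ that is, the Lie superalgebra generated by $h_i,e_i,f_i$ ($i=1,2,3$), with $e_1,f_1$ odd and the other generators even, with the relations $[h_i,h_j]=0$, $[h_i,e_j]=a_{ij}e_j$, $[h_i,f_j]=-a_{ij}f_j$, $[e_i,f_j]=\delta_{ij}h_i$, $[e_1,e_1]=[f_1,f_1]=0$, in which $h_1,h_2,h_3$ are linearly independent and which has no non-zero ideal meeting $\mathfrak h=\sum_i\mathbb K h_i$ trivially. Let $\Delta=\Delta_0\sqcup\Delta_1\subset\mathfrak h^*$ be the set of (even and odd) roots of $\mathfrak g$ with respect to $\mathfrak h$; explicitly $\Delta_0=\{\pm2\varepsilon_1,\pm2\varepsilon_2,\pm2\varepsilon_3\}$ and $\Delta_1=\{\pm\varepsilon_1\pm\varepsilon_2\pm\varepsilon_3\}$,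 where $\varepsilon_1-\varepsilon_2-\varepsilon_3$, $2\varepsilon_2$, $2\varepsilon_3$ are the weights of $e_1,e_2,e_3$. On $\mathfrak h^*$ let $(\ ,\ )$ be the bilinear form for which the $\varepsilon_i$ are orthogonal with $(\varepsilon_1,\varepsilon_1)=-(1+a)/2$, $(\varepsilon_2,\varepsilon_2)=1/2$, $(\varepsilon_3,\varepsilon_3)=a/2$. The positive roots are $2\varepsilon_i$ ($i=1,2,3$) and $\varepsilon_1\pm\varepsilon_2\pm\varepsilon_3$; their coroots are $H_{2\varepsilon_1}=(1+a)^{-1}(2h_1-h_2-ah_3)$, $H_{2\varepsilon_2}=h_2$, $H_{2\varepsilon_3}=h_3$, $H_{\varepsilon_1-\varepsilon_2-\varepsilon_3}=h_1$, $H_{\varepsilon_1+\varepsilon_2-\varepsilon_3}=h_1-h_2$, $H_{\varepsilon_1-\varepsilon_2+\varepsilon_3}=h_1-ah_3$, $H_{\varepsilon_1+\varepsilon_2+\varepsilon_3}=h_1-h_2-ah_3$, and $H_{-\alpha}=-H_\alpha$. Let $\mathbb Z[a]$ be the subring of $\mathbb K$ generated by $a$. A Chevalley basis of $\mathfrak g$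 is a homogeneous $\mathbb K$-basis $\{H_1,H_2,H_3\}\sqcup\{X_\alpha\}_{\alpha\in\Delta}$ such that: (a) $\{H_1,H_2,H_3\}$ is a $\mathbb K$-basis of $\mathfrak h$, and $\mathfrak h_{\mathbb Z[a]}:=\sum_i\mathbb Z[a]H_i$ is the $\mathbb Z[a]$-span of all the $H_\alpha$, $\alpha\in\Delta$; (b) $[H_i,H_j]=0$ and $[H_i,X_\alpha]=\alpha(H_i)X_\alpha$; (c) $[X_\alpha,X_{-\alpha}]=\sigma_\alpha H_\alpha$, where $\sigma_\alpha=-1$ if $\alpha$ is an odd negative root and $\sigma_\alpha=1$ otherwise; (d) for $\alpha,\beta\in\Delta$ with $\alpha+\beta\ne0$: $[X_\alpha,X_\beta]=0$ if $\alpha+\beta\notin\Delta$, while $[X_\alpha,X_\beta]=c_{\alpha,\beta}X_{\alpha+\beta}$ if $\alpha+\beta\in\Delta$, where $c_{\alpha,\beta}=\pm(r+1)$ if $(\alpha,\alpha)\neq0$ or $(\beta,\beta)\ne0$ and $(\beta+\mathbb Z\alpha)\cap(\Delta\cup\{0\})=\{\beta-r\alpha,\dots,\beta+q\alpha\}$,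 and $c_{\alpha,\beta}=\pm\beta(H_\alpha)$ if $(\alpha,\alpha)=0=(\beta,\beta)$. Fix a Chevalley basis. For $y$ in a $\mathbb K$-algebra and $n\in\mathbb N$ put $\binom yn=y(y-1)\cdots(y-n+1)/n!$ and $y^{(n)}=y^n/n!$. Let $\mathbb Z_a$ be the subring of $\mathbb K$ generated by all $\binom pn$ with $p\in\mathbb Z[a]$, $n\in\mathbb N$. Let $U(\mathfrak g)$ be the universal enveloping superalgebra of $\mathfrak g$, and let the Kostant superalgebra $K_{\mathbb Z_a}(\mathfrak g)$ be the unital $\mathbb Z_a$-subalgebra of $U(\mathfrak g)$ generated by $X_\alpha^{(n)}$, $X_\gamma$ and $\binom Hn$ for $\alpha\in\Delta_0$, $\gamma\in\Delta_1$, $H\in\mathfrak h_{\mathbb Z[a]}$, $n\in\mathbb N$. Theorem. $K_{\mathbb Z_a}(\mathfrak g)$ is a free $\mathbb Z_a$-module. Moreover, for every total order $\preceq$ on $\Delta\sqcup\{1,2,3\}$, a $\mathbb Z_a$-basis of $K_{\mathbb Z_a}(\mathfrak g)$ is formed by the ordered monomials, i.e. by all products of the factors $X_\alpha^{(n_\alpha)}$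 ($\alpha\in\Delta_0$), $\binom{H_i}{n_i}$ ($i=1,2,3$) and $X_\gamma^{n_\gamma}$ ($\gamma\in\Delta_1$), each index occurring once and the factors being taken in the order $\preceq$, where $n_\alpha,n_i\in\mathbb N$ and $n_\gamma\in\{0,1\}$ are arbitrary (distinct families of exponents giving distinct basis elements). -/

import Mathlib

noncomputable section

/-! ### Lie superalgebras and their universal enveloping superalgebras -/

/-- A Lie superalgebra over `K`: a `ℤ/2`-graded module `L = part 0 ⊕ part 1` with a bilinear
even bracket that satisfies super antisymmetry and the super Jacobi identity. -/
class LieSuperalgebra (K L : Type*) [CommRing K] [AddCommGroup L] [Module K L] where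
  part : ZMod 2 → Submodule K L
  isCompl : IsCompl (part 0) (part 1)
  bracket : L →ₗ[K] L →ₗ[K] L
  bracket_mem : ∀ {i j : ZMod 2} {x y : L}, x ∈ part i → y ∈ part j → bracket x y ∈ part (i + j)
  skew : ∀ {i j : ZMod 2} {x y : L}, x ∈ part i → y ∈ part j →
    bracket x y + (-1 : K) ^ (i.val * j.val) • bracket y x = 0
  jacobi : ∀ {i j k : ZMod 2} {x y z : L}, x ∈ part i → y ∈ part j → z ∈ part k →
    (-1 : K) ^ (i.val * k.val) • bracket x (bracket y z) +
    (-1 : K) ^ (j.val * i.val) • bracket y (bracket z x) +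
    (-1 : K) ^ (k.val * j.val) • bracket z (bracket x y) = 0

/-- The relations `x y - (-1)^{|x||y|} y x = [x, y]`, for `x`, `y` homogeneous. -/
inductive SuperEnvelopingRel (K L : Type*) [CommRing K] [AddCommGroup L] [Module K L]
    [LieSuperalgebra K L] : TensorAlgebra K L → TensorAlgebra K L → Prop
  | mk {i j : ZMod 2} {x y : L} (hx : x ∈ LieSuperalgebra.part (K := K) (L := L) i)
      (hy : y ∈ LieSuperalgebra.part (K := K) (L := L) j) :
      SuperEnvelopingRel K L
        (TensorAlgebra.ι K x * TensorAlgebra.ι K y -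
          (-1 : K) ^ (i.val * j.val) • (TensorAlgebra.ι K y * TensorAlgebra.ι K x))
        (TensorAlgebra.ι K (LieSuperalgebra.bracket (K := K) x y))

/-- The universal enveloping superalgebra of a Lie superalgebra. -/
def SuperEnveloping (K L : Type*) [CommRing K] [AddCommGroup L] [Module K L]
    [LieSuperalgebra K L] : Type _ :=
  RingQuot (SuperEnvelopingRel K L)

namespace SuperEnveloping

variable (K L : Type*) [CommRing K] [AddCommGroup L] [Module K L] [LieSuperalgebra K L]

instance : Ring (SuperEnveloping K L) := inferInstanceAs (Ring (RingQuot (SuperEnvelopingRel K L)))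
instance : Algebra K (SuperEnveloping K L) := inferInstanceAs (Algebra K (RingQuot (SuperEnvelopingRel K L)))

/-- The quotient map from the tensor algebra. -/
def mkAlgHom : TensorAlgebra K L →ₐ[K] SuperEnveloping K L := RingQuot.mkAlgHom K (SuperEnvelopingRel K L)

/-- The canonical map of a Lie superalgebra to its universal enveloping superalgebra. -/
def ι : L →ₗ[K] SuperEnveloping K L := (mkAlgHom K L).toLinearMap ∘ₗ TensorAlgebra.ι K

end SuperEnveloping

/-! ### Divided powers and binomial coefficients -/

/-- The divided power `y ^ n / n!`. -/
def dividedPow (K : Type*) {A : Type*} [Field K] [Ring A] [Algebra K A] (y : A) (n : ℕ) : A :=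
  (n.factorial : K)⁻¹ • y ^ n

/-- The binomial coefficient `y (y - 1) ⋯ (y - n + 1) / n!`. -/
def binom (K : Type*) {A : Type*} [Field K] [Ring A] [Algebra K A] (y : A) (n : ℕ) : A :=
  (n.factorial : K)⁻¹ • Polynomial.aeval y (descPochhammer K n)

/-! ### The Lie superalgebra `D(2,1;a)` -/

/-- The underlying space of `D(2,1;a)`.

The even part is `sl₂ ⊕ sl₂ ⊕ sl₂`: the coordinates `even s 0`, `even s 1`, `even s 2` belong to
the standard basis `E`, `F`, `H` of the copy of `sl₂` with number `s`.  The odd part is `V ⊗ V ⊗ V`,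
where `V` is the standard module of `sl₂` with basis `x₀`, `x₁` (of weight `1` and `-1`): the
coordinate `odd i j k` belongs to `xᵢ ⊗ xⱼ ⊗ xₖ`. -/
@[ext] structure D21 {K : Type*} [Field K] (a : K) where
  even : Fin 3 → Fin 3 → K
  odd : Fin 2 → Fin 2 → Fin 2 → K

namespace D21

variable {K : Type*} [Field K]

/-- The scalars `-(1 + a) / 2`, `1 / 2`, `a / 2` (with sum zero). -/
def sigma (a : K) : Fin 3 → K := ![-(1 + a) / 2, 1 / 2, a / 2]

/-- The bracket of `sl₂`: `[H, E] = 2 E`, `[H, F] = -2 F`, `[E, F] = H`. -/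
def sl2Bracket (A B : Fin 3 → K) : Fin 3 → K :=
  ![2 * (A 2 * B 0 - A 0 * B 2), 2 * (A 1 * B 2 - A 2 * B 1), A 0 * B 1 - A 1 * B 0]

/-- The action of `sl₂` on its standard module `V`. -/
def sl2Act (A : Fin 3 → K) (x : Fin 2 → K) : Fin 2 → K :=
  ![A 2 * x 0 + A 0 * x 1, A 1 * x 0 - A 2 * x 1]

/-- The invariant alternating form `ψ` of `V`, on basis vectors. -/
def psi : Fin 2 → Fin 2 → K := ![![0, 1], ![-1, 0]]

/-- The symmetric equivariant map `V × V → sl₂`, `(x, y) ↦ (z ↦ ψ(y, z) x + ψ(x, z) y)`. -/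
def symPair (x y : Fin 2 → K) : Fin 3 → K :=
  ![2 * x 0 * y 0, -2 * x 1 * y 1, -(x 0 * y 1 + x 1 * y 0)]

/-- The componentwise bracket of `sl₂ ⊕ sl₂ ⊕ sl₂`. -/
def evenBracket (A B : Fin 3 → Fin 3 → K) : Fin 3 → Fin 3 → K := fun s => sl2Bracket (A s) (B s)

/-- The action of `sl₂ ⊕ sl₂ ⊕ sl₂` on `V ⊗ V ⊗ V`. -/
def oddAct (A : Fin 3 → Fin 3 → K) (v : Fin 2 → Fin 2 → Fin 2 → K) : Fin 2 → Fin 2 → Fin 2 → K :=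
  fun i j k => sl2Act (A 0) (fun l => v l j k) i + sl2Act (A 1) (fun l => v i l k) j +
    sl2Act (A 2) (fun l => v i j l) k

/-- The bracket of two odd elements.  For decomposable tensors, the component of
`[v₀ ⊗ v₁ ⊗ v₂, w₀ ⊗ w₁ ⊗ w₂]` in copy `s` is `σ s · (∏_{t ≠ s} ψ(v_t, w_t)) · symPair v_s w_s`. -/
def oddBracket (a : K) (v w : Fin 2 → Fin 2 → Fin 2 → K) : Fin 3 → Fin 3 → K :=
  ![sigma a 0 • ∑ j, ∑ j', ∑ k, ∑ k', (psi j j' * psi k k' : K) •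
      symPair (fun l => v l j k) (fun l => w l j' k'),
    sigma a 1 • ∑ i, ∑ i', ∑ k, ∑ k', (psi i i' * psi k k' : K) •
      symPair (fun l => v i l k) (fun l => w i' l k'),
    sigma a 2 • ∑ i, ∑ i', ∑ j, ∑ j', (psi i i' * psi j j' : K) •
      symPair (fun l => v i j l) (fun l => w i' j' l)]

variable (a : K)

/-- `D(2,1;a)` as a product. -/
def equivProd : D21 a ≃ (Fin 3 → Fin 3 → K) × (Fin 2 → Fin 2 → Fin 2 → K) where
  toFun x := (x.even, x.odd)
  invFun p := ⟨p.1, p.2⟩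
  left_inv _ := rfl
  right_inv _ := rfl

instance : AddCommGroup (D21 a) := (equivProd a).addCommGroup
instance : Module K (D21 a) := (equivProd a).module K

@[simp] lemma add_even (x y : D21 a) : (x + y).even = x.even + y.even := rfl
@[simp] lemma add_odd (x y : D21 a) : (x + y).odd = x.odd + y.odd := rfl
@[simp] lemma sub_even (x y : D21 a) : (x - y).even = x.even - y.even := rfl
@[simp] lemma sub_odd (x y : D21 a) : (x - y).odd = x.odd - y.odd := rfl
@[simp] lemma neg_even (x : D21 a) : (-x).even = -x.even := rfl
@[simp] lemma neg_odd (x : D21 a) : (-x).odd = -x.odd := rfl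
@[simp] lemma smul_even (c : K) (x : D21 a) : (c • x).even = c • x.even := rfl
@[simp] lemma smul_odd (c : K) (x : D21 a) : (c • x).odd = c • x.odd := rfl
@[simp] lemma zero_even : (0 : D21 a).even = 0 := rfl
@[simp] lemma zero_odd : (0 : D21 a).odd = 0 := rfl

/-- The bracket of `D(2,1;a)`. -/
def bracketFun (x y : D21 a) : D21 a :=
  ⟨evenBracket x.even y.even + oddBracket a x.odd y.odd, oddAct x.even y.odd - oddAct y.even x.odd⟩

lemma bracketFun_even (x y : D21 a) : (bracketFun a x y).even =
    evenBracket x.even y.even + oddBracket a x.odd y.odd := rfl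
lemma bracketFun_odd (x y : D21 a) : (bracketFun a x y).odd =
    oddAct x.even y.odd - oddAct y.even x.odd := rfl

lemma funext3 {α : Type*} {f g : Fin 3 → α} (h0 : f 0 = g 0) (h1 : f 1 = g 1) (h2 : f 2 = g 2) :
    f = g := by
  funext i; fin_cases i <;> assumption

lemma funext2 {α : Type*} {f g : Fin 2 → α} (h0 : f 0 = g 0) (h1 : f 1 = g 1) : f = g := by
  funext i; fin_cases i <;> assumption

lemma sl2Bracket_0 (A B : Fin 3 → K) : sl2Bracket A B 0 = 2 * (A 2 * B 0 - A 0 * B 2) := rfl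
lemma sl2Bracket_1 (A B : Fin 3 → K) : sl2Bracket A B 1 = 2 * (A 1 * B 2 - A 2 * B 1) := rfl
lemma sl2Bracket_2 (A B : Fin 3 → K) : sl2Bracket A B 2 = A 0 * B 1 - A 1 * B 0 := rfl
lemma sl2Act_0 (A : Fin 3 → K) (x : Fin 2 → K) : sl2Act A x 0 = A 2 * x 0 + A 0 * x 1 := rfl
lemma sl2Act_1 (A : Fin 3 → K) (x : Fin 2 → K) : sl2Act A x 1 = A 1 * x 0 - A 2 * x 1 := rfl
lemma symPair_0 (x y : Fin 2 → K) : symPair x y 0 = 2 * x 0 * y 0 := rfl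
lemma symPair_1 (x y : Fin 2 → K) : symPair x y 1 = -2 * x 1 * y 1 := rfl
lemma symPair_2 (x y : Fin 2 → K) : symPair x y 2 = -(x 0 * y 1 + x 1 * y 0) := rfl

lemma oddBracket_0 (v w) (t : Fin 3) : oddBracket a v w 0 t = sigma a 0 *
    (symPair (v · 0 0) (w · 1 1) t - symPair (v · 0 1) (w · 1 0) t
    - symPair (v · 1 0) (w · 0 1) t + symPair (v · 1 1) (w · 0 0) t) := by
  simp [oddBracket, Fin.sum_univ_two, psi]; ring
lemma oddBracket_1 (v w) (t : Fin 3) : oddBracket a v w 1 t = sigma a 1 *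
    (symPair (v 0 · 0) (w 1 · 1) t - symPair (v 0 · 1) (w 1 · 0) t
    - symPair (v 1 · 0) (w 0 · 1) t + symPair (v 1 · 1) (w 0 · 0) t) := by
  simp [oddBracket, Fin.sum_univ_two, psi]; ring
lemma oddBracket_2 (v w) (t : Fin 3) : oddBracket a v w 2 t = sigma a 2 *
    (symPair (v 0 0 ·) (w 1 1 ·) t - symPair (v 0 1 ·) (w 1 0 ·) t
    - symPair (v 1 0 ·) (w 0 1 ·) t + symPair (v 1 1 ·) (w 0 0 ·) t) := by
  simp [oddBracket, Fin.sum_univ_two, psi]; ring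

lemma oddBracket_comm (v w) : oddBracket a v w = oddBracket a w v := by
  apply funext3 <;> apply funext3 <;>
    simp only [oddBracket_0, oddBracket_1, oddBracket_2, symPair_0, symPair_1, symPair_2,
      Pi.add_apply, Pi.sub_apply, Pi.neg_apply, Pi.smul_apply, Pi.zero_apply, smul_eq_mul] <;> ring
lemma oddBracket_add_left (v v' w) :
    oddBracket a (v + v') w = oddBracket a v w + oddBracket a v' w := by
  apply funext3 <;> apply funext3 <;>
    simp only [oddBracket_0, oddBracket_1, oddBracket_2, symPair_0, symPair_1, symPair_2,
      Pi.add_apply, Pi.sub_apply, Pi.neg_apply, Pi.smul_apply, Pi.zero_apply, smul_eq_mul] <;> ring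
lemma oddBracket_smul_left (c : K) (v w) :
    oddBracket a (c • v) w = c • oddBracket a v w := by
  apply funext3 <;> apply funext3 <;>
    simp only [oddBracket_0, oddBracket_1, oddBracket_2, symPair_0, symPair_1, symPair_2,
      Pi.add_apply, Pi.sub_apply, Pi.neg_apply, Pi.smul_apply, Pi.zero_apply, smul_eq_mul] <;> ring
lemma oddBracket_add_right (v v' w) :
    oddBracket a w (v + v') = oddBracket a w v + oddBracket a w v' := by
  simp only [oddBracket_comm a w, oddBracket_add_left]
lemma oddBracket_smul_right (c : K) (v w) :
    oddBracket a w (c • v) = c • oddBracket a w v := by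
  simp only [oddBracket_comm a w, oddBracket_smul_left]
lemma evenBracket_skew (A B : Fin 3 → Fin 3 → K) : evenBracket A B = -evenBracket B A := by
  apply funext3 <;> apply funext3 <;>
    simp only [evenBracket, sl2Bracket_0, sl2Bracket_1, sl2Bracket_2,
      Pi.add_apply, Pi.sub_apply, Pi.neg_apply, Pi.smul_apply, Pi.zero_apply, smul_eq_mul] <;> ring
lemma evenBracket_add_left (A A' B : Fin 3 → Fin 3 → K) :
    evenBracket (A + A') B = evenBracket A B + evenBracket A' B := by
  apply funext3 <;> apply funext3 <;>
    simp only [evenBracket, sl2Bracket_0, sl2Bracket_1, sl2Bracket_2,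
      Pi.add_apply, Pi.sub_apply, Pi.neg_apply, Pi.smul_apply, Pi.zero_apply, smul_eq_mul] <;> ring
lemma evenBracket_smul_left (c : K) (A B : Fin 3 → Fin 3 → K) :
    evenBracket (c • A) B = c • evenBracket A B := by
  apply funext3 <;> apply funext3 <;>
    simp only [evenBracket, sl2Bracket_0, sl2Bracket_1, sl2Bracket_2,
      Pi.add_apply, Pi.sub_apply, Pi.neg_apply, Pi.smul_apply, Pi.zero_apply, smul_eq_mul] <;> ring
lemma evenBracket_add_right (A A' B : Fin 3 → Fin 3 → K) :
    evenBracket B (A + A') = evenBracket B A + evenBracket B A' := by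
  rw [evenBracket_skew, evenBracket_add_left, evenBracket_skew B A, evenBracket_skew B A', neg_add]
lemma evenBracket_smul_right (c : K) (A B : Fin 3 → Fin 3 → K) :
    evenBracket B (c • A) = c • evenBracket B A := by
  rw [evenBracket_skew, evenBracket_smul_left, evenBracket_skew B A, smul_neg]
lemma oddAct_add_left (A B : Fin 3 → Fin 3 → K) (v) :
    oddAct (A + B) v = oddAct A v + oddAct B v := by
  apply funext2 <;> apply funext2 <;> apply funext2 <;>
    simp only [oddAct, sl2Act_0, sl2Act_1,
      Pi.add_apply, Pi.sub_apply, Pi.neg_apply, Pi.smul_apply, Pi.zero_apply, smul_eq_mul] <;> ring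
lemma oddAct_add_right (A : Fin 3 → Fin 3 → K) (v w) :
    oddAct A (v + w) = oddAct A v + oddAct A w := by
  apply funext2 <;> apply funext2 <;> apply funext2 <;>
    simp only [oddAct, sl2Act_0, sl2Act_1,
      Pi.add_apply, Pi.sub_apply, Pi.neg_apply, Pi.smul_apply, Pi.zero_apply, smul_eq_mul] <;> ring
lemma oddAct_smul_left (c : K) (A : Fin 3 → Fin 3 → K) (v) :
    oddAct (c • A) v = c • oddAct A v := by
  apply funext2 <;> apply funext2 <;> apply funext2 <;>
    simp only [oddAct, sl2Act_0, sl2Act_1,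
      Pi.add_apply, Pi.sub_apply, Pi.neg_apply, Pi.smul_apply, Pi.zero_apply, smul_eq_mul] <;> ring
lemma oddAct_smul_right (c : K) (A : Fin 3 → Fin 3 → K) (v) :
    oddAct A (c • v) = c • oddAct A v := by
  apply funext2 <;> apply funext2 <;> apply funext2 <;>
    simp only [oddAct, sl2Act_0, sl2Act_1,
      Pi.add_apply, Pi.sub_apply, Pi.neg_apply, Pi.smul_apply, Pi.zero_apply, smul_eq_mul] <;> ring

lemma bracketFun_add_left (x y z : D21 a) :
    bracketFun a (x + y) z = bracketFun a x z + bracketFun a y z := by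
  apply D21.ext
  · simp only [bracketFun_even, add_even, add_odd, evenBracket_add_left, oddBracket_add_left]; abel
  · simp only [bracketFun_odd, add_even, add_odd, oddAct_add_left, oddAct_add_right]; abel
lemma bracketFun_smul_left (c : K) (x z : D21 a) :
    bracketFun a (c • x) z = c • bracketFun a x z := by
  apply D21.ext
  · simp [bracketFun_even, evenBracket_smul_left, oddBracket_smul_left]
  · simp [bracketFun_odd, oddAct_smul_left, oddAct_smul_right, smul_sub]
lemma bracketFun_add_right (x y z : D21 a) :
    bracketFun a z (x + y) = bracketFun a z x + bracketFun a z y := by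
  apply D21.ext
  · simp only [bracketFun_even, add_even, add_odd, evenBracket_add_right, oddBracket_add_right]; abel
  · simp only [bracketFun_odd, add_even, add_odd, oddAct_add_left, oddAct_add_right]; abel
lemma bracketFun_smul_right (c : K) (x z : D21 a) :
    bracketFun a z (c • x) = c • bracketFun a z x := by
  apply D21.ext
  · simp [bracketFun_even, evenBracket_smul_right, oddBracket_smul_right]
  · simp [bracketFun_odd, oddAct_smul_left, oddAct_smul_right, smul_sub]

/-- The bracket of `D(2,1;a)` as a bilinear map. -/
def bracket : D21 a →ₗ[K] D21 a →ₗ[K] D21 a :=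
  LinearMap.mk₂ K (bracketFun a) (bracketFun_add_left a) (bracketFun_smul_left a)
    (fun x y z => bracketFun_add_right a y z x) (fun c x y => bracketFun_smul_right a c y x)

lemma bracket_even (x y : D21 a) : (bracket a x y).even =
    evenBracket x.even y.even + oddBracket a x.odd y.odd := rfl
lemma bracket_odd (x y : D21 a) : (bracket a x y).odd =
    oddAct x.even y.odd - oddAct y.even x.odd := rfl

lemma even_jacobi (A B C : Fin 3 → Fin 3 → K) : evenBracket A (evenBracket B C) +
    evenBracket B (evenBracket C A) + evenBracket C (evenBracket A B) = 0 := by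
  apply funext3 <;> apply funext3 <;>
    simp only [evenBracket, sl2Bracket_0, sl2Bracket_1, sl2Bracket_2,
      Pi.add_apply, Pi.sub_apply, Pi.neg_apply, Pi.smul_apply, Pi.zero_apply, smul_eq_mul] <;> ring
lemma oddAct_evenBracket (A B : Fin 3 → Fin 3 → K) (v) :
    oddAct (evenBracket A B) v = oddAct A (oddAct B v) - oddAct B (oddAct A v) := by
  apply funext2 <;> apply funext2 <;> apply funext2 <;>
    simp only [oddAct, sl2Act_0, sl2Act_1, evenBracket, sl2Bracket_0, sl2Bracket_1, sl2Bracket_2,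
      Pi.add_apply, Pi.sub_apply, Pi.neg_apply, Pi.smul_apply, Pi.zero_apply, smul_eq_mul] <;> ring
lemma evenBracket_oddBracket (A : Fin 3 → Fin 3 → K) (v w) :
    evenBracket A (oddBracket a v w) =
      oddBracket a (oddAct A v) w + oddBracket a v (oddAct A w) := by
  apply funext3 <;> apply funext3 <;>
    simp only [oddAct, sl2Act_0, sl2Act_1, evenBracket, sl2Bracket_0, sl2Bracket_1, sl2Bracket_2,
      oddBracket_0, oddBracket_1, oddBracket_2, symPair_0, symPair_1, symPair_2,
      Pi.add_apply, Pi.sub_apply, Pi.neg_apply, Pi.smul_apply, Pi.zero_apply, smul_eq_mul] <;> ring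
lemma odd_jacobi (u v w) : oddAct (oddBracket a u v) w +
    oddAct (oddBracket a v w) u + oddAct (oddBracket a w u) v = 0 := by
  have hs : sigma a 0 = -(sigma a 1 + sigma a 2) := by simp [sigma]; ring
  apply funext2 <;> apply funext2 <;> apply funext2 <;>
    simp only [oddAct, sl2Act_0, sl2Act_1, hs,
      oddBracket_0, oddBracket_1, oddBracket_2, symPair_0, symPair_1, symPair_2,
      Pi.add_apply, Pi.sub_apply, Pi.neg_apply, Pi.smul_apply, Pi.zero_apply, smul_eq_mul] <;> ring

lemma evenBracket_zero_right (A : Fin 3 → Fin 3 → K) : evenBracket A 0 = 0 := by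
  simpa using evenBracket_smul_right 0 0 A
lemma evenBracket_zero_left (A : Fin 3 → Fin 3 → K) : evenBracket 0 A = 0 := by
  simpa using evenBracket_smul_left 0 0 A
lemma oddBracket_zero_right (v) : oddBracket a v 0 = 0 := by
  simpa using oddBracket_smul_right a 0 0 v
lemma oddBracket_zero_left (v) : oddBracket a 0 v = 0 := by
  simpa using oddBracket_smul_left a 0 0 v
lemma oddAct_zero_right (A : Fin 3 → Fin 3 → K) : oddAct A 0 = 0 := by
  simpa using oddAct_smul_right 0 A 0
lemma oddAct_zero_left (v : Fin 2 → Fin 2 → Fin 2 → K) : oddAct 0 v = 0 := by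
  simpa using oddAct_smul_left 0 0 v
lemma oddAct_neg_right (A : Fin 3 → Fin 3 → K) (v) : oddAct A (-v) = -oddAct A v := by
  simpa using oddAct_smul_right (-1) A v
lemma oddBracket_neg_right (v w) : oddBracket a v (-w) = -oddBracket a v w := by
  simpa using oddBracket_smul_right a (-1) w v

/-- The even and the odd part of `D(2,1;a)`. -/
def part (i : ZMod 2) : Submodule K (D21 a) where
  carrier := {x | if i = 0 then x.odd = 0 else x.even = 0}
  add_mem' {x y} hx hy := by
    by_cases h : i = 0 <;> simp_all
  zero_mem' := by by_cases h : i = 0 <;> simp_all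
  smul_mem' c x hx := by
    by_cases h : i = 0 <;> simp_all

lemma mem_part_zero (x : D21 a) : x ∈ part a 0 ↔ x.odd = 0 := Iff.rfl
lemma mem_part_one (x : D21 a) : x ∈ part a 1 ↔ x.even = 0 := Iff.rfl

lemma parity_cases (i : ZMod 2) : i = 0 ∨ i = 1 := by
  fin_cases i
  · exact Or.inl rfl
  · exact Or.inr rfl

lemma bracket_mem {i j : ZMod 2} {x y : D21 a} (hx : x ∈ part a i) (hy : y ∈ part a j) :
    bracket a x y ∈ part a (i + j) := by
  have h11 : (1 + 1 : ZMod 2) = 0 := rfl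
  rcases parity_cases i with rfl | rfl <;> rcases parity_cases j with rfl | rfl <;>
    simp only [h11, zero_add, add_zero, mem_part_zero, mem_part_one, bracket_even,
      bracket_odd] at * <;>
    simp [hx, hy, oddAct_zero_right, oddAct_zero_left, oddBracket_zero_right,
      oddBracket_zero_left, evenBracket_zero_right, evenBracket_zero_left]

lemma bracket_skew {i j : ZMod 2} {x y : D21 a} (hx : x ∈ part a i) (hy : y ∈ part a j) :
    bracket a x y + (-1 : K) ^ (i.val * j.val) • bracket a y x = 0 := by
  have h1 : (1 : ZMod 2).val = 1 := rfl
  rcases parity_cases i with rfl | rfl <;> rcases parity_cases j with rfl | rfl <;>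
    simp only [mem_part_zero, mem_part_one] at * <;>
    apply D21.ext <;>
    simp [bracket_even, bracket_odd, hx, hy, h1, oddAct_zero_right, oddAct_zero_left,
      oddBracket_zero_right, oddBracket_zero_left, evenBracket_zero_right, evenBracket_zero_left]
  · simp [evenBracket_skew x.even y.even]
  · simp [oddBracket_comm a x.odd y.odd]

lemma bracket_jacobi {i j k : ZMod 2} {x y z : D21 a} (hx : x ∈ part a i) (hy : y ∈ part a j)
    (hz : z ∈ part a k) :
    (-1 : K) ^ (i.val * k.val) • bracket a x (bracket a y z) +
    (-1 : K) ^ (j.val * i.val) • bracket a y (bracket a z x) +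
    (-1 : K) ^ (k.val * j.val) • bracket a z (bracket a x y) = 0 := by
  have h1 : (1 : ZMod 2).val = 1 := rfl
  have he := even_jacobi x.even y.even z.even
  have ho := odd_jacobi a x.odd y.odd z.odd
  rcases parity_cases i with rfl | rfl <;> rcases parity_cases j with rfl | rfl <;>
    rcases parity_cases k with rfl | rfl <;>
    simp only [mem_part_zero, mem_part_one] at * <;>
    apply D21.ext <;>
    simp only [bracket_even, bracket_odd, hx, hy, hz, h1, oddAct_zero_right, oddAct_zero_left,
      oddBracket_zero_right, oddBracket_zero_left, evenBracket_zero_right, evenBracket_zero_left,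
      oddAct_neg_right, oddBracket_neg_right, evenBracket_oddBracket, oddAct_evenBracket,
      add_zero, zero_add, sub_zero, zero_sub, mul_zero, zero_mul, mul_one, pow_zero, pow_one,
      one_smul, neg_smul, ZMod.val_zero, add_even, add_odd, smul_even, smul_odd, zero_even,
      zero_odd, neg_even, neg_odd, smul_zero, neg_zero, he]
  · abel
  · abel
  · rw [oddBracket_comm a z.odd]; abel
  · abel
  · rw [oddBracket_comm a x.odd, oddBracket_comm a z.odd (oddAct _ _)]; abel
  · rw [oddBracket_comm a y.odd (oddAct _ _)]; abel
  · rw [← ho]; abel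

instance : LieSuperalgebra K (D21 a) where
  part := part a
  isCompl := by
    constructor
    · rw [Submodule.disjoint_def]
      intro x hx hy
      exact D21.ext hy hx
    · rw [codisjoint_iff, eq_top_iff]
      intro x _
      exact Submodule.mem_sup.2 ⟨⟨x.even, 0⟩, rfl, ⟨0, x.odd⟩, rfl,
        D21.ext (by simp) (by simp)⟩
  bracket := bracket a
  bracket_mem := bracket_mem a
  skew := bracket_skew a
  jacobi := bracket_jacobi a

/-- The element `E`, `F` or `H` (for `t = 0, 1, 2`) of the copy of `sl₂` with number `s`. -/
def evenVec (s t : Fin 3) : D21 a := ⟨Pi.single s (Pi.single t 1), 0⟩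

/-- The element `x_p ⊗ x_q ⊗ x_r` of the odd part. -/
def oddVec (p q r : Fin 2) : D21 a := ⟨0, Pi.single p (Pi.single q (Pi.single r 1))⟩

/-- The Chevalley generators `e₁, e₂, e₃` (with indices `0, 1, 2`). -/
def genE : Fin 3 → D21 a := ![oddVec a 0 1 1, evenVec a 1 0, evenVec a 2 0]

/-- The Chevalley generators `f₁, f₂, f₃`. -/
def genF : Fin 3 → D21 a := ![oddVec a 1 0 0, evenVec a 1 1, evenVec a 2 1]

/-- The Cartan generators `h₁ = [e₁, f₁]`, `h₂ = [e₂, f₂]`, `h₃ = [e₃, f₃]`. -/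
def genH (i : Fin 3) : D21 a := bracket a (genE a i) (genF a i)

/-- The Cartan matrix of `D(2,1;a)`. -/
def cartanMatrix : Matrix (Fin 3) (Fin 3) K := !![0, 1, a; -1, 2, 0; -1, 0, 2]

/-- The Cartan subalgebra `𝔥`; it is the span of `h₁, h₂, h₃` by `cartan_eq_span_genH`. -/
def cartan : Submodule K (D21 a) := Submodule.span K (Set.range fun s => evenVec a s 2)

/-- The element `H` of the copy of `sl₂` with number `s`, as an element of `𝔥`. -/
def cartanVec (s : Fin 3) : cartan a := ⟨evenVec a s 2, Submodule.subset_span ⟨s, rfl⟩⟩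

/-- The basis `ε₁, ε₂, ε₃` of `𝔥*`, dual to `cartanVec`. -/
def eps (s : Fin 3) : Module.Dual K (cartan a) where
  toFun x := (x : D21 a).even s 2
  map_add' _ _ := rfl
  map_smul' _ _ := rfl

/-- The set `Δ₀` of even roots. -/
def evenRoots : Set (Module.Dual K (cartan a)) :=
  {α | α ≠ 0 ∧ ∃ x ∈ part a 0, x ≠ 0 ∧ ∀ h : cartan a, bracket a h x = α h • x}

/-- The set `Δ₁` of odd roots. -/
def oddRoots : Set (Module.Dual K (cartan a)) :=
  {α | ∃ x ∈ part a 1, x ≠ 0 ∧ ∀ h : cartan a, bracket a h x = α h • x}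

/-- The set `Δ` of roots. -/
def roots : Set (Module.Dual K (cartan a)) := evenRoots a ∪ oddRoots a

/-- The set `Δ⁺` of positive roots. -/
def posRoots : Set (Module.Dual K (cartan a)) :=
  {2 • eps a 0, 2 • eps a 1, 2 • eps a 2,
    eps a 0 - eps a 1 - eps a 2, eps a 0 + eps a 1 - eps a 2,
    eps a 0 - eps a 1 + eps a 2, eps a 0 + eps a 1 + eps a 2}

/-- The bilinear form on `𝔥*`: the `ε`s are orthogonal, `(ε₁, ε₁) = -(1 + a) / 2`,
`(ε₂, ε₂) = 1 / 2`, `(ε₃, ε₃) = a / 2`. -/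
def form (α β : Module.Dual K (cartan a)) : K :=
  ∑ s, sigma a s * α (cartanVec a s) * β (cartanVec a s)

/-- The element of `𝔥` that represents `α` with respect to `form`. -/
def dualVec (α : Module.Dual K (cartan a)) : cartan a :=
  ∑ s, (sigma a s * α (cartanVec a s)) • cartanVec a s

open Classical in
/-- The coroot `H_α`: the multiple of `dualVec α` that is normalized by `α(H_α) = 2` when
`(α, α) ≠ 0`, and `H_α = -dualVec α` for isotropic `α` (so that `H_{α₁} = h₁`). -/
def coroot (α : Module.Dual K (cartan a)) : cartan a :=
  if form a α α = 0 then -dualVec a α else (2 / form a α α) • dualVec a α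

open Classical in
/-- The sign `σ_α`: it is `-1` if `α` is an odd negative root and `1` otherwise. -/
def rootSign (α : Module.Dual K (cartan a)) : K :=
  if α ∈ oddRoots a ∧ -α ∈ posRoots a then -1 else 1

/-! ### Checks: the generators, the roots and the coroots are the standard ones -/

lemma oddVec_apply (p q r i j k : Fin 2) :
    (oddVec a p q r).odd i j k = if i = p ∧ j = q ∧ k = r then 1 else 0 := by
  by_cases hi : i = p <;> by_cases hj : j = q <;> by_cases hk : k = r <;>
    simp [oddVec, hi, hj, hk]
lemma evenVec_apply (s t i j : Fin 3) :
    (evenVec a s t).even i j = if i = s ∧ j = t then 1 else 0 := by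
  by_cases hi : i = s <;> by_cases hj : j = t <;> simp [evenVec, hi, hj]

lemma genH_zero [NeZero (2 : K)] : genH a 0 = (2⁻¹ : K) •
    ((1 + a) • evenVec a 0 2 + evenVec a 1 2 + a • evenVec a 2 2) := by
  apply D21.ext
  · apply funext3 <;> apply funext3 <;>
      simp [genH, genE, genF, bracket_even, evenBracket, sl2Bracket_0, sl2Bracket_1, sl2Bracket_2,
        oddBracket_0, oddBracket_1, oddBracket_2, symPair_0, symPair_1, symPair_2, oddVec_apply,
        evenVec_apply, sigma] <;> simp [oddVec] <;> ring
  · simp [genH, genE, genF, bracket_odd, oddVec, evenVec, oddAct_zero_left]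
lemma genH_one : genH a 1 = evenVec a 1 2 := by
  apply D21.ext
  · apply funext3 <;> apply funext3 <;>
      simp [genH, genE, genF, bracket_even, evenBracket, sl2Bracket_0, sl2Bracket_1, sl2Bracket_2,
        evenVec_apply] <;> simp [evenVec, oddBracket_zero_left]
  · simp [genH, genE, genF, bracket_odd, oddVec, evenVec, oddAct_zero_right]
lemma genH_two : genH a 2 = evenVec a 2 2 := by
  apply D21.ext
  · apply funext3 <;> apply funext3 <;>
      simp [genH, genE, genF, bracket_even, evenBracket, sl2Bracket_0, sl2Bracket_1, sl2Bracket_2,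
        evenVec_apply] <;> simp [evenVec, oddBracket_zero_left]
  · simp [genH, genE, genF, bracket_odd, oddVec, evenVec, oddAct_zero_right]

lemma mem_cartan_iff (x : D21 a) : x ∈ cartan a ↔
    x.odd = 0 ∧ ∀ s, x.even s 0 = 0 ∧ x.even s 1 = 0 := by
  constructor
  · intro hx
    induction hx using Submodule.span_induction with
    | mem x h =>
      obtain ⟨s, rfl⟩ := h
      exact ⟨rfl, fun t => by simp [evenVec_apply]⟩
    | zero => simp
    | add x y _ _ hx hy => simp_all
    | smul c x _ hx => simp_all
  · rintro ⟨h0, h1⟩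
    have : x = ∑ s, x.even s 2 • evenVec a s 2 := by
      apply D21.ext
      · apply funext3 <;> apply funext3 <;> simp [Fin.sum_univ_three, evenVec_apply, h1]
      · simp [Fin.sum_univ_three, evenVec, h0]
    rw [this]
    exact Submodule.sum_mem _ fun s _ => Submodule.smul_mem _ _ (Submodule.subset_span ⟨s, rfl⟩)

lemma fin3_cases (i : Fin 3) : i = 0 ∨ i = 1 ∨ i = 2 := by
  fin_cases i <;> simp
lemma fin2_cases (i : Fin 2) : i = 0 ∨ i = 1 := by
  fin_cases i <;> simp

lemma bracket_cartan_even {h : D21 a} (hh : h ∈ cartan a) (x : D21 a) (s t : Fin 3) :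
    (bracket a h x).even s t = ![2, -2, 0] t * h.even s 2 * x.even s t := by
  obtain ⟨h0, h1⟩ := (mem_cartan_iff a h).1 hh
  rcases fin3_cases t with rfl | rfl | rfl <;>
    simp [bracket_even, h0, oddBracket_zero_left, evenBracket, sl2Bracket_0, sl2Bracket_1,
      sl2Bracket_2, h1] <;> ring

lemma bracket_cartan_odd {h : D21 a} (hh : h ∈ cartan a) (x : D21 a) (i j k : Fin 2) :
    (bracket a h x).odd i j k = (![1, -1] i * h.even 0 2 + ![1, -1] j * h.even 1 2 +
      ![1, -1] k * h.even 2 2) * x.odd i j k := by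
  obtain ⟨h0, h1⟩ := (mem_cartan_iff a h).1 hh
  rcases fin2_cases i with rfl | rfl <;> rcases fin2_cases j with rfl | rfl <;>
    rcases fin2_cases k with rfl | rfl <;>
    simp [bracket_odd, h0, oddAct_zero_right, oddAct, sl2Act_0, sl2Act_1, h1] <;> ring

lemma genH_mem [NeZero (2 : K)] (i : Fin 3) : genH a i ∈ cartan a := by
  have m (s : Fin 3) : evenVec a s 2 ∈ cartan a := Submodule.subset_span ⟨s, rfl⟩
  rcases fin3_cases i with rfl | rfl | rfl
  · rw [genH_zero]
    exact Submodule.smul_mem _ _ (Submodule.add_mem _ (Submodule.add_mem _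
      (Submodule.smul_mem _ _ (m 0)) (m 1)) (Submodule.smul_mem _ _ (m 2)))
  · exact genH_one a ▸ m 1
  · exact genH_two a ▸ m 2

lemma genH_apply [NeZero (2 : K)] (i s : Fin 3) : (genH a i).even s 2 =
    ![![(1 + a) / 2, 1 / 2, a / 2], ![0, 1, 0], ![0, 0, 1]] i s := by
  rcases fin3_cases i with rfl | rfl | rfl <;> rcases fin3_cases s with rfl | rfl | rfl <;>
    simp [genH_zero, genH_one, genH_two, evenVec_apply] <;> ring

lemma bracket_cartan_cartan {h h' : D21 a} (hh : h ∈ cartan a) (hh' : h' ∈ cartan a) :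
    bracket a h h' = 0 := by
  obtain ⟨h0, h1⟩ := (mem_cartan_iff a h').1 hh'
  apply D21.ext
  · funext s t
    rw [bracket_cartan_even a hh]
    rcases fin3_cases t with rfl | rfl | rfl <;> simp [h1]
  · funext i j k
    rw [bracket_cartan_odd a hh]
    simp [h0]

lemma bracket_cartan_evenVec {h : D21 a} (hh : h ∈ cartan a) (s t : Fin 3) :
    bracket a h (evenVec a s t) = (![2, -2, 0] t * h.even s 2) • evenVec a s t := by
  apply D21.ext
  · funext s' t'
    rw [bracket_cartan_even a hh]
    by_cases hs : s' = s <;> by_cases ht : t' = t <;> simp [evenVec_apply, hs, ht]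
  · funext i j k
    rw [bracket_cartan_odd a hh]
    simp [evenVec]

lemma bracket_cartan_oddVec {h : D21 a} (hh : h ∈ cartan a) (p q r : Fin 2) :
    bracket a h (oddVec a p q r) = (![1, -1] p * h.even 0 2 + ![1, -1] q * h.even 1 2 +
      ![1, -1] r * h.even 2 2 : K) • oddVec a p q r := by
  apply D21.ext
  · funext s' t'
    rw [bracket_cartan_even a hh]
    simp [oddVec]
  · funext i j k
    rw [bracket_cartan_odd a hh]
    by_cases hp : i = p <;> by_cases hq : j = q <;> by_cases hr : k = r <;>
      simp [oddVec_apply, hp, hq, hr]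

/-- The generators satisfy the relations of the contragredient Lie superalgebra with the given
Cartan matrix. -/
theorem contragredient_relations [NeZero (2 : K)] :
    (∀ i, genH a i ∈ part a 0) ∧ genE a 0 ∈ part a 1 ∧ genE a 1 ∈ part a 0 ∧ genE a 2 ∈ part a 0 ∧
    genF a 0 ∈ part a 1 ∧ genF a 1 ∈ part a 0 ∧ genF a 2 ∈ part a 0 ∧
    (∀ i j, bracket a (genH a i) (genH a j) = 0) ∧
    bracket a (genE a 0) (genE a 0) = 0 ∧ bracket a (genF a 0) (genF a 0) = 0 ∧
    (∀ i j, bracket a (genH a i) (genE a j) = cartanMatrix a i j • genE a j) ∧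
    (∀ i j, bracket a (genH a i) (genF a j) = -cartanMatrix a i j • genF a j) ∧
    (∀ i j, bracket a (genE a i) (genF a j) = if i = j then genH a i else 0) := by
  have h2 : (2 : K) ≠ 0 := NeZero.ne 2
  refine ⟨fun i => ((mem_cartan_iff a _).1 (genH_mem a i)).1, rfl, rfl, rfl, rfl, rfl, rfl,
    fun i j => bracket_cartan_cartan a (genH_mem a i) (genH_mem a j), ?_, ?_, ?_, ?_, ?_⟩
  · apply D21.ext
    · apply funext3 <;> apply funext3 <;> simp [genE, bracket_even, evenBracket, sl2Bracket,
        oddBracket_0, oddBracket_1, oddBracket_2, symPair_0, symPair_1, symPair_2, oddVec]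
    · simp [bracket_odd]
  · apply D21.ext
    · apply funext3 <;> apply funext3 <;> simp [genF, bracket_even, evenBracket, sl2Bracket,
        oddBracket_0, oddBracket_1, oddBracket_2, symPair_0, symPair_1, symPair_2, oddVec]
    · simp [bracket_odd]
  · intro i j
    rcases fin3_cases j with rfl | rfl | rfl <;>
      simp only [genE, Matrix.cons_val, bracket_cartan_evenVec a (genH_mem a i),
        bracket_cartan_oddVec a (genH_mem a i), genH_apply] <;>
      rcases fin3_cases i with rfl | rfl | rfl <;> congr 1 <;> simp [cartanMatrix] <;>
      field_simp <;> ring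
  · intro i j
    rcases fin3_cases j with rfl | rfl | rfl <;>
      simp only [genF, Matrix.cons_val, bracket_cartan_evenVec a (genH_mem a i),
        bracket_cartan_oddVec a (genH_mem a i), genH_apply] <;>
      rcases fin3_cases i with rfl | rfl | rfl <;> congr 1 <;> simp [cartanMatrix] <;>
      field_simp <;> ring
  · intro i j
    by_cases hij : i = j
    · subst hij; simp [genH]
    · rw [if_neg hij]
      revert hij
      rcases fin3_cases i with rfl | rfl | rfl <;> rcases fin3_cases j with rfl | rfl | rfl <;>
        intro hij <;> first
        | exact absurd rfl hij
        | apply D21.ext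
          · apply funext3 <;> apply funext3 <;> simp [genE, genF, bracket_even, evenBracket,
              sl2Bracket, oddVec, evenVec, oddBracket_zero_left, oddBracket_zero_right]
          · apply funext2 <;> apply funext2 <;> apply funext2 <;> simp [genE, genF, bracket_odd,
              oddAct, sl2Act, oddVec, evenVec]

theorem cartan_eq_span_genH [NeZero (2 : K)] (ha : a ≠ -1) :
    cartan a = Submodule.span K (Set.range (genH a)) := by
  have h2 : (2 : K) ≠ 0 := NeZero.ne 2
  have ha' : 1 + a ≠ 0 := fun h => ha (by linear_combination h)
  apply le_antisymm
  · rw [cartan, Submodule.span_le]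
    have m (i : Fin 3) : genH a i ∈ Submodule.span K (Set.range (genH a)) :=
      Submodule.subset_span ⟨i, rfl⟩
    rintro _ ⟨s, rfl⟩
    rcases fin3_cases s with rfl | rfl | rfl
    · have : evenVec a 0 2 = (1 + a)⁻¹ • ((2 : K) • genH a 0 - genH a 1 - a • genH a 2) := by
        rw [genH_zero, genH_one, genH_two, smul_smul, mul_inv_cancel₀ h2, one_smul]
        have : (1 + a) • evenVec a 0 2 + evenVec a 1 2 + a • evenVec a 2 2 - evenVec a 1 2 -
          a • evenVec a 2 2 = (1 + a) • evenVec a 0 2 := by abel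
        rw [this, smul_smul, inv_mul_cancel₀ ha', one_smul]
      simp only [SetLike.mem_coe, this]
      exact Submodule.smul_mem _ _ (Submodule.sub_mem _ (Submodule.sub_mem _
        (Submodule.smul_mem _ _ (m 0)) (m 1)) (Submodule.smul_mem _ _ (m 2)))
    · simpa only [SetLike.mem_coe, ← genH_one] using m 1
    · simpa only [SetLike.mem_coe, ← genH_two] using m 2
  · rw [Submodule.span_le]
    rintro _ ⟨s, rfl⟩
    exact genH_mem a s

lemma bracket_evenVec (s t : Fin 3) (x : D21 a) : bracket a (evenVec a s t) x =
    ⟨evenBracket (evenVec a s t).even x.even, oddAct (evenVec a s t).even x.odd⟩ := by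
  apply D21.ext
  · simp [bracket_even, evenVec, oddBracket_zero_left]
  · simp [bracket_odd, evenVec, oddAct_zero_right]

lemma eq_sum (x : D21 a) : x = ∑ s, ∑ t, x.even s t • evenVec a s t +
    ∑ i, ∑ j, ∑ k, x.odd i j k • oddVec a i j k := by
  apply D21.ext
  · apply funext3 <;> apply funext3 <;>
      simp [Fin.sum_univ_three, Fin.sum_univ_two, evenVec, oddVec]
  · apply funext2 <;> apply funext2 <;> apply funext2 <;>
      simp [Fin.sum_univ_three, Fin.sum_univ_two, evenVec, oddVec]

lemma bracket_E_even (s : Fin 3) (x : D21 a) : (bracket a (evenVec a s 0) x).even =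
    Pi.single s ![-2 * x.even s 2, 0, x.even s 1] := by
  rw [bracket_evenVec]
  funext s'
  by_cases h : s' = s
  · subst h
    apply funext3 <;> simp [evenBracket, sl2Bracket_0, sl2Bracket_1, sl2Bracket_2, evenVec]
  · apply funext3 <;> simp [evenBracket, sl2Bracket_0, sl2Bracket_1, sl2Bracket_2, evenVec, h]
lemma bracket_F_even (s : Fin 3) (x : D21 a) : (bracket a (evenVec a s 1) x).even =
    Pi.single s ![0, 2 * x.even s 2, -x.even s 0] := by
  rw [bracket_evenVec]
  funext s'
  by_cases h : s' = s
  · subst h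
    apply funext3 <;> simp [evenBracket, sl2Bracket_0, sl2Bracket_1, sl2Bracket_2, evenVec]
  · apply funext3 <;> simp [evenBracket, sl2Bracket_0, sl2Bracket_1, sl2Bracket_2, evenVec, h]
lemma sl2Act_zero (x : Fin 2 → K) : sl2Act 0 x = 0 := by
  apply funext2 <;> simp [sl2Act]
lemma oddAct_sq (s : Fin 3) (A : Fin 3 → K) (hA : ∀ x, sl2Act A (sl2Act A x) = 0) (v) :
    oddAct (Pi.single s A) (oddAct (Pi.single s A) v) = 0 := by
  funext i j k
  rcases fin3_cases s with rfl | rfl | rfl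
  · simpa [oddAct, sl2Act_zero] using congrFun (hA fun l => v l j k) i
  · simpa [oddAct, sl2Act_zero] using congrFun (hA fun l => v i l k) j
  · simpa [oddAct, sl2Act_zero] using congrFun (hA fun l => v i j l) k
lemma bracket_evenVec_sq_odd (s u : Fin 3) (hu : u = 0 ∨ u = 1) (x : D21 a) :
    (bracket a (evenVec a s u) (bracket a (evenVec a s u) x)).odd = 0 := by
  simp only [bracket_evenVec]
  refine oddAct_sq s _ (fun y => ?_) _
  rcases hu with rfl | rfl <;> apply funext2 <;> simp [sl2Act]
lemma bracket_E_F (s : Fin 3) : bracket a (evenVec a s 0) (evenVec a s 1) = evenVec a s 2 := by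
  apply D21.ext
  · rw [bracket_E_even]
    simp only [evenVec]
    congr 1
    apply funext3 <;> simp
  · simp [bracket_odd, evenVec, oddAct_zero_right]
lemma bracket_F_E (s : Fin 3) : bracket a (evenVec a s 1) (evenVec a s 0) = -evenVec a s 2 := by
  have := bracket_skew a (x := evenVec a s 0) (y := evenVec a s 1) (i := 0) (j := 0) rfl rfl
  rw [bracket_E_F] at this
  simpa using eq_neg_of_add_eq_zero_right (by simpa using this)

/-- The generators generate `D(2,1;a)` as a Lie superalgebra. -/
theorem generators_generate [NeZero (2 : K)] (ha : a ≠ -1) (S : Submodule K (D21 a))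
    (hS : ∀ x ∈ S, ∀ y ∈ S, bracket a x y ∈ S) (hE : ∀ i, genE a i ∈ S) (hF : ∀ i, genF a i ∈ S) :
    S = ⊤ := by
  have h2 : (2 : K) ≠ 0 := NeZero.ne 2
  have ha' : 1 + a ≠ 0 := fun h => ha (by linear_combination h)
  have E1 : evenVec a 1 0 ∈ S := hE 1
  have E2 : evenVec a 2 0 ∈ S := hE 2
  have F1 : evenVec a 1 1 ∈ S := hF 1
  have F2 : evenVec a 2 1 ∈ S := hF 2
  have o011 : oddVec a 0 1 1 ∈ S := hE 0
  have o100 : oddVec a 1 0 0 ∈ S := hF 0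
  have act {s t : Fin 3} {p q r p' q' r' : Fin 2} (h : evenVec a s t ∈ S)
      (h' : oddVec a p q r ∈ S) (e : oddAct (evenVec a s t).even (oddVec a p q r).odd =
        (oddVec a p' q' r').odd) : oddVec a p' q' r' ∈ S := by
    have : bracket a (evenVec a s t) (oddVec a p q r) = oddVec a p' q' r' := by
      apply D21.ext
      · simp [bracket_even, evenVec, oddVec, oddBracket_zero_left, evenBracket_zero_right]
      · rw [bracket_odd, e]; simp [evenVec, oddVec, oddAct_zero_left]
    exact this ▸ hS _ h _ h'
  have o001 : oddVec a 0 0 1 ∈ S := act E1 o011 (by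
    apply funext2 <;> apply funext2 <;> apply funext2 <;> simp [oddAct, sl2Act, evenVec, oddVec])
  have o010 : oddVec a 0 1 0 ∈ S := act E2 o011 (by
    apply funext2 <;> apply funext2 <;> apply funext2 <;> simp [oddAct, sl2Act, evenVec, oddVec])
  have o000 : oddVec a 0 0 0 ∈ S := act E2 o001 (by
    apply funext2 <;> apply funext2 <;> apply funext2 <;> simp [oddAct, sl2Act, evenVec, oddVec])
  have o110 : oddVec a 1 1 0 ∈ S := act F1 o100 (by
    apply funext2 <;> apply funext2 <;> apply funext2 <;> simp [oddAct, sl2Act, evenVec, oddVec])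
  have o101 : oddVec a 1 0 1 ∈ S := act F2 o100 (by
    apply funext2 <;> apply funext2 <;> apply funext2 <;> simp [oddAct, sl2Act, evenVec, oddVec])
  have o111 : oddVec a 1 1 1 ∈ S := act F2 o110 (by
    apply funext2 <;> apply funext2 <;> apply funext2 <;> simp [oddAct, sl2Act, evenVec, oddVec])
  have E0 : evenVec a 0 0 ∈ S := by
    have : bracket a (oddVec a 0 0 0) (oddVec a 0 1 1) = (-(1 + a)) • evenVec a 0 0 := by
      apply D21.ext
      · apply funext3 <;> apply funext3 <;> simp [bracket_even, evenBracket, sl2Bracket,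
          oddBracket_0, oddBracket_1, oddBracket_2, symPair, oddVec, evenVec, sigma]
        field_simp
      · simp [bracket_odd, oddVec, evenVec, oddAct_zero_left]
    have h := hS _ o000 _ o011
    rw [this] at h
    exact (Submodule.smul_mem_iff _ (neg_ne_zero.2 ha')).1 h
  have F0 : evenVec a 0 1 ∈ S := by
    have : bracket a (oddVec a 1 0 0) (oddVec a 1 1 1) = (1 + a) • evenVec a 0 1 := by
      apply D21.ext
      · apply funext3 <;> apply funext3 <;> simp [bracket_even, evenBracket, sl2Bracket,
          oddBracket_0, oddBracket_1, oddBracket_2, symPair, oddVec, evenVec, sigma]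
        field_simp; ring
      · simp [bracket_odd, oddVec, evenVec, oddAct_zero_left]
    have h := hS _ o100 _ o111
    rw [this] at h
    exact (Submodule.smul_mem_iff _ ha').1 h
  have HH {s : Fin 3} (h : evenVec a s 0 ∈ S) (h' : evenVec a s 1 ∈ S) : evenVec a s 2 ∈ S := by
    rw [← bracket_E_F]; exact hS _ h _ h'
  have H0 := HH E0 F0
  have H1 := HH E1 F1
  have H2 := HH E2 F2
  rw [eq_top_iff]
  intro x _
  rw [eq_sum a x]
  refine Submodule.add_mem _ (Submodule.sum_mem _ fun s _ => Submodule.sum_mem _ fun t _ =>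
    Submodule.smul_mem _ _ ?_) (Submodule.sum_mem _ fun i _ => Submodule.sum_mem _ fun j _ =>
    Submodule.sum_mem _ fun k _ => Submodule.smul_mem _ _ ?_)
  · rcases fin3_cases s with rfl | rfl | rfl <;> rcases fin3_cases t with rfl | rfl | rfl <;>
      assumption
  · rcases fin2_cases i with rfl | rfl <;> rcases fin2_cases j with rfl | rfl <;>
      rcases fin2_cases k with rfl | rfl <;> assumption

/-- `D(2,1;a)` has no non-zero ideal that meets `𝔥` trivially. -/
theorem ideal_eq_bot [NeZero (2 : K)] (I : Submodule K (D21 a))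
    (hI : ∀ x, ∀ y ∈ I, bracket a x y ∈ I) (h : I ⊓ cartan a = ⊥) : I = ⊥ := by
  have h2 : (2 : K) ≠ 0 := NeZero.ne 2
  have hc {x : D21 a} (hx : x ∈ I) (hx' : x ∈ cartan a) : x = 0 := by
    have : x ∈ I ⊓ cartan a := ⟨hx, hx'⟩
    rwa [h, Submodule.mem_bot] at this
  have m (s : Fin 3) : evenVec a s 2 ∈ cartan a := Submodule.subset_span ⟨s, rfl⟩
  have key0 (s : Fin 3) (x : D21 a) (hx : x ∈ I) : x.even s 0 = 0 := by
    have h1 := hI (evenVec a s 1) _ (hI (evenVec a s 1) x hx)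
    have e : bracket a (evenVec a s 1) (bracket a (evenVec a s 1) x) =
        (-2 * x.even s 0) • evenVec a s 1 := by
      apply D21.ext
      · rw [bracket_F_even, bracket_F_even, smul_even, evenVec, ← Pi.single_smul]
        congr 1
        apply funext3 <;> simp
      · rw [bracket_evenVec_sq_odd a s 1 (Or.inr rfl)]; simp [evenVec]
    have h3 := hI (evenVec a s 0) _ h1
    rw [e, map_smul, bracket_E_F] at h3
    have := congrFun (congrFun (congrArg D21.even
      (hc h3 (Submodule.smul_mem _ _ (m s)))) s) 2
    simpa [evenVec_apply, h2] using this
  have key1 (s : Fin 3) (x : D21 a) (hx : x ∈ I) : x.even s 1 = 0 := by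
    have h1 := hI (evenVec a s 0) _ (hI (evenVec a s 0) x hx)
    have e : bracket a (evenVec a s 0) (bracket a (evenVec a s 0) x) =
        (-2 * x.even s 1) • evenVec a s 0 := by
      apply D21.ext
      · rw [bracket_E_even, bracket_E_even, smul_even, evenVec, ← Pi.single_smul]
        congr 1
        apply funext3 <;> simp
      · rw [bracket_evenVec_sq_odd a s 0 (Or.inl rfl)]; simp [evenVec]
    have h3 := hI (evenVec a s 1) _ h1
    rw [e, map_smul, bracket_F_E] at h3
    have := congrFun (congrFun (congrArg D21.even
      (hc h3 (Submodule.smul_mem _ _ (Submodule.neg_mem _ (m s))))) s) 2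
    simpa [evenVec_apply, h2] using this
  have even_zero (x : D21 a) (hx : x ∈ I) : x.even = 0 := by
    funext s t
    rcases fin3_cases t with rfl | rfl | rfl
    · exact key0 s x hx
    · exact key1 s x hx
    · have := key0 s _ (hI (evenVec a s 0) x hx)
      simpa [bracket_even, evenVec, oddBracket_zero_left, evenBracket, sl2Bracket_0, h2] using this
  rw [eq_bot_iff]
  intro x hx
  rw [Submodule.mem_bot]
  apply D21.ext (even_zero x hx)
  funext i j k
  have m := even_zero _ (hI (oddVec a (1 - i) (1 - j) (1 - k)) x hx)
  have m := congrFun (congrFun m 1) 2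
  rcases fin2_cases i with rfl | rfl <;> rcases fin2_cases j with rfl | rfl <;>
    rcases fin2_cases k with rfl | rfl <;>
    simpa [bracket_even, evenBracket, sl2Bracket_2, oddVec, oddBracket_1, symPair_2, sigma, h2]
      using m

lemma eps_apply (s : Fin 3) (x : cartan a) : eps a s x = (x : D21 a).even s 2 := rfl

lemma cartanVec_coe (s : Fin 3) : (cartanVec a s : D21 a) = evenVec a s 2 := rfl

lemma cartanVec_even (s t : Fin 3) : ((cartanVec a s : cartan a) : D21 a).even t 2 =
    if t = s then 1 else 0 := by
  simp [cartanVec, evenVec_apply]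

lemma eps_cartanVec (s t : Fin 3) : eps a s (cartanVec a t) = if s = t then 1 else 0 :=
  cartanVec_even a t s

lemma dual_ext {α β : Module.Dual K (cartan a)} (h : ∀ s, α (cartanVec a s) = β (cartanVec a s)) :
    α = β := by
  ext ⟨x, hx⟩
  induction hx using Submodule.span_induction with
  | mem x h' => obtain ⟨s, rfl⟩ := h'; exact h s
  | zero => exact (map_zero α).trans (map_zero β).symm
  | add x y hx hy ihx ihy =>
    have := congrArg₂ (· + ·) ihx ihy
    exact (map_add α ⟨x, hx⟩ ⟨y, hy⟩).trans (this.trans (map_add β ⟨x, hx⟩ ⟨y, hy⟩).symm)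
  | smul c x hx ihx =>
    have := congrArg (c • ·) ihx
    exact (map_smul α c ⟨x, hx⟩).trans (this.trans (map_smul β c ⟨x, hx⟩).symm)

/-- The even roots are `±2 ε₁`, `±2 ε₂`, `±2 ε₃`. -/
theorem mem_evenRoots_iff [CharZero K] (α : Module.Dual K (cartan a)) :
    α ∈ evenRoots a ↔ ∃ s, α = 2 • eps a s ∨ α = -(2 • eps a s) := by
  constructor
  · rintro ⟨hα, x, hx, hx0, hw⟩
    have hw' (u s t : Fin 3) : (![2, -2, 0] t * if s = u then 1 else 0) * x.even s t =
        α (cartanVec a u) * x.even s t := by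
      have := congrFun (congrFun (congrArg D21.even (hw (cartanVec a u))) s) t
      rwa [bracket_cartan_even a (cartanVec a u).2, cartanVec_even] at this
    have : ∃ s t, x.even s t ≠ 0 := by
      by_contra! hcon
      exact hx0 (D21.ext (by funext s t; exact hcon s t) hx)
    obtain ⟨s, t, hst⟩ := this
    have hw'' (u : Fin 3) := mul_right_cancel₀ hst (hw' u s t)
    refine ⟨s, ?_⟩
    rcases fin3_cases t with rfl | rfl | rfl
    · left
      apply dual_ext
      intro u
      rw [← hw'' u]; simp [eps_cartanVec]
    · right
      apply dual_ext
      intro u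
      rw [← hw'' u]; by_cases hsu : s = u <;> simp [eps_cartanVec, hsu]
    · exact absurd (dual_ext a fun u => by rw [← hw'' u]; simp) hα
  · rintro ⟨s, rfl | rfl⟩
    · refine ⟨fun h => ?_, evenVec a s 0, rfl, fun h => ?_, fun h => ?_⟩
      · have := DFunLike.congr_fun h (cartanVec a s)
        simp [eps_cartanVec] at this
      · have := congrFun (congrFun (congrArg D21.even h) s) 0
        simp [evenVec_apply] at this
      · rw [bracket_cartan_evenVec a h.2]; simp [eps_apply]
    · refine ⟨fun h => ?_, evenVec a s 1, rfl, fun h => ?_, fun h => ?_⟩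
      · have := DFunLike.congr_fun h (cartanVec a s)
        simp [eps_cartanVec] at this
      · have := congrFun (congrFun (congrArg D21.even h) s) 1
        simp [evenVec_apply] at this
      · rw [bracket_cartan_evenVec a h.2]; simp [eps_apply]

/-- The odd roots are `±ε₁ ± ε₂ ± ε₃`. -/
theorem mem_oddRoots_iff (α : Module.Dual K (cartan a)) : α ∈ oddRoots a ↔
    ∃ i j k : Fin 2, α = (![1, -1] i : K) • eps a 0 + (![1, -1] j : K) • eps a 1 +
      (![1, -1] k : K) • eps a 2 := by
  constructor
  · rintro ⟨x, hx, hx0, hw⟩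
    have : ∃ i j k, x.odd i j k ≠ 0 := by
      by_contra! hcon
      exact hx0 (D21.ext hx (by funext i j k; exact hcon i j k))
    obtain ⟨i, j, k, hijk⟩ := this
    refine ⟨i, j, k, dual_ext a fun u => ?_⟩
    have := congrFun (congrFun (congrFun (congrArg D21.odd (hw (cartanVec a u))) i) j) k
    rw [bracket_cartan_odd a (cartanVec a u).2] at this
    have := mul_right_cancel₀ hijk this
    rw [← this]; rfl
  · rintro ⟨i, j, k, rfl⟩
    refine ⟨oddVec a i j k, rfl, fun h => ?_, fun h => ?_⟩
    · have := congrFun (congrFun (congrFun (congrArg D21.odd h) i) j) k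
      simp [oddVec_apply] at this
    · rw [bracket_cartan_oddVec a h.2]; rfl

lemma coroot_two_eps [CharZero K] (s : Fin 3) (hs : sigma a s ≠ 0) :
    coroot a (2 • eps a s) = cartanVec a s := by
  have h1 : form a (2 • eps a s) (2 • eps a s) = 4 * sigma a s := by
    simp [form, eps_cartanVec]; ring
  have h2 : dualVec a (2 • eps a s) = (2 * sigma a s) • cartanVec a s := by
    simp [dualVec, eps_cartanVec, mul_comm]
  rw [coroot, h1, h2, if_neg (mul_ne_zero (by norm_num) hs), smul_smul]
  have : 2 / (4 * sigma a s) * (2 * sigma a s) = 1 := by field_simp; norm_num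
  rw [this, one_smul]

/-- The coroots of the positive even roots. -/
theorem coroot_even [CharZero K] (ha0 : a ≠ 0) (ha1 : a ≠ -1) :
    (coroot a (2 • eps a 0) : D21 a) =
      (1 + a)⁻¹ • ((2 : K) • genH a 0 - genH a 1 - a • genH a 2) ∧
    (coroot a (2 • eps a 1) : D21 a) = genH a 1 ∧ (coroot a (2 • eps a 2) : D21 a) = genH a 2 := by
  have ha' : 1 + a ≠ 0 := fun h => ha1 (by linear_combination h)
  rw [coroot_two_eps a 0 (by simp [sigma, ← neg_add_rev, add_comm a, ha']),
    coroot_two_eps a 1 (by simp [sigma]), coroot_two_eps a 2 (by simp [sigma, ha0]),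
    genH_zero, genH_one, genH_two]
  refine ⟨?_, rfl, rfl⟩
  rw [cartanVec_coe, smul_smul, mul_inv_cancel₀ two_ne_zero, eq_inv_smul_iff₀ ha']
  module

lemma coroot_odd_aux [CharZero K] (α : Module.Dual K (cartan a)) (c d : K)
    (hα : ∀ s, α (cartanVec a s) = ![1, c, d] s) (hc : c = 1 ∨ c = -1) (hd : d = 1 ∨ d = -1) :
    (coroot a α : D21 a) =
      (2⁻¹ : K) • ((1 + a) • evenVec a 0 2 - c • evenVec a 1 2 - (d * a) • evenVec a 2 2) := by
  rw [coroot, if_pos]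
  · simp only [dualVec, Fin.sum_univ_three, hα, Submodule.coe_neg, Submodule.coe_add,
      Submodule.coe_smul, cartanVec_coe, sigma, Matrix.cons_val]
    module
  · rcases hc with rfl | rfl <;> rcases hd with rfl | rfl <;>
      simp [form, Fin.sum_univ_three, hα, sigma] <;> ring

/-- The coroots of the positive odd roots. -/
theorem coroot_odd [CharZero K] :
    (coroot a (eps a 0 - eps a 1 - eps a 2) : D21 a) = genH a 0 ∧
    (coroot a (eps a 0 + eps a 1 - eps a 2) : D21 a) = genH a 0 - genH a 1 ∧
    (coroot a (eps a 0 - eps a 1 + eps a 2) : D21 a) = genH a 0 - a • genH a 2 ∧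
    (coroot a (eps a 0 + eps a 1 + eps a 2) : D21 a) = genH a 0 - genH a 1 - a • genH a 2 := by
  rw [coroot_odd_aux a (eps a 0 - eps a 1 - eps a 2) (-1) (-1) ?_ (Or.inr rfl) (Or.inr rfl),
    coroot_odd_aux a (eps a 0 + eps a 1 - eps a 2) 1 (-1) ?_ (Or.inl rfl) (Or.inr rfl),
    coroot_odd_aux a (eps a 0 - eps a 1 + eps a 2) (-1) 1 ?_ (Or.inr rfl) (Or.inl rfl),
    coroot_odd_aux a (eps a 0 + eps a 1 + eps a 2) 1 1 ?_ (Or.inl rfl) (Or.inl rfl),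
    genH_zero, genH_one, genH_two]
  · refine ⟨?_, ?_, ?_, ?_⟩ <;> module
  all_goals
    intro s
    rcases fin3_cases s with rfl | rfl | rfl <;> simp [eps_cartanVec]

lemma coroot_neg (α : Module.Dual K (cartan a)) : coroot a (-α) = -coroot a α := by
  have h1 : form a (-α) (-α) = form a α α := by simp [form]
  have h2 : dualVec a (-α) = -dualVec a α := by simp [dualVec]
  rw [coroot, coroot, h1, h2]
  split_ifs <;> simp

/-! ### Chevalley bases -/

/-- The ring `ℤ[a]`. -/
def intRing : Subring K := Subring.closure {a}

/-- The ring `ℤ_a`, generated by the binomial coefficients of the elements of `ℤ[a]`. -/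
def binomRing : Subring K := Subring.closure {z | ∃ p ∈ intRing a, ∃ n : ℕ, z = binom K p n}

/-- The `α`-string through `β` is `{β - r α, …, β + q α}`. -/
def IsString (α β : Module.Dual K (cartan a)) (r q : ℕ) : Prop :=
  {γ | γ ∈ roots a ∪ {0} ∧ ∃ k : ℤ, γ = β + k • α} =
    {γ | ∃ k : ℤ, -(r : ℤ) ≤ k ∧ k ≤ q ∧ γ = β + k • α}

/-- The family `H₁, H₂, H₃, X_α` (`α ∈ Δ`) is a Chevalley basis of `D(2,1;a)`. -/
structure IsChevalleyBasis (H : Fin 3 → cartan a) (X : roots a → D21 a) : Prop where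
  linearIndependent : LinearIndependent K (Sum.elim (fun i => (H i : D21 a)) X)
  span_eq_top : Submodule.span K (Set.range (Sum.elim (fun i => (H i : D21 a)) X)) = ⊤
  homogeneous : ∀ α, X α ∈ part a 0 ∨ X α ∈ part a 1
  linearIndependent_H : LinearIndependent K H
  span_H : Submodule.span K (Set.range H) = ⊤
  span_coroot : Submodule.span (intRing a) (Set.range H) =
    Submodule.span (intRing a) (coroot a '' roots a)
  bracket_H_H : ∀ i j, bracket a (H i) (H j) = 0
  bracket_H_X : ∀ i (α : roots a), bracket a (H i) (X α) = α.1 (H i) • X α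
  bracket_neg : ∀ α β : roots a, β.1 = -α.1 →
    bracket a (X α) (X β) = rootSign a α.1 • (coroot a α.1 : D21 a)
  bracket_of_not_root : ∀ α β : roots a, α.1 + β.1 ≠ 0 → α.1 + β.1 ∉ roots a →
    bracket a (X α) (X β) = 0
  bracket_of_string : ∀ α β δ : roots a, δ.1 = α.1 + β.1 →
    (form a α.1 α.1 ≠ 0 ∨ form a β.1 β.1 ≠ 0) → ∀ r q : ℕ, IsString a α.1 β.1 r q →
    ∃ c : K, (c = r + 1 ∨ c = -(r + 1)) ∧ bracket a (X α) (X β) = c • X δ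
  bracket_of_isotropic : ∀ α β δ : roots a, δ.1 = α.1 + β.1 →
    form a α.1 α.1 = 0 → form a β.1 β.1 = 0 →
    ∃ c : K, (c = β.1 (coroot a α.1) ∨ c = -β.1 (coroot a α.1)) ∧
      bracket a (X α) (X β) = c • X δ

/-! ### The Kostant superalgebra and the ordered monomials -/

/-- The universal enveloping superalgebra `U(𝔤)`. -/
abbrev U : Type _ := SuperEnveloping K (D21 a)

/-- The canonical map `𝔤 → U(𝔤)`. -/
abbrev toU : D21 a →ₗ[K] U a := SuperEnveloping.ι K (D21 a)

/-- The Kostant superalgebra: the `ℤ_a`-subalgebra of `U(𝔤)` generated by the divided powers of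
the even root vectors, the odd root vectors, and the binomial coefficients of the elements of the
`ℤ[a]`-span of `H₁, H₂, H₃`. -/
def kostant (H : Fin 3 → cartan a) (X : roots a → D21 a) : Subalgebra (binomRing a) (U a) :=
  Algebra.adjoin (binomRing a)
    ({u | ∃ α : roots a, α.1 ∈ evenRoots a ∧ ∃ n : ℕ, u = dividedPow K (toU a (X α)) n} ∪
     {u | ∃ γ : roots a, γ.1 ∈ oddRoots a ∧ u = toU a (X γ)} ∪
     {u | ∃ h ∈ Submodule.span (intRing a) (Set.range H), ∃ n : ℕ,
        u = binom K (toU a (h : D21 a)) n})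

/-- The exponents of the ordered monomials: a natural number for each even root and each of
`H₁, H₂, H₃`, and `0` or `1` for each odd root. -/
def Exponent : Type _ :=
  {n : (roots a ⊕ Fin 3) →₀ ℕ // ∀ γ : roots a, γ.1 ∈ oddRoots a → n (Sum.inl γ) ≤ 1}

/-- The factor `X_α^{(n)}` or `binom(H_i, n)`.  For an odd root `γ` and `n = 0, 1` it is `1`
or `X_γ`. -/
def factor (H : Fin 3 → cartan a) (X : roots a → D21 a) (s : roots a ⊕ Fin 3) (n : ℕ) : U a :=
  Sum.elim (fun α => dividedPow K (toU a (X α)) n) (fun i => binom K (toU a (H i : D21 a)) n) s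

open Classical in
/-- The product of the factors with non-zero exponent, in the order of their indices with respect
to the total order `r`. -/
def monomial (H : Fin 3 → cartan a) (X : roots a → D21 a)
    (r : roots a ⊕ Fin 3 → roots a ⊕ Fin 3 → Prop) [IsLinearOrder (roots a ⊕ Fin 3) r]
    (n : Exponent a) : U a :=
  ((n.1.support.sort r).map fun s => factor a H X s (n.1 s)).prod

end D21

end

/-!
The ordered monomials span because the commutation relations of a Chevalley basis permute two
adjacent factors of a word up to words of lower degree with coefficients in `ℤ_a`: Kostant's
identity for opposite even root vectors, the binomial relations for a divided power against an odd
root vector, and the shift `P(H) X = X P(H + c)` for the torus, where `P(H + c)` expands again in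
binomials of `H` by Newton interpolation. Repeated factors are merged in the same way.

They are independent because the super-comultiplication turns linear forms into an algebra under
convolution. It is realised by letting `U(𝔤)` act on `U(𝔤) ⊗ U(𝔤)`, where an ordered monomial
applied to `1 ⊗ 1` is the sum over all ways of splitting its exponents in two. Hence forms that
separate monomials of low degree convolve to forms that separate monomials of higher degree, which
reduces the matter to degree one, that is, to the injectivity of `𝔤 → U(𝔤)`; this holds because
the adjoint representation of `𝔤` is faithful.
-/

noncomputable section

section DividedPowers

open Finset.HasAntidiagonal (antidiagonal mem_antidiagonal)

variable {K A B : Type*} [Field K] [Ring A] [Algebra K A] [Ring B] [Algebra K B]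

@[simp] lemma dividedPow_zero (y : A) : dividedPow K y 0 = 1 := by simp [dividedPow]

@[simp] lemma dividedPow_one (y : A) : dividedPow K y 1 = y := by simp [dividedPow]

@[simp] lemma binom_zero (y : A) : binom K y 0 = 1 := by simp [binom]

@[simp] lemma binom_one (y : A) : binom K y 1 = y := by simp [binom]

lemma map_dividedPow (φ : A →ₐ[K] B) (y : A) (n : ℕ) :
    φ (dividedPow K y n) = dividedPow K (φ y) n := by
  simp [dividedPow]

lemma map_binom (φ : A →ₐ[K] B) (y : A) (n : ℕ) : φ (binom K y n) = binom K (φ y) n := by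
  simp [binom, Polynomial.aeval_algHom_apply]

lemma aeval_binom_X (y : A) (n : ℕ) :
    Polynomial.aeval y (binom K (Polynomial.X : Polynomial K) n) = binom K y n := by
  rw [map_binom, Polynomial.aeval_X]

lemma dividedPow_neg (y : A) (n : ℕ) :
    dividedPow K (-y) n = (-1 : K) ^ n • dividedPow K y n := by
  rw [dividedPow, dividedPow, ← neg_one_smul K y, smul_pow, smul_comm]

lemma semiconjBy_aeval {x y z : A} (h : SemiconjBy x y z) (p : Polynomial K) :
    SemiconjBy x (Polynomial.aeval y p) (Polynomial.aeval z p) := by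
  induction p using Polynomial.induction_on' with
  | add p q hp hq => simpa using hp.add_right hq
  | monomial n c =>
    simp only [Polynomial.aeval_monomial]
    exact SemiconjBy.mul_right (Algebra.commutes c x).symm (h.pow_right n)

lemma semiconjBy_binom {x y z : A} (h : SemiconjBy x y z) (n : ℕ) :
    SemiconjBy x (binom K y n) (binom K z n) := by
  simpa only [aeval_binom_X] using semiconjBy_aeval h (binom K (Polynomial.X : Polynomial K) n)

lemma commute_dividedPow_right {x y : A} (h : Commute x y) (n : ℕ) :
    Commute x (dividedPow K y n) := (h.pow_right n).smul_right _

lemma commute_dividedPow_left {x y : A} (h : Commute x y) (n : ℕ) :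
    Commute (dividedPow K x n) y := (commute_dividedPow_right h.symm n).symm

lemma commute_binom_right {x y : A} (h : Commute x y) (n : ℕ) :
    Commute x (binom K y n) := semiconjBy_binom h n

lemma commute_binom_left {x y : A} (h : Commute x y) (n : ℕ) :
    Commute (binom K x n) y := (commute_binom_right h.symm n).symm

lemma aeval_descPochhammer_eq_smeval (y : A) (n : ℕ) :
    Polynomial.aeval y (descPochhammer K n) = (descPochhammer ℤ n).smeval y := by
  rw [← descPochhammer_map (algebraMap ℤ K), Polynomial.aeval_map_algebraMap,
    Polynomial.aeval_eq_smeval]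

lemma natDegree_binom_X_le (n : ℕ) :
    (binom K (Polynomial.X : Polynomial K) n).natDegree ≤ n := by
  refine (Polynomial.natDegree_smul_le _ _).trans ?_
  rw [Polynomial.aeval_X_left_apply, descPochhammer_natDegree]

lemma mul_binom_of_sl2 {E y : A} (hy : y * E - E * y = 2 * E) (n : ℕ) :
    E * binom K y n = binom K (y - 2) n * E := by
  refine semiconjBy_binom ?_ n
  rw [SemiconjBy, sub_mul, ← hy, sub_sub_cancel]

lemma semiconjBy_dividedPow_of_eigenvector {x y : A} {c : K} (h : y * x - x * y = c • x) (n : ℕ) :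
    SemiconjBy (dividedPow K x n) (y + algebraMap K A (n * c)) y := by
  have semiconjBy_self : SemiconjBy x (y + algebraMap K A c) y := by
    rw [SemiconjBy, mul_add, sub_eq_iff_eq_add.1 h, Algebra.smul_def, Algebra.commutes, add_comm]
  have semiconjBy_pow : SemiconjBy (x ^ n) (y + algebraMap K A (n * c)) y := by
    induction n with
    | zero => simp
    | succ n ih =>
      have shift : (n + 1 : ℕ) * c = c + n * c := by push_cast; ring
      rw [shift, map_add, ← add_assoc, pow_succ]
      exact ih.mul_left (semiconjBy_self.add_right (Algebra.commutes (n * c) x).symm)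
  rw [dividedPow, SemiconjBy, smul_mul_assoc, mul_smul_comm, semiconjBy_pow.eq]

variable [CharZero K]

lemma mul_dividedPow (y : A) (n : ℕ) :
    y * dividedPow K y n = (n + 1 : K) • dividedPow K y (n + 1) := by
  have h : (n + 1 : K) ≠ 0 := by exact_mod_cast n.succ_ne_zero
  rw [dividedPow, dividedPow, smul_smul, Nat.factorial_succ, mul_smul_comm, pow_succ']
  congr 1
  push_cast
  rw [mul_inv, mul_inv_cancel_left₀ h]

lemma dividedPow_mul (y : A) (n : ℕ) :
    dividedPow K y n * y = (n + 1 : K) • dividedPow K y (n + 1) := by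
  rw [← mul_dividedPow, (commute_dividedPow_right (Commute.refl y) n).eq]

lemma dividedPow_mul_dividedPow (y : A) (m n : ℕ) :
    dividedPow K y m * dividedPow K y n = ((m + n).choose m : K) • dividedPow K y (m + n) := by
  rw [dividedPow, dividedPow, dividedPow, smul_mul_smul_comm, ← pow_add, smul_smul,
    Nat.cast_add_choose]
  congr 1
  have := Nat.cast_ne_zero (R := K).2 (m + n).factorial_ne_zero
  field_simp

lemma binom_mul_sub (y : A) (n : ℕ) :
    binom K y n * (y - n) = (n + 1 : K) • binom K y (n + 1) := by
  have h : (n + 1 : K) ≠ 0 := by exact_mod_cast n.succ_ne_zero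
  rw [binom, binom, smul_smul, Nat.factorial_succ, smul_mul_assoc, descPochhammer_succ_right]
  simp only [map_mul, map_sub, Polynomial.aeval_X, map_natCast]
  congr 1
  push_cast
  rw [mul_inv, mul_inv_cancel_left₀ h]

lemma dividedPow_add_of_commute {x y : A} (h : Commute x y) (n : ℕ) :
    dividedPow K (x + y) n =
      ∑ p ∈ antidiagonal n, dividedPow K x p.1 * dividedPow K y p.2 := by
  rw [dividedPow, h.add_pow', Finset.smul_sum]
  refine Finset.sum_congr rfl fun p hp => ?_
  rw [mem_antidiagonal] at hp
  subst hp
  rw [dividedPow, dividedPow, smul_mul_smul_comm, ← Nat.cast_smul_eq_nsmul K, smul_smul,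
    Nat.cast_add_choose]
  congr 1
  have := Nat.cast_ne_zero (R := K).2 (p.1 + p.2).factorial_ne_zero
  field_simp

lemma binom_add_of_commute {x y : A} (h : Commute x y) (n : ℕ) :
    binom K (x + y) n = ∑ p ∈ antidiagonal n, binom K x p.1 * binom K y p.2 := by
  rw [binom, aeval_descPochhammer_eq_smeval, Ring.descPochhammer_smeval_add n h, Finset.smul_sum]
  refine Finset.sum_congr rfl fun p hp => ?_
  rw [mem_antidiagonal] at hp
  subst hp
  rw [binom, binom, aeval_descPochhammer_eq_smeval, aeval_descPochhammer_eq_smeval,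
    smul_mul_smul_comm, ← nsmul_eq_mul, ← Nat.cast_smul_eq_nsmul K, smul_smul, Nat.cast_add_choose]
  congr 1
  have := Nat.cast_ne_zero (R := K).2 (p.1 + p.2).factorial_ne_zero
  field_simp

lemma binom_add_one (y : A) (n : ℕ) :
    binom K (y + 1) (n + 1) = binom K y (n + 1) + binom K y n := by
  have h0 : (n + 1 : K) ≠ 0 := by exact_mod_cast n.succ_ne_zero
  rw [binom, binom, binom, aeval_descPochhammer_eq_smeval, Ring.descPochhammer_succ_succ_smeval,
    aeval_descPochhammer_eq_smeval, aeval_descPochhammer_eq_smeval, smul_add, add_comm,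
    ← Nat.cast_smul_eq_nsmul K, smul_smul, Nat.factorial_succ]
  congr 2
  push_cast
  field_simp

lemma binom_natCast (j n : ℕ) : binom K (j : K) n = (j.choose n : K) := by
  rw [binom, Polynomial.coe_aeval_eq_eval, descPochhammer_eval_eq_descFactorial,
    Nat.descFactorial_eq_factorial_mul_choose, Nat.cast_mul, smul_eq_mul,
    inv_mul_cancel_left₀ (Nat.cast_ne_zero.2 n.factorial_ne_zero)]

lemma eval_binom_X_natCast (j n : ℕ) :
    (binom K (Polynomial.X : Polynomial K) n).eval (j : K) = (j.choose n : K) := by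
  rw [← Polynomial.coe_aeval_eq_eval, aeval_binom_X, binom_natCast]

/- Both sides agree at every natural number `j ≥ d`, by Newton's forward difference formula. -/
lemma eq_sum_fwdDiff_smul_binom_X {p : Polynomial K} {d : ℕ} (hp : p.natDegree ≤ d) :
    p = ∑ k ∈ Finset.range (d + 1), (fwdDiff 1)^[k] (fun x => p.eval x) (0 : K) •
      binom K (Polynomial.X : Polynomial K) k := by
  refine Polynomial.eq_of_infinite_eval_eq _ _
    (((Set.Ici_infinite d).image Nat.cast_injective.injOn).mono ?_)
  rintro _ ⟨j, hj, rfl⟩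
  have newton := shift_eq_sum_fwdDiff_iter (1 : K) (fun x => p.eval x) j 0
  simp only [zero_add, nsmul_eq_mul, mul_one] at newton
  simp only [Set.mem_ofPred_eq, Polynomial.eval_finsetSum, Polynomial.eval_smul, smul_eq_mul,
    eval_binom_X_natCast, newton, mul_comm]
  refine (Finset.sum_subset (Finset.range_mono (Nat.succ_le_succ hj)) fun k _ hk => ?_).symm
  rw [Finset.mem_range, not_lt] at hk
  simp [Polynomial.fwdDiff_iter_eq_zero_of_degree_lt (hp.trans_lt hk)]

lemma exists_aeval_eq_sum_binom (R : Subring K) {p : Polynomial K} {d : ℕ} (hp : p.natDegree ≤ d)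
    (hR : ∀ j : ℕ, p.eval (j : K) ∈ R) :
    ∃ c : ℕ → R, ∀ y : A,
      Polynomial.aeval y p = ∑ k ∈ Finset.range (d + 1), (c k : K) • binom K y k := by
  have fwdDiff_mem (k : ℕ) : (fwdDiff 1)^[k] (fun x => p.eval x) (0 : K) ∈ R := by
    rw [fwdDiff_iter_eq_sum_shift]
    refine sum_mem fun i _ => zsmul_mem ?_ _
    simpa using hR i
  refine ⟨fun k => ⟨_, fwdDiff_mem k⟩, fun y => ?_⟩
  conv_lhs => rw [eq_sum_fwdDiff_smul_binom_X hp]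
  simp [aeval_binom_X]

lemma smul_binom_add_one (y : A) (c : K) (n : ℕ) :
    c • binom K (y + 1) (n + 1) =
      (c - (n + 1)) • binom K y (n + 1) + (y - n + algebraMap K A c) * binom K y n := by
  have sub_mul_binom : (y - n) * binom K y n = (n + 1 : K) • binom K y (n + 1) := by
    rw [← binom_mul_sub]
    exact (commute_binom_right ((Commute.refl y).sub_left (Nat.cast_commute n y)) n).eq
  rw [binom_add_one, add_mul, sub_mul_binom, ← Algebra.smul_def]
  module

lemma dividedPow_succ_mul_sub {x y z : A} (h : x * y - y * x = z) (hz : Commute x z) (n : ℕ) :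
    dividedPow K x (n + 1) * y - y * dividedPow K x (n + 1) = z * dividedPow K x n := by
  induction n with
  | zero => simpa using h
  | succ n ih =>
    have hn : ((n + 1 : ℕ) + 1 : K) ≠ 0 := by exact_mod_cast (n + 1).succ_ne_zero
    have leibniz : x * dividedPow K x (n + 1) * y - y * (x * dividedPow K x (n + 1)) =
        x * (dividedPow K x (n + 1) * y - y * dividedPow K x (n + 1)) +
          (x * y - y * x) * dividedPow K x (n + 1) := by noncomm_ring
    rw [← smul_right_inj hn, smul_sub, ← smul_mul_assoc, ← mul_smul_comm, ← mul_dividedPow,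
      leibniz, ih, h, ← mul_assoc, hz.eq, mul_assoc, mul_dividedPow, mul_smul_comm]
    push_cast
    module

lemma mul_dividedPow_of_sl2 {E F H : A} (hEF : E * F - F * E = H) (hHF : H * F - F * H = -2 * F)
    (n : ℕ) : E * dividedPow K F (n + 1) =
      dividedPow K F (n + 1) * E + dividedPow K F n * (H - n) := by
  have hE : E * F = F * E + H := by rw [← hEF]; abel
  have hH (n : ℕ) : (H - n) * F = F * (H - n - 2) := by
    rw [sub_eq_iff_eq_add] at hHF
    rw [sub_mul, hHF, Nat.cast_comm]
    noncomm_ring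
  induction n with
  | zero => simp [hE]
  | succ n ih =>
    have hn : ((n + 1 : ℕ) + 1 : K) ≠ 0 := by exact_mod_cast (n + 1).succ_ne_zero
    rw [← smul_right_inj hn, ← mul_smul_comm, ← dividedPow_mul, ← mul_assoc, ih, add_mul,
      mul_assoc _ E, hE, mul_assoc _ _ F, hH, mul_add, ← mul_assoc, ← mul_assoc, dividedPow_mul,
      dividedPow_mul, smul_mul_assoc, smul_add, smul_mul_assoc, add_assoc]
    congr 1
    have h2 : (2 : A) = algebraMap K A 2 := (map_ofNat _ 2).symm
    have hc (k : ℕ) : (k : A) = algebraMap K A k := by simp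
    rw [hc, hc, h2]
    simp only [mul_sub, Algebra.algebraMap_eq_smul_one, mul_smul_comm, mul_one]
    push_cast
    module

lemma mul_lowering_term {E H : A} (hHE : H * E - E * H = 2 * E) {g : ℕ → A}
    (hg : ∀ k : ℕ, E * g k = g k * E + g (k + 1) * (H + k + 1)) {m k : ℕ} (hk : k ≤ m) :
    E * (g k * binom K (H - m + 2 * k) k * dividedPow K E (m - k)) =
      ((m + 1 : K) - k) • (g k * binom K (H - m + 2 * k - 2) k * dividedPow K E (m + 1 - k)) +
        g (k + 1) * (H + k + 1) * binom K (H - m + 2 * k) k * dividedPow K E (m - k) := by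
  have weight : (H - m + 2 * k) * E - E * (H - m + 2 * k) = 2 * E := by
    have hc : (2 : A) * k * E = E * (2 * k) := by exact_mod_cast Nat.cast_comm (2 * k) E
    rw [← hHE, add_mul, sub_mul, mul_add, mul_sub, Nat.cast_comm, hc]
    abel
  rw [← mul_assoc, ← mul_assoc, hg, add_mul, add_mul, mul_assoc (g k), mul_binom_of_sl2 weight,
    ← mul_assoc, mul_assoc _ E, mul_dividedPow, mul_smul_comm, Nat.sub_add_comm hk,
    Nat.cast_sub hk, sub_add_eq_add_sub]

/- `g` plays the role of the divided powers of the lowering operator, in decreasing order. -/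
lemma dividedPow_mul_of_lowering {E H : A} (hHE : H * E - E * H = 2 * E) {g : ℕ → A}
    (hg : ∀ k : ℕ, E * g k = g k * E + g (k + 1) * (H + k + 1)) (m : ℕ) :
    dividedPow K E m * g 0 = ∑ k ∈ Finset.range (m + 1),
      g k * binom K (H - m + 2 * k) k * dividedPow K E (m - k) := by
  induction m with
  | zero => simp
  | succ m ih =>
    have hm : (m + 1 : K) ≠ 0 := by exact_mod_cast m.succ_ne_zero
    let u : ℕ → A := fun k =>
      ((m + 1 : K) - k) • (g k * binom K (H - m + 2 * k - 2) k * dividedPow K E (m + 1 - k))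
    let v : ℕ → A := fun k => Nat.casesOn k 0 fun k =>
      g (k + 1) * (H + k + 1) * binom K (H - m + 2 * k) k * dividedPow K E (m - k)
    have mul_term : ∀ k ∈ Finset.range (m + 1),
        E * (g k * binom K (H - m + 2 * k) k * dividedPow K E (m - k)) = u k + v (k + 1) :=
      fun k hk => mul_lowering_term hHE hg (Nat.lt_succ_iff.1 (Finset.mem_range.1 hk))
    have smul_term (k : ℕ) : (m + 1 : K) • (g k *
        binom K (H - (m + 1 : ℕ) + 2 * k) k * dividedPow K E (m + 1 - k)) = u k + v k := by
      cases k with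
      | zero => simp [u, v]
      | succ j =>
        have hy : H - (m + 1 : ℕ) + 2 * (j + 1 : ℕ) = (H - m + 2 * j) + 1 := by
          push_cast; noncomm_ring
        have hy' : H - m + 2 * (j + 1 : ℕ) - 2 = H - m + 2 * j := by
          push_cast; rw [mul_add, mul_one]; abel
        have hz : H + j + 1 = H - m + 2 * j - j + algebraMap K A (m + 1) := by
          rw [map_add, map_natCast, map_one]; noncomm_ring
        simp only [u, v]
        rw [hy, hy', hz, Nat.add_sub_add_right, mul_assoc (g (j + 1)) (_ + algebraMap _ _ _),
          ← smul_mul_assoc, ← mul_smul_comm, smul_binom_add_one]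
        simp only [mul_add, add_mul, smul_mul_assoc, mul_smul_comm, Nat.cast_add, Nat.cast_one]
    rw [← smul_right_inj hm, ← smul_mul_assoc, ← mul_dividedPow, mul_assoc, ih, Finset.mul_sum,
      Finset.sum_congr rfl mul_term, Finset.smul_sum, Finset.sum_congr rfl fun k _ => smul_term k,
      Finset.sum_add_distrib, Finset.sum_add_distrib, Finset.sum_range_succ u (m + 1),
      Finset.sum_range_succ' v (m + 1)]
    simp [u, v]

lemma dividedPow_mul_dividedPow_of_sl2 {E F H : A} (hEF : E * F - F * E = H)
    (hHE : H * E - E * H = 2 * E) (hHF : H * F - F * H = -2 * F) (m n : ℕ) :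
    dividedPow K E m * dividedPow K F n = ∑ k ∈ Finset.range (m + 1),
      (if k ≤ n then dividedPow K F (n - k) else 0) *
        binom K (H - n - m + 2 * k) k * dividedPow K E (m - k) := by
  have hHE' : (H - n) * E - E * (H - n) = 2 * E := by
    rw [sub_mul, mul_sub, Nat.cast_comm, ← hHE]; abel
  have lowering (k : ℕ) : E * (if k ≤ n then dividedPow K F (n - k) else 0) =
      (if k ≤ n then dividedPow K F (n - k) else 0) * E +
        (if k + 1 ≤ n then dividedPow K F (n - (k + 1)) else 0) * (H - n + k + 1) := by
    rcases lt_trichotomy k n with h | rfl | h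
    · obtain ⟨j, rfl⟩ := Nat.exists_eq_add_of_lt h
      rw [if_pos h.le, if_pos (Nat.succ_le_of_lt h), show k + j + 1 - k = j + 1 by omega,
        show k + j + 1 - (k + 1) = j by omega, mul_dividedPow_of_sl2 hEF hHF]
      congr 2
      push_cast
      abel
    · simp
    · simp [h.not_ge, show ¬ k + 1 ≤ n by omega]
  simpa using dividedPow_mul_of_lowering hHE' lowering m

end DividedPowers

section Straightening

variable {R A S : Type*} [CommRing R] [Ring A] [Algebra R A] (f : S → ℕ → A)

/-- The product of the factors `f s n` over a word in pairs `(s, n)`. -/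
def wordProd (l : List (S × ℕ)) : A := (l.map fun p => f p.1 p.2).prod

/-- The degree of a word: the sum of its exponents. -/
def wordDegree (l : List (S × ℕ)) : ℕ := (l.map Prod.snd).sum

/-- The product of the factors `f s (m s)`, in the order of the list `L`. -/
def orderedProd (L : List S) (m : S →₀ ℕ) : A := (L.map fun s => f s (m s)).prod

variable (R) in
/-- The span of the products over all words of degree less than `d`. -/
def wordSpan (d : ℕ) : Submodule R A :=
  Submodule.span R {x | ∃ l : List (S × ℕ), wordDegree l < d ∧ x = wordProd f l}

lemma wordSpan_mono {d e : ℕ} (h : d ≤ e) : wordSpan R f d ≤ wordSpan R f e :=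
  Submodule.span_mono fun _ ⟨l, hl, hx⟩ => ⟨l, hl.trans_le h, hx⟩

lemma mul_mem_wordSpan {d e k : ℕ} {x y : A} (hx : x ∈ wordSpan R f d) (hy : y ∈ wordSpan R f e)
    (h : d + e ≤ k + 1) : x * y ∈ wordSpan R f k := by
  refine (?_ : wordSpan R f d * wordSpan R f e ≤ _) (Submodule.mul_mem_mul hx hy)
  rw [wordSpan, wordSpan, Submodule.span_mul_span, Submodule.span_le]
  rintro _ ⟨_, ⟨l, hl, rfl⟩, _, ⟨l', hl', rfl⟩, rfl⟩
  refine Submodule.subset_span ⟨l ++ l', ?_, ?_⟩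
  · simp only [wordDegree, List.map_append, List.sum_append] at *
    omega
  · simp [wordProd]

lemma factor_mem_wordSpan {s : S} {n d : ℕ} (h : n < d) : f s n ∈ wordSpan R f d :=
  Submodule.subset_span ⟨[(s, n)], by simpa [wordDegree] using h, by simp [wordProd]⟩

lemma one_mem_wordSpan {d : ℕ} (h : 0 < d) : (1 : A) ∈ wordSpan R f d :=
  Submodule.subset_span ⟨[], by simpa [wordDegree] using h, by simp [wordProd]⟩

lemma orderedProd_mem_wordSpan (L : List S) (m : S →₀ ℕ) {d : ℕ} (h : (L.map m).sum < d) :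
    orderedProd f L m ∈ wordSpan R f d := by
  refine Submodule.subset_span ⟨L.map fun s => (s, m s), ?_, ?_⟩
  · simpa [wordDegree, Function.comp_def] using h
  · simp [wordProd, orderedProd, Function.comp_def]

lemma orderedProd_congr {L : List S} {m m' : S →₀ ℕ} (h : ∀ s ∈ L, m s = m' s) :
    orderedProd f L m = orderedProd f L m' := by
  rw [orderedProd, orderedProd, List.map_congr_left fun s hs => by rw [h s hs]]

lemma orderedProd_cons (s : S) (L : List S) (m : S →₀ ℕ) :
    orderedProd f (s :: L) m = f s (m s) * orderedProd f L m := by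
  simp [orderedProd]

lemma orderedProd_add_single_of_notMem {L : List S} {s : S} (hs : s ∉ L) (m : S →₀ ℕ) (n : ℕ) :
    orderedProd f L (m + Finsupp.single s n) = orderedProd f L m :=
  orderedProd_congr f fun t ht => by
    rw [Finsupp.add_apply, Finsupp.single_eq_of_ne (ne_of_mem_of_not_mem ht hs), add_zero]

lemma orderedProd_filter_support [DecidableEq S] (h0 : ∀ s, f s 0 = 1) (L : List S) (m : S →₀ ℕ) :
    orderedProd f (L.filter (· ∈ m.support)) m = orderedProd f L m := by
  induction L with
  | nil => rfl
  | cons s L ih =>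
    by_cases hs : s ∈ m.support
    · rw [List.filter_cons_of_pos (by simpa using hs), orderedProd_cons, orderedProd_cons, ih]
    · rw [List.filter_cons_of_neg (by simpa using hs), orderedProd_cons, ih,
        Finsupp.notMem_support_iff.1 hs, h0, one_mul]

lemma orderedProd_zero (h0 : ∀ s, f s 0 = 1) (L : List S) : orderedProd f L 0 = 1 := by
  simp [orderedProd, h0]

lemma orderedProd_single (h0 : ∀ s, f s 0 = 1) {L : List S} (hL : L.Nodup) {s : S} (hs : s ∈ L)
    (n : ℕ) : orderedProd f L (Finsupp.single s n) = f s n := by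
  classical
  rw [orderedProd, List.prod_map_eq_pow_single s, List.count_eq_one_of_mem hL hs, pow_one,
    Finsupp.single_eq_same]
  intro t hts _
  rw [Finsupp.single_eq_of_ne hts, h0]

lemma sum_map_add_single {L : List S} (hL : L.Nodup) {s : S} (hs : s ∈ L) (m : S →₀ ℕ) (n : ℕ) :
    (L.map ⇑(m + Finsupp.single s n)).sum = n + (L.map m).sum := by
  classical
  rw [← List.sum_toFinset _ hL, ← List.sum_toFinset _ hL]
  simp only [Finsupp.coe_add, Pi.add_apply, Finset.sum_add_distrib, Finsupp.single_apply]
  rw [Finset.sum_ite_eq, if_pos (List.mem_toFinset.2 hs), add_comm]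

variable {f}

lemma exists_mul_orderedProd_sub_mem
    (hswap : ∀ s t m n, s ≠ t → ∃ c : R, f s m * f t n - c • (f t n * f s m) ∈ wordSpan R f (m + n))
    (hmerge : ∀ s m n, ∃ c : R, f s m * f s n - c • f s (m + n) ∈ wordSpan R f (m + n))
    {L : List S} (hL : L.Nodup) {s : S} (hs : s ∈ L) (n : ℕ) (m : S →₀ ℕ) :
    ∃ c : R, f s n * orderedProd f L m - c • orderedProd f L (m + Finsupp.single s n) ∈
      wordSpan R f (n + (L.map m).sum) := by
  classical
  induction L with
  | nil => simp at hs
  | cons t L ih =>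
    obtain ⟨htL, hL'⟩ := List.nodup_cons.1 hL
    simp only [orderedProd_cons, List.map_cons, List.sum_cons]
    by_cases hst : s = t
    · subst hst
      obtain ⟨c, hc⟩ := hmerge s n (m s)
      refine ⟨c, ?_⟩
      rw [orderedProd_add_single_of_notMem f htL, Finsupp.add_apply, Finsupp.single_eq_same,
        add_comm (m s) n, ← mul_assoc, ← smul_mul_assoc, ← sub_mul]
      exact mul_mem_wordSpan f hc (e := (L.map m).sum + 1)
        (orderedProd_mem_wordSpan f L m (Nat.lt_succ_self _)) (by omega)
    · obtain ⟨c, hc⟩ := hswap s t n (m t) hst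
      obtain ⟨c', hc'⟩ := ih hL' ((List.mem_cons.1 hs).resolve_left hst)
      refine ⟨c * c', ?_⟩
      rw [Finsupp.add_apply, Finsupp.single_eq_of_ne (Ne.symm hst), add_zero]
      have h1 := mul_mem_wordSpan f hc (orderedProd_mem_wordSpan f L m (Nat.lt_succ_self _))
        (k := n + (m t + (L.map m).sum)) (by omega)
      have h2 := mul_mem_wordSpan f (factor_mem_wordSpan f (s := t) (Nat.lt_succ_self (m t))) hc'
        (k := n + (m t + (L.map m).sum)) (by omega)
      convert add_mem h1 (Submodule.smul_mem _ c h2) using 1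
      simp only [sub_mul, mul_sub, smul_sub, mul_assoc, smul_mul_assoc, mul_smul_comm, smul_smul]
      abel

lemma exists_wordProd_sub_smul_mem
    (hswap : ∀ s t m n, s ≠ t → ∃ c : R, f s m * f t n - c • (f t n * f s m) ∈ wordSpan R f (m + n))
    (hmerge : ∀ s m n, ∃ c : R, f s m * f s n - c • f s (m + n) ∈ wordSpan R f (m + n))
    (h0 : ∀ s, f s 0 = 1)
    {L : List S} (hL : L.Nodup) (hmem : ∀ s, s ∈ L) (l : List (S × ℕ)) :
    ∃ (c : R) (m : S →₀ ℕ), (L.map m).sum = wordDegree l ∧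
      wordProd f l - c • orderedProd f L m ∈ wordSpan R f (wordDegree l) := by
  induction l with
  | nil =>
    refine ⟨1, 0, by simp [wordDegree, Finsupp.coe_zero, Pi.zero_def], ?_⟩
    simp [wordProd, orderedProd_zero f h0]
  | cons p l ih =>
    obtain ⟨c, m, hm, hc⟩ := ih
    obtain ⟨c', hc'⟩ := exists_mul_orderedProd_sub_mem hswap hmerge hL (hmem p.1) p.2 m
    have hd : wordDegree (p :: l) = p.2 + wordDegree l := by simp [wordDegree]
    refine ⟨c * c', m + Finsupp.single p.1 p.2, ?_, ?_⟩
    · rw [sum_map_add_single hL (hmem p.1), hm, hd]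
    · have h1 := mul_mem_wordSpan f (factor_mem_wordSpan f (s := p.1) (Nat.lt_succ_self p.2)) hc
        (k := p.2 + wordDegree l) (by omega)
      rw [hm] at hc'
      rw [hd]
      convert add_mem h1 (Submodule.smul_mem _ c hc') using 1
      simp only [wordProd, List.map_cons, List.prod_cons, mul_sub, smul_sub, mul_smul_comm,
        smul_smul]
      abel

theorem wordSpan_le_span_orderedProd
    (hswap : ∀ s t m n, s ≠ t → ∃ c : R, f s m * f t n - c • (f t n * f s m) ∈ wordSpan R f (m + n))
    (hmerge : ∀ s m n, ∃ c : R, f s m * f s n - c • f s (m + n) ∈ wordSpan R f (m + n))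
    (h0 : ∀ s, f s 0 = 1)
    {L : List S} (hL : L.Nodup) (hmem : ∀ s, s ∈ L) (d : ℕ) :
    wordSpan R f d ≤ Submodule.span R (Set.range (orderedProd f L)) := by
  induction d using Nat.strong_induction_on with
  | _ d ih =>
    refine Submodule.span_le.2 ?_
    rintro _ ⟨l, hl, rfl⟩
    obtain ⟨c, m, -, hc⟩ := exists_wordProd_sub_smul_mem hswap hmerge h0 hL hmem l
    simpa using add_mem (ih _ hl hc) (Submodule.smul_mem _ c (Submodule.subset_span ⟨m, rfl⟩))

end Straightening

section BinomWordSpan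

variable {K A S : Type*} [Field K] [CharZero K] [Ring A] [Algebra K A] {R : Subring K}
  {f : S → ℕ → A}

omit [CharZero K] in
lemma smul_mem_wordSpan {c : K} (hc : c ∈ R) {d : ℕ} {u : A} (hu : u ∈ wordSpan R f d) :
    c • u ∈ wordSpan R f d := Submodule.smul_mem _ (⟨c, hc⟩ : R) hu

lemma aeval_mem_wordSpan {y : A} (hy : ∀ n, binom K y n ∈ wordSpan R f (n + 1))
    {p : Polynomial K} {n : ℕ} (hp : p.natDegree ≤ n) (hv : ∀ j : ℕ, p.eval (j : K) ∈ R) :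
    Polynomial.aeval y p ∈ wordSpan R f (n + 1) := by
  obtain ⟨c, hc⟩ := exists_aeval_eq_sum_binom (A := A) R hp hv
  rw [hc]
  refine sum_mem fun k hk => smul_mem_wordSpan (c k).2 ?_
  exact wordSpan_mono _ (by simpa using hk) (hy k)

lemma binom_add_algebraMap_sub_mem_wordSpan {y : A}
    (hy : ∀ n, binom K y n ∈ wordSpan R f (n + 1)) {c : K} (hc : ∀ n, binom K c n ∈ R) (n : ℕ) :
    binom K (y + algebraMap K A c) n - binom K y n ∈ wordSpan R f n := by
  have hb (k : ℕ) : binom K (algebraMap K A c) k = algebraMap K A (binom K c k) :=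
    (map_binom (Algebra.ofId K A) c k).symm
  rw [binom_add_of_commute (Algebra.commutes c y).symm,
    ← Finset.add_sum_erase _ _ (Finset.HasAntidiagonal.mem_antidiagonal.2
      (show (n, 0).1 + (n, 0).2 = n from add_zero n))]
  simp only [binom_zero, mul_one, add_sub_cancel_left]
  refine sum_mem fun p hp => ?_
  rw [Finset.mem_erase, Finset.HasAntidiagonal.mem_antidiagonal] at hp
  have hp2 : p.2 ≠ 0 := fun h => hp.1 (Prod.ext (by simpa [h] using hp.2) h)
  rw [hb, ← Algebra.commutes, ← Algebra.smul_def]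
  exact smul_mem_wordSpan (hc _) (wordSpan_mono _ (by omega) (hy _))

lemma binom_add_algebraMap_mem_wordSpan {y : A}
    (hy : ∀ n, binom K y n ∈ wordSpan R f (n + 1)) {c : K} (hc : ∀ n, binom K c n ∈ R) (n : ℕ) :
    binom K (y + algebraMap K A c) n ∈ wordSpan R f (n + 1) := by
  simpa using add_mem
    (wordSpan_mono _ n.le_succ (binom_add_algebraMap_sub_mem_wordSpan hy hc n)) (hy n)

lemma binom_smul_mem_wordSpan {y : A} (hy : ∀ n, binom K y n ∈ wordSpan R f (n + 1)) {c : K}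
    (hc : ∀ j n : ℕ, binom K (c * j) n ∈ R) (n : ℕ) :
    binom K (c • y) n ∈ wordSpan R f (n + 1) := by
  have h := aeval_mem_wordSpan hy (n := n)
    (p := (binom K (Polynomial.X : Polynomial K) n).comp (c • Polynomial.X)) ?_ ?_
  · rwa [Polynomial.aeval_comp, map_smul, Polynomial.aeval_X, aeval_binom_X] at h
  · calc _ ≤ n * 1 := Polynomial.natDegree_comp_le.trans
          (Nat.mul_le_mul (natDegree_binom_X_le n)
            ((Polynomial.natDegree_smul_le _ _).trans Polynomial.natDegree_X_le))
      _ = n := mul_one n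
  · intro j
    rw [Polynomial.eval_comp, ← Polynomial.coe_aeval_eq_eval, aeval_binom_X]
    simpa using hc j n

lemma binom_add_mem_wordSpan {x y : A} (hxy : Commute x y)
    (hx : ∀ n, binom K x n ∈ wordSpan R f (n + 1))
    (hy : ∀ n, binom K y n ∈ wordSpan R f (n + 1)) (n : ℕ) :
    binom K (x + y) n ∈ wordSpan R f (n + 1) := by
  rw [binom_add_of_commute hxy]
  refine sum_mem fun p hp => mul_mem_wordSpan _ (hx p.1) (hy p.2) ?_
  rw [Finset.HasAntidiagonal.mem_antidiagonal] at hp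
  omega

lemma exists_binom_mul_binom_sub_smul_mem_wordSpan {y : A}
    (hy : ∀ n, binom K y n ∈ wordSpan R f (n + 1)) (m n : ℕ) :
    ∃ c : R, binom K y m * binom K y n - c • binom K y (m + n) ∈ wordSpan R f (m + n) := by
  obtain ⟨c, hc⟩ := exists_aeval_eq_sum_binom (A := A) R
    (p := binom K (Polynomial.X : Polynomial K) m * binom K (Polynomial.X : Polynomial K) n)
    (d := m + n) (Polynomial.natDegree_mul_le.trans
      (add_le_add (natDegree_binom_X_le m) (natDegree_binom_X_le n)))
    (fun j => by
      rw [Polynomial.eval_mul, eval_binom_X_natCast, eval_binom_X_natCast]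
      exact mul_mem (natCast_mem R _) (natCast_mem R _))
  have expansion := hc y
  rw [map_mul, aeval_binom_X, aeval_binom_X, Finset.sum_range_succ] at expansion
  refine ⟨c (m + n), ?_⟩
  rw [expansion, Subring.smul_def, add_sub_cancel_right]
  refine sum_mem fun k hk => smul_mem_wordSpan (c k).2 ?_
  exact wordSpan_mono _ (Nat.succ_le_of_lt (Finset.mem_range.1 hk)) (hy k)

end BinomWordSpan

section SuperEnveloping

open scoped TensorProduct

namespace LieSuperalgebra

variable {K L : Type*} [CommRing K] [AddCommGroup L] [Module K L] [LieSuperalgebra K L]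

variable (K L) in
/-- The projection of a Lie superalgebra onto its even part, as an endomorphism. -/
def evenPart : L →ₗ[K] L := (part 0).projection (part 1) isCompl

variable (K L) in
/-- The projection of a Lie superalgebra onto its odd part, as an endomorphism. -/
def oddPart : L →ₗ[K] L := (part 1).projection (part 0) isCompl.symm

lemma evenPart_mem (x : L) : evenPart K L x ∈ (part 0 : Submodule K L) :=
  Submodule.projection_apply_mem _ x

lemma oddPart_mem (x : L) : oddPart K L x ∈ (part 1 : Submodule K L) :=
  Submodule.projection_apply_mem _ x

lemma evenPart_add_oddPart (x : L) : evenPart K L x + oddPart K L x = x :=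
  Submodule.projection_add_projection_eq_self _ x

variable {i j k : ZMod 2} {x y z : L}

lemma evenPart_of_mem_zero (hx : x ∈ (part 0 : Submodule K L)) : evenPart K L x = x :=
  Submodule.projection_apply_of_mem_left _ hx

lemma oddPart_of_mem_zero (hx : x ∈ (part 0 : Submodule K L)) : oddPart K L x = 0 :=
  Submodule.projection_apply_of_mem_right _ hx

lemma evenPart_of_mem_one (hx : x ∈ (part 1 : Submodule K L)) : evenPart K L x = 0 :=
  Submodule.projection_apply_of_mem_right _ hx

lemma oddPart_of_mem_one (hx : x ∈ (part 1 : Submodule K L)) : oddPart K L x = x :=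
  Submodule.projection_apply_of_mem_left _ hx

lemma bracket_eq_neg_smul (hx : x ∈ (part i : Submodule K L)) (hy : y ∈ (part j : Submodule K L)) :
    bracket (K := K) x y = -((-1 : K) ^ (i.val * j.val) • bracket (K := K) y x) :=
  eq_neg_of_add_eq_zero_left (skew hx hy)

lemma bracket_bracket_sub_of_mem (hx : x ∈ (part i : Submodule K L))
    (hy : y ∈ (part j : Submodule K L)) (hz : z ∈ (part k : Submodule K L)) :
    bracket (K := K) x (bracket (K := K) y z) -
        (-1 : K) ^ (i.val * j.val) • bracket (K := K) y (bracket (K := K) x z) =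
      bracket (K := K) (bracket (K := K) x y) z := by
  have h := jacobi hx hy hz
  rw [bracket_eq_neg_smul hz (bracket_mem hx hy), bracket_eq_neg_smul hz hx] at h
  rcases D21.parity_cases i with rfl | rfl <;> rcases D21.parity_cases j with rfl | rfl <;>
    rcases D21.parity_cases k with rfl | rfl <;>
    simp only [ZMod.val_one, show (1 + 1 : ZMod 2).val = 0 from rfl,
      ZMod.val_zero, add_zero, zero_add, mul_zero, mul_one, pow_zero, pow_one,
      one_smul, neg_smul, map_neg, neg_neg] at h ⊢ <;>
    first
    | rw [← sub_eq_zero, ← h]; abel1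
    | rw [← sub_eq_zero, ← neg_eq_zero, ← h]; abel1

lemma bracket_bracket_sub (hx : x ∈ (part i : Submodule K L)) (hy : y ∈ (part j : Submodule K L))
    (z : L) :
    bracket (K := K) x (bracket (K := K) y z) -
        (-1 : K) ^ (i.val * j.val) • bracket (K := K) y (bracket (K := K) x z) =
      bracket (K := K) (bracket (K := K) x y) z := by
  have h0 := bracket_bracket_sub_of_mem hx hy (evenPart_mem (K := K) z)
  have h1 := bracket_bracket_sub_of_mem hx hy (oddPart_mem (K := K) z)
  rw [← evenPart_add_oddPart (K := K) z]
  simp only [map_add, smul_add, ← h0, ← h1]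
  abel

end LieSuperalgebra

namespace SuperEnveloping

open LieSuperalgebra

variable {K L A : Type*} [CommRing K] [AddCommGroup L] [Module K L] [LieSuperalgebra K L]
  [Ring A] [Algebra K A]

/-- The universal property of the universal enveloping superalgebra. By super antisymmetry the
relation for an odd element followed by an even one is implied. -/
def lift (g : L →ₗ[K] A)
    (h00 : ∀ x ∈ (part 0 : Submodule K L), ∀ y ∈ (part 0 : Submodule K L),
      g x * g y - g y * g x = g (bracket (K := K) x y))
    (h01 : ∀ x ∈ (part 0 : Submodule K L), ∀ y ∈ (part 1 : Submodule K L),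
      g x * g y - g y * g x = g (bracket (K := K) x y))
    (h11 : ∀ x ∈ (part 1 : Submodule K L), ∀ y ∈ (part 1 : Submodule K L),
      g x * g y + g y * g x = g (bracket (K := K) x y)) :
    SuperEnveloping K L →ₐ[K] A :=
  RingQuot.liftAlgHom K ⟨TensorAlgebra.lift K g, by
    rintro _ _ @⟨i, j, x, y, hx, hy⟩
    simp only [map_sub, map_smul, map_mul, TensorAlgebra.lift_ι_apply]
    rcases D21.parity_cases i with rfl | rfl <;> rcases D21.parity_cases j with rfl | rfl
    · simpa using h00 x hx y hy
    · simpa using h01 x hx y hy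
    · rw [bracket_eq_neg_smul hx hy]
      simp [← h01 y hy x hx]
    · simpa [ZMod.val_one] using h11 x hx y hy⟩

@[simp] lemma lift_ι (g : L →ₗ[K] A) (h00) (h01) (h11) (x : L) :
    lift g h00 h01 h11 (ι K L x) = g x := by
  have h : lift g h00 h01 h11 (mkAlgHom K L (TensorAlgebra.ι K x)) =
      TensorAlgebra.lift K g (TensorAlgebra.ι K x) :=
    RingQuot.liftAlgHom_mkAlgHom_apply _ _ _ _
  rwa [TensorAlgebra.lift_ι_apply] at h

lemma algHom_ext {φ ψ : SuperEnveloping K L →ₐ[K] A} (h : ∀ x, φ (ι K L x) = ψ (ι K L x)) :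
    φ = ψ :=
  RingQuot.ringQuot_ext' _ _ _ <| TensorAlgebra.hom_ext <| LinearMap.ext h

variable {i j : ZMod 2} {x y : L}

lemma ι_mul_sub_smul (hx : x ∈ (part i : Submodule K L)) (hy : y ∈ (part j : Submodule K L)) :
    ι K L x * ι K L y - (-1 : K) ^ (i.val * j.val) • (ι K L y * ι K L x) =
      ι K L (bracket (K := K) x y) := by
  have h := RingQuot.mkAlgHom_rel K (SuperEnvelopingRel.mk hx hy)
  rwa [map_sub, map_smul, map_mul, map_mul] at h

lemma ι_mul_sub_of_even_left (hx : x ∈ (part 0 : Submodule K L))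
    (hy : y ∈ (part j : Submodule K L)) :
    ι K L x * ι K L y - ι K L y * ι K L x = ι K L (bracket (K := K) x y) := by
  simpa using ι_mul_sub_smul hx hy

lemma ι_mul_add_of_odd (hx : x ∈ (part 1 : Submodule K L)) (hy : y ∈ (part 1 : Submodule K L)) :
    ι K L x * ι K L y + ι K L y * ι K L x = ι K L (bracket (K := K) x y) := by
  simpa [ZMod.val_one] using ι_mul_sub_smul hx hy

variable (K L) in
/-- The counit (augmentation) of the universal enveloping superalgebra. -/
def counit : SuperEnveloping K L →ₐ[K] K := lift 0 (by simp) (by simp) (by simp)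

@[simp] lemma counit_ι (x : L) : counit K L (ι K L x) = 0 := lift_ι _ _ _ _ _

variable (K L) in
/-- The parity automorphism of the universal enveloping superalgebra: `1` on even elements of the
Lie superalgebra, `-1` on odd ones. -/
def parityHom : SuperEnveloping K L →ₐ[K] SuperEnveloping K L :=
  lift (ι K L ∘ₗ (evenPart K L - oddPart K L))
    (fun x hx y hy => by
      have hxy : bracket (K := K) x y ∈ part 0 := bracket_mem hx hy
      simp [evenPart_of_mem_zero, oddPart_of_mem_zero, hx, hy, hxy, ι_mul_sub_of_even_left hx hy])
    (fun x hx y hy => by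
      have hxy : bracket (K := K) x y ∈ part 1 := bracket_mem hx hy
      simp [evenPart_of_mem_zero, oddPart_of_mem_zero, evenPart_of_mem_one, oddPart_of_mem_one,
        hx, hy, hxy, ← ι_mul_sub_of_even_left hx hy, add_comm, ← sub_eq_add_neg])
    (fun x hx y hy => by
      have hxy : bracket (K := K) x y ∈ part 0 := bracket_mem hx hy
      simp [evenPart_of_mem_zero, oddPart_of_mem_zero, evenPart_of_mem_one, oddPart_of_mem_one,
        hx, hy, hxy, ← ι_mul_add_of_odd hx hy])

lemma parityHom_ι (x : L) :
    parityHom K L (ι K L x) = ι K L (evenPart K L x) - ι K L (oddPart K L x) := by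
  simp [parityHom]

lemma parityHom_ι_of_even (hx : x ∈ (part 0 : Submodule K L)) :
    parityHom K L (ι K L x) = ι K L x := by
  simp [parityHom_ι, evenPart_of_mem_zero hx, oddPart_of_mem_zero hx]

lemma parityHom_ι_of_odd (hx : x ∈ (part 1 : Submodule K L)) :
    parityHom K L (ι K L x) = -ι K L x := by
  simp [parityHom_ι, evenPart_of_mem_one hx, oddPart_of_mem_one hx]

@[simp] lemma parityHom_parityHom (u : SuperEnveloping K L) :
    parityHom K L (parityHom K L u) = u := by
  suffices h : (parityHom K L).comp (parityHom K L) = AlgHom.id K _ from DFunLike.congr_fun h u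
  refine algHom_ext fun x => ?_
  rw [AlgHom.comp_apply, AlgHom.id_apply, parityHom_ι, map_sub,
    parityHom_ι_of_even (evenPart_mem x), parityHom_ι_of_odd (oddPart_mem x), sub_neg_eq_add,
    ← map_add, evenPart_add_oddPart]

variable (K L) in
/-- The adjoint representation, extended to the universal enveloping superalgebra. -/
def adjoint : SuperEnveloping K L →ₐ[K] Module.End K L :=
  lift bracket
    (fun x hx y hy => LinearMap.ext fun z => by simpa using bracket_bracket_sub hx hy z)
    (fun x hx y hy => LinearMap.ext fun z => by simpa using bracket_bracket_sub hx hy z)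
    (fun x hx y hy => LinearMap.ext fun z => by
      simpa [ZMod.val_one] using bracket_bracket_sub hx hy z)

@[simp] lemma adjoint_ι (x : L) : adjoint K L (ι K L x) = bracket x := lift_ι _ _ _ _ _

lemma ι_injective (h : Function.Injective (bracket (K := K) (L := L))) :
    Function.Injective (ι K L) :=
  .of_comp (f := adjoint K L) <| by simpa only [Function.comp_def, adjoint_ι] using h

variable (K L) in
/-- The action of the universal enveloping superalgebra on the left factor of its tensor square. -/
def leftAct : SuperEnveloping K L →ₐ[K]
    Module.End K (SuperEnveloping K L ⊗[K] SuperEnveloping K L) :=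
  (Module.End.rTensorAlgHom K _ _).comp (Algebra.lmul K _)

variable (K L) in
/-- The action of the universal enveloping superalgebra on the right factor of its tensor square. -/
def rightAct : SuperEnveloping K L →ₐ[K]
    Module.End K (SuperEnveloping K L ⊗[K] SuperEnveloping K L) :=
  (Module.End.lTensorAlgHom K _ _).comp (Algebra.lmul K _)

@[simp] lemma leftAct_tmul (w u v : SuperEnveloping K L) :
    leftAct K L w (u ⊗ₜ v) = (w * u) ⊗ₜ v := rfl

@[simp] lemma rightAct_tmul (w u v : SuperEnveloping K L) :
    rightAct K L w (u ⊗ₜ v) = u ⊗ₜ (w * v) := rfl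

lemma commute_leftAct_rightAct (w w' : SuperEnveloping K L) :
    Commute (leftAct K L w) (rightAct K L w') :=
  TensorProduct.ext' fun u v => by simp

variable (K L) in
/-- The action `x (u ⊗ v) = x u ⊗ v + (-1)^{|x||u|} u ⊗ x v` of a Lie superalgebra on the tensor
square of its universal enveloping superalgebra. -/
def tensorAct : L →ₗ[K] Module.End K (SuperEnveloping K L ⊗[K] SuperEnveloping K L) :=
  (leftAct K L).toLinearMap ∘ₗ ι K L + (rightAct K L).toLinearMap ∘ₗ ι K L ∘ₗ evenPart K L +
    LinearMap.mulRight K (LinearMap.rTensor _ (parityHom K L).toLinearMap) ∘ₗ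
      (rightAct K L).toLinearMap ∘ₗ ι K L ∘ₗ oddPart K L

lemma tensorAct_of_even (hx : x ∈ (part 0 : Submodule K L)) :
    tensorAct K L x = leftAct K L (ι K L x) + rightAct K L (ι K L x) := by
  simp [tensorAct, evenPart_of_mem_zero hx, oddPart_of_mem_zero hx]

lemma tensorAct_tmul_of_even (hx : x ∈ (part 0 : Submodule K L)) (u v : SuperEnveloping K L) :
    tensorAct K L x (u ⊗ₜ v) = (ι K L x * u) ⊗ₜ v + u ⊗ₜ (ι K L x * v) := by
  simp [tensorAct_of_even hx]

lemma tensorAct_tmul_of_odd (hx : x ∈ (part 1 : Submodule K L)) (u v : SuperEnveloping K L) :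
    tensorAct K L x (u ⊗ₜ v) = (ι K L x * u) ⊗ₜ v + parityHom K L u ⊗ₜ (ι K L x * v) := by
  simp [tensorAct, evenPart_of_mem_one hx, oddPart_of_mem_one hx]

variable (K L) in
/-- The action of the universal enveloping superalgebra on its tensor square. It carries the same
information as the super comultiplication `u ↦ u (1 ⊗ 1)`, without needing a super tensor product
of algebras. -/
def tensorRep : SuperEnveloping K L →ₐ[K]
    Module.End K (SuperEnveloping K L ⊗[K] SuperEnveloping K L) :=
  lift (tensorAct K L)
    (fun x hx y hy => TensorProduct.ext' fun u v => by
      have hxy : bracket (K := K) x y ∈ part 0 := bracket_mem hx hy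
      simp only [LinearMap.sub_apply, Module.End.mul_apply, tensorAct_tmul_of_even hx,
        tensorAct_tmul_of_even hy, tensorAct_tmul_of_even hxy, map_add,
        ← ι_mul_sub_of_even_left hx hy, sub_mul, TensorProduct.tmul_sub, TensorProduct.sub_tmul,
        mul_assoc]
      abel)
    (fun x hx y hy => TensorProduct.ext' fun u v => by
      have hxy : bracket (K := K) x y ∈ part 1 := bracket_mem hx hy
      simp only [LinearMap.sub_apply, Module.End.mul_apply, tensorAct_tmul_of_even hx,
        tensorAct_tmul_of_odd hy, tensorAct_tmul_of_odd hxy, map_add, map_mul,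
        ← ι_mul_sub_of_even_left hx hy, sub_mul, TensorProduct.tmul_sub, TensorProduct.sub_tmul,
        mul_assoc, parityHom_ι_of_even hx]
      abel)
    (fun x hx y hy => TensorProduct.ext' fun u v => by
      have hxy : bracket (K := K) x y ∈ part 0 := bracket_mem hx hy
      simp only [LinearMap.add_apply, Module.End.mul_apply, tensorAct_tmul_of_odd hx,
        tensorAct_tmul_of_odd hy, tensorAct_tmul_of_even hxy, map_add, map_mul,
        ← ι_mul_add_of_odd hx hy, add_mul, TensorProduct.tmul_add, TensorProduct.add_tmul,
        mul_assoc, parityHom_ι_of_odd hx, parityHom_ι_of_odd hy, parityHom_parityHom,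
        neg_mul, TensorProduct.neg_tmul]
      abel)

@[simp] lemma tensorRep_ι (x : L) : tensorRep K L (ι K L x) = tensorAct K L x := lift_ι _ _ _ _ _

end SuperEnveloping

end SuperEnveloping

section Independence

open Finset.HasAntidiagonal (antidiagonal mem_antidiagonal)

open SuperEnveloping

open scoped TensorProduct

lemma sum_antidiagonal_eq_sum_erase {S M : Type*} [DecidableEq S] [AddCommMonoid M] (s : S)
    (m : S →₀ ℕ) (F : (S →₀ ℕ) × (S →₀ ℕ) → M) :
    ∑ p ∈ antidiagonal m, F p = ∑ q ∈ antidiagonal (m.erase s), ∑ k ∈ antidiagonal (m s),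
      F (q.1 + Finsupp.single s k.1, q.2 + Finsupp.single s k.2) := by
  rw [← Finset.sum_product']
  refine Finset.sum_nbij' (fun p => ((p.1.erase s, p.2.erase s), (p.1 s, p.2 s)))
    (fun q => (q.1.1 + Finsupp.single s q.2.1, q.1.2 + Finsupp.single s q.2.2)) ?_ ?_ ?_ ?_ ?_
  · rintro ⟨p₁, p₂⟩ hp
    simp only [Finset.mem_product, mem_antidiagonal] at hp ⊢
    simp [← hp]
  · rintro ⟨⟨q₁, q₂⟩, k₁, k₂⟩ hq
    simp only [Finset.mem_product, mem_antidiagonal] at hq ⊢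
    rw [add_add_add_comm, hq.1, ← Finsupp.single_add, hq.2, Finsupp.erase_add_single]
  · rintro ⟨p₁, p₂⟩ -
    simp [Finsupp.erase_add_single]
  · rintro ⟨⟨q₁, q₂⟩, k₁, k₂⟩ hq
    simp only [Finset.mem_product, mem_antidiagonal] at hq
    obtain ⟨h₁, h₂⟩ : q₁ s = 0 ∧ q₂ s = 0 := by simpa using DFunLike.congr_fun hq.1 s
    simp [Finsupp.erase_add, Finsupp.erase_of_notMem_support, h₁, h₂]
  · rintro ⟨p₁, p₂⟩ -
    simp [Finsupp.erase_add_single]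

variable {K L : Type*} [Field K] [AddCommGroup L] [Module K L] [LieSuperalgebra K L]

/-- A divided power sequence of parity `p` in the universal enveloping superalgebra: `f 0 = 1` and
`Δ (f n) = ∑ f i ⊗ f (n - i)`, where the comultiplication `Δ` is expressed through `tensorRep`.
For odd `p` the last condition is imposed on `f 0` and `f 1` only. -/
structure IsDividedPowerSequence (p : ZMod 2) (f : ℕ → SuperEnveloping K L) : Prop where
  zero : f 0 = 1
  counit_eq_zero : ∀ n ≠ 0, counit K L (f n) = 0
  parityHom_eq : ∀ n, parityHom K L (f n) = (-1 : Kˣ) ^ (p.val * n) • f n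
  tensorRep_tmul : ∀ n, (p = 1 → n ≤ 1) → ∀ (u v : SuperEnveloping K L) (c : Kˣ),
    parityHom K L u = c • u → tensorRep K L (f n) (u ⊗ₜ v) =
      ∑ q ∈ antidiagonal n, c ^ (p.val * q.2) • ((f q.1 * u) ⊗ₜ[K] (f q.2 * v))

section Examples

variable [CharZero K] {x : L}

lemma isDividedPowerSequence_dividedPow_of_even
    (hx : x ∈ (LieSuperalgebra.part 0 : Submodule K L)) :
    IsDividedPowerSequence 0 (dividedPow K (ι K L x)) where
  zero := dividedPow_zero _
  counit_eq_zero n hn := by simp [dividedPow, hn]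
  parityHom_eq n := by simp [map_dividedPow, parityHom_ι_of_even hx]
  tensorRep_tmul n _ u v c _ := by
    rw [map_dividedPow, tensorRep_ι, tensorAct_of_even hx,
      dividedPow_add_of_commute (commute_leftAct_rightAct _ _)]
    simp [← map_dividedPow]

lemma isDividedPowerSequence_binom_of_even
    (hx : x ∈ (LieSuperalgebra.part 0 : Submodule K L)) :
    IsDividedPowerSequence 0 (binom K (ι K L x)) where
  zero := binom_zero _
  counit_eq_zero n hn := by
    obtain ⟨n, rfl⟩ := Nat.exists_eq_succ_of_ne_zero hn
    simp [binom, descPochhammer_succ_left]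
  parityHom_eq n := by simp [map_binom, parityHom_ι_of_even hx]
  tensorRep_tmul n _ u v c _ := by
    rw [map_binom, tensorRep_ι, tensorAct_of_even hx,
      binom_add_of_commute (commute_leftAct_rightAct _ _)]
    simp [← map_binom]

end Examples

lemma isDividedPowerSequence_dividedPow_of_odd {x : L}
    (hx : x ∈ (LieSuperalgebra.part 1 : Submodule K L)) :
    IsDividedPowerSequence 1 (dividedPow K (ι K L x)) where
  zero := dividedPow_zero _
  counit_eq_zero n hn := by simp [dividedPow, hn]
  parityHom_eq n := by
    simp [map_dividedPow, parityHom_ι_of_odd hx, dividedPow_neg, ZMod.val_one, Units.smul_def]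
  tensorRep_tmul n hn u v c hu := by
    have := hn rfl
    interval_cases n
    · simp
    · simp [tensorAct_tmul_of_odd hx, hu, Finset.Nat.antidiagonal_succ, ZMod.val_one,
        Units.smul_def, TensorProduct.smul_tmul', add_comm]

variable {S : Type*} {p : S → ZMod 2} {f : S → ℕ → SuperEnveloping K L}

lemma exists_parityHom_orderedProd (hf : ∀ s, IsDividedPowerSequence (p s) (f s)) (l : List S)
    (m : S →₀ ℕ) : ∃ c : Kˣ, parityHom K L (orderedProd f l m) = c • orderedProd f l m := by
  induction l with
  | nil => exact ⟨1, by simp [orderedProd]⟩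
  | cons s l ih =>
    obtain ⟨c, hc⟩ := ih
    exact ⟨(-1) ^ ((p s).val * m s) * c, by
      rw [orderedProd_cons, map_mul, (hf s).parityHom_eq, hc, smul_mul_smul_comm]⟩

variable (p) in
/-- A family of exponents that is at most `1` at the indices of parity `1`. -/
def IsSuperExponent (m : S →₀ ℕ) : Prop := ∀ s, p s = 1 → m s ≤ 1

lemma IsSuperExponent.of_le {m m' : S →₀ ℕ} (hm : IsSuperExponent p m) (h : m' ≤ m) :
    IsSuperExponent p m' := fun s hs => (h s).trans (hm s hs)

lemma exists_tensorRep_orderedProd [DecidableEq S]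
    (hf : ∀ s, IsDividedPowerSequence (p s) (f s)) {l : List S} (hl : l.Nodup) :
    ∃ ε : (S →₀ ℕ) × (S →₀ ℕ) → Kˣ, ∀ m : S →₀ ℕ, IsSuperExponent p m → (∀ s ∈ m.support, s ∈ l) →
      tensorRep K L (orderedProd f l m) (1 ⊗ₜ 1) =
        ∑ q ∈ antidiagonal m, ε q • (orderedProd f l q.1 ⊗ₜ[K] orderedProd f l q.2) := by
  induction l with
  | nil =>
    refine ⟨1, fun m _ hm => ?_⟩
    obtain rfl : m = 0 := Finsupp.ext fun s => by simpa using hm s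
    simp [orderedProd]
  | cons s l ih =>
    obtain ⟨hs, hl⟩ := List.nodup_cons.1 hl
    obtain ⟨ε, hε⟩ := ih hl
    choose c hc using exists_parityHom_orderedProd hf l
    refine ⟨fun q => ε (q.1.erase s, q.2.erase s) * c (q.1.erase s) ^ ((p s).val * q.2 s),
      fun m hm hml => ?_⟩
    have herase : orderedProd f l m = orderedProd f l (m.erase s) := by
      conv_lhs => rw [← m.erase_add_single s, orderedProd_add_single_of_notMem f hs]
    have h := hε (m.erase s) (hm.of_le fun t => by
      rw [Finsupp.erase_apply]; split_ifs <;> simp) fun t ht => by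
      rw [Finsupp.support_erase, Finset.mem_erase] at ht
      exact (List.mem_cons.1 (hml t ht.2)).resolve_left ht.1
    rw [orderedProd_cons, map_mul, Module.End.mul_apply, herase, h, map_sum,
      sum_antidiagonal_eq_sum_erase s m]
    refine Finset.sum_congr rfl fun q hq => ?_
    obtain ⟨h₁, h₂⟩ : q.1 s = 0 ∧ q.2 s = 0 := by
      simpa using DFunLike.congr_fun (mem_antidiagonal.1 hq) s
    rw [Units.smul_def, map_smul, (hf s).tensorRep_tmul _ (hm s) _ _ _ (hc _), ← Units.smul_def,
      Finset.smul_sum]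
    refine Finset.sum_congr rfl fun k _ => ?_
    simp [orderedProd_cons, orderedProd_add_single_of_notMem f hs, Finsupp.erase_add,
      Finsupp.erase_of_notMem_support, h₁, h₂, smul_smul]

/-- The convolution product of linear forms on the universal enveloping superalgebra, dual to the
super comultiplication. -/
def convolution (φ ψ : SuperEnveloping K L →ₗ[K] K) : SuperEnveloping K L →ₗ[K] K :=
  LinearMap.mul' K K ∘ₗ TensorProduct.map φ ψ ∘ₗ
    LinearMap.applyₗ (1 ⊗ₜ[K] 1) ∘ₗ (tensorRep K L).toLinearMap

lemma exists_convolution_orderedProd [DecidableEq S]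
    (hf : ∀ s, IsDividedPowerSequence (p s) (f s)) {l : List S} (hl : l.Nodup)
    (hmem : ∀ s, s ∈ l) :
    ∃ ε : (S →₀ ℕ) × (S →₀ ℕ) → Kˣ, ∀ m : S →₀ ℕ, IsSuperExponent p m → ∀ φ ψ,
      convolution φ ψ (orderedProd f l m) = ∑ q ∈ antidiagonal m,
        ε q • (φ (orderedProd f l q.1) * ψ (orderedProd f l q.2)) := by
  obtain ⟨ε, hε⟩ := exists_tensorRep_orderedProd hf hl
  refine ⟨ε, fun m hm φ ψ => ?_⟩
  simp [convolution, hε m hm fun s _ => hmem s, Units.smul_def]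

variable (p f) in
/-- A linear form that does not vanish on the ordered product with exponents `i`, but vanishes on
all the other ordered products of at most the same degree. -/
def IsSeparatingForm (l : List S) (φ : SuperEnveloping K L →ₗ[K] K) (i : S →₀ ℕ) : Prop :=
  φ (orderedProd f l i) ≠ 0 ∧ ∀ j : S →₀ ℕ, IsSuperExponent p j → j.degree ≤ i.degree → j ≠ i →
    φ (orderedProd f l j) = 0

lemma IsSeparatingForm.convolution (hf : ∀ s, IsDividedPowerSequence (p s) (f s)) {l : List S}
    (hl : l.Nodup) (hmem : ∀ s, s ∈ l) {φ ψ : SuperEnveloping K L →ₗ[K] K} {i₁ i₂ : S →₀ ℕ}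
    (hφ : IsSeparatingForm p f l φ i₁) (hψ : IsSeparatingForm p f l ψ i₂)
    (hi : IsSuperExponent p (i₁ + i₂)) :
    IsSeparatingForm p f l (convolution φ ψ) (i₁ + i₂) := by
  classical
  obtain ⟨ε, hε⟩ := exists_convolution_orderedProd hf hl hmem
  have hvan (q : (S →₀ ℕ) × (S →₀ ℕ)) (hq : IsSuperExponent p (q.1 + q.2))
      (hdeg : (q.1 + q.2).degree ≤ (i₁ + i₂).degree) (hne : q ≠ (i₁, i₂)) :
      ε q • (φ (orderedProd f l q.1) * ψ (orderedProd f l q.2)) = 0 := by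
    rw [map_add, map_add] at hdeg
    have hq₁ := hq.of_le (self_le_add_right q.1 q.2)
    have hq₂ := hq.of_le (self_le_add_left q.2 q.1)
    by_cases h₁ : q.1 = i₁
    · rw [hψ.2 q.2 hq₂ (by rw [h₁] at hdeg; omega) fun h₂ => hne (Prod.ext h₁ h₂), mul_zero,
        smul_zero]
    · rcases le_or_gt q.1.degree i₁.degree with hd | hd
      · rw [hφ.2 q.1 hq₁ hd h₁, zero_mul, smul_zero]
      · rw [hψ.2 q.2 hq₂ (by omega) (by rintro h₂; rw [h₂] at hdeg; omega), mul_zero, smul_zero]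
  refine ⟨?_, fun j hj hdeg hne => ?_⟩
  · rw [hε _ hi, Finset.sum_eq_single_of_mem (i₁, i₂) (mem_antidiagonal.2 rfl)]
    · exact (smul_ne_zero_iff_ne _).2 (mul_ne_zero hφ.1 hψ.1)
    · intro q hq hne
      have hq := mem_antidiagonal.1 hq
      exact hvan q (hq ▸ hi) (by rw [hq]) hne
  · rw [hε j hj]
    refine Finset.sum_eq_zero fun q hq => ?_
    obtain rfl := mem_antidiagonal.1 hq
    exact hvan q hj hdeg (by rintro rfl; exact hne rfl)

lemma isSeparatingForm_counit (hf : ∀ s, IsDividedPowerSequence (p s) (f s)) (l : List S) :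
    IsSeparatingForm p f l (counit K L).toLinearMap 0 := by
  refine ⟨by simp [orderedProd_zero f fun s => (hf s).zero], fun j _ hj hj0 => ?_⟩
  exact absurd ((Finsupp.degree_eq_zero_iff j).1 (by simpa using hj)) hj0

lemma exists_isSeparatingForm_single (hf : ∀ s, IsDividedPowerSequence (p s) (f s))
    (hli : LinearIndependent K fun s => f s 1) {l : List S} (hl : l.Nodup) (hmem : ∀ s, s ∈ l)
    (s : S) : ∃ φ, IsSeparatingForm p f l φ (Finsupp.single s 1) := by
  classical
  obtain ⟨G, hG⟩ := LinearMap.exists_leftInverse_of_injective _ (LinearMap.ker_eq_bot.2 hli)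
  have hG (t : S) : G (f t 1) = Finsupp.single t 1 := by
    simpa using DFunLike.congr_fun hG (Finsupp.single t 1)
  have hzero := orderedProd_zero f (fun s => (hf s).zero) l
  have hone (t : S) := orderedProd_single f (fun s => (hf s).zero) hl (hmem t) 1
  have hcounit (t : S) := (hf t).counit_eq_zero 1 one_ne_zero
  let θ : SuperEnveloping K L →ₗ[K] K := Finsupp.lapply s ∘ₗ G
  refine ⟨θ - θ 1 • (counit K L).toLinearMap, ?_, fun j _ hj hjs => ?_⟩
  · simp [θ, hone, hcounit, hG]
  · rw [Finsupp.degree_single, Nat.le_one_iff_eq_zero_or_eq_one] at hj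
    rcases hj with hj | hj
    · simp [(Finsupp.degree_eq_zero_iff j).1 hj, hzero]
    · obtain ⟨t, rfl⟩ : j ∈ Set.range fun t : S => Finsupp.single t 1 := by
        rwa [Finsupp.range_single_one]
      have hts : t ≠ s := by rintro rfl; exact hjs rfl
      simp [θ, hone, hcounit, hG, hts]

lemma exists_isSeparatingForm (hf : ∀ s, IsDividedPowerSequence (p s) (f s))
    (hli : LinearIndependent K fun s => f s 1) {l : List S} (hl : l.Nodup) (hmem : ∀ s, s ∈ l)
    (i : S →₀ ℕ) (hi : IsSuperExponent p i) : ∃ φ, IsSeparatingForm p f l φ i := by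
  induction i using Finsupp.induction_linear with
  | zero => exact ⟨_, isSeparatingForm_counit hf l⟩
  | add i j hi' hj' =>
    obtain ⟨φ, hφ⟩ := hi' (hi.of_le (self_le_add_right i j))
    obtain ⟨ψ, hψ⟩ := hj' (hi.of_le (self_le_add_left j i))
    exact ⟨_, hφ.convolution hf hl hmem hψ hi⟩
  | single s n =>
    induction n with
    | zero => exact ⟨_, by simpa using isSeparatingForm_counit hf l⟩
    | succ n ih =>
      rw [Finsupp.single_add] at hi ⊢
      obtain ⟨φ, hφ⟩ := ih (hi.of_le (self_le_add_right _ _))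
      obtain ⟨ψ, hψ⟩ := exists_isSeparatingForm_single hf hli hl hmem s
      exact ⟨_, hφ.convolution hf hl hmem hψ hi⟩

theorem linearIndependent_orderedProd (hf : ∀ s, IsDividedPowerSequence (p s) (f s))
    (hli : LinearIndependent K fun s => f s 1) {l : List S} (hl : l.Nodup) (hmem : ∀ s, s ∈ l) :
    LinearIndependent K fun m : {m : S →₀ ℕ // IsSuperExponent p m} => orderedProd f l m := by
  rw [linearIndependent_iff]
  intro c hc
  by_contra hne
  obtain ⟨i, hi, hmax⟩ := c.support.exists_max_image (fun m => m.1.degree)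
    (Finsupp.support_nonempty_iff.2 hne)
  obtain ⟨φ, hφi, hφ⟩ := exists_isSeparatingForm hf hli hl hmem i.1 i.2
  have h := congrArg φ hc
  rw [Finsupp.linearCombination_apply, Finsupp.sum, map_sum, map_zero,
    Finset.sum_eq_single_of_mem i hi, map_smul, smul_eq_mul] at h
  · exact (mul_ne_zero (Finsupp.mem_support_iff.1 hi) hφi) h
  · intro j hj hji
    rw [map_smul, hφ j.1 j.2 (hmax j hj) (fun h => hji (Subtype.ext h)), smul_zero]

end Independence

section RootSystem

namespace D21

variable {K : Type*} [Field K] {a : K}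

lemma bracket_injective [NeZero (2 : K)] : Function.Injective (bracket a) := by
  refine (injective_iff_map_eq_zero _).2 fun x hx => ?_
  have h2 : (2 : K) ≠ 0 := NeZero.ne 2
  have bracket_evenVec (s t u v : Fin 3) : (bracket a x (evenVec a s t)).even u v = 0 := by
    rw [hx]; rfl
  have coord_0 (s : Fin 3) : x.even s 0 = 0 := by
    simpa [bracket_even, evenVec, oddBracket_zero_right, evenBracket, sl2Bracket, h2]
      using bracket_evenVec s 1 s 2
  have coord_1 (s : Fin 3) : x.even s 1 = 0 := by
    simpa [bracket_even, evenVec, oddBracket_zero_right, evenBracket, sl2Bracket, h2]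
      using bracket_evenVec s 0 s 2
  have coord_2 (s : Fin 3) : x.even s 2 = 0 := by
    simpa [bracket_even, evenVec, oddBracket_zero_right, evenBracket, sl2Bracket, h2]
      using bracket_evenVec s 0 s 0
  have even_eq_zero : x.even = 0 := funext fun s => funext3 (coord_0 s) (coord_1 s) (coord_2 s)
  refine D21.ext even_eq_zero ?_
  funext i j k
  have h : (bracket a x (evenVec a 0 2)).odd i j k = 0 := by rw [hx]; rfl
  rcases fin2_cases i with rfl | rfl <;>
    simpa [bracket_odd, even_eq_zero, evenVec, oddAct, sl2Act] using h

lemma sign_mem (R : Subring K) {e : K} (he : e = 1 ∨ e = -1) : e ∈ R := by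
  rcases he with rfl | rfl
  exacts [one_mem R, neg_mem (one_mem R)]

lemma self_mem_intRing : a ∈ intRing a := Subring.subset_closure rfl

lemma mem_oddRoots_iff_coord (α : Module.Dual K (cartan a)) :
    α ∈ oddRoots a ↔ ∀ s, α (cartanVec a s) = 1 ∨ α (cartanVec a s) = -1 := by
  rw [mem_oddRoots_iff]
  constructor
  · rintro ⟨i, j, k, rfl⟩ s
    rcases fin3_cases s with rfl | rfl | rfl
    · rcases fin2_cases i with rfl | rfl <;> simp [eps_cartanVec]
    · rcases fin2_cases j with rfl | rfl <;> simp [eps_cartanVec]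
    · rcases fin2_cases k with rfl | rfl <;> simp [eps_cartanVec]
  · intro h
    have exists_sign (s : Fin 3) : ∃ i : Fin 2, α (cartanVec a s) = (![1, -1] i : K) := by
      rcases h s with h | h
      · exact ⟨0, by simpa using h⟩
      · exact ⟨1, by simpa using h⟩
    choose i hi using exists_sign
    refine ⟨i 0, i 1, i 2, dual_ext a fun s => ?_⟩
    rcases fin3_cases s with rfl | rfl | rfl <;> simp [eps_cartanVec, hi]

section CharZero

variable [CharZero K] {α β γ : Module.Dual K (cartan a)}

lemma mem_evenRoots_iff_coord :
    α ∈ evenRoots a ↔ ∃ (s : Fin 3) (e : K), (e = 1 ∨ e = -1) ∧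
      ∀ t, α (cartanVec a t) = if t = s then 2 * e else 0 := by
  rw [mem_evenRoots_iff]
  constructor
  · rintro ⟨s, rfl | rfl⟩
    · exact ⟨s, 1, Or.inl rfl, fun t => by simp [eps_cartanVec, eq_comm]⟩
    · exact ⟨s, -1, Or.inr rfl, fun t => by
        by_cases h : t = s <;> simp [eps_cartanVec, h, eq_comm (a := s) (b := t)]⟩
  · rintro ⟨s, e, rfl | rfl, h⟩
    · exact ⟨s, Or.inl (dual_ext a fun t => by simp [eps_cartanVec, h, eq_comm])⟩
    · exact ⟨s, Or.inr (dual_ext a fun t => by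
        by_cases hts : t = s <;> simp [eps_cartanVec, h, hts, eq_comm (a := s) (b := t)])⟩

instance finite_roots : Finite (roots a) := by
  refine Set.Finite.subset (Set.Finite.union
    (Set.finite_range fun s : Fin 3 => 2 • eps a s) (Set.Finite.union
    (Set.finite_range fun s : Fin 3 => -(2 • eps a s))
    (Set.finite_range fun p : Fin 2 × Fin 2 × Fin 2 => (![1, -1] p.1 : K) • eps a 0 +
      (![1, -1] p.2.1 : K) • eps a 1 + (![1, -1] p.2.2 : K) • eps a 2))) ?_
  rintro α (h | h)
  · obtain ⟨s, rfl | rfl⟩ := (mem_evenRoots_iff a α).1 h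
    exacts [Or.inl ⟨s, rfl⟩, Or.inr (Or.inl ⟨s, rfl⟩)]
  · obtain ⟨i, j, k, rfl⟩ := (mem_oddRoots_iff a α).1 h
    exact Or.inr (Or.inr ⟨(i, j, k), rfl⟩)

lemma coord_of_mem_evenRoots (hα : α ∈ evenRoots a) (t : Fin 3) :
    α (cartanVec a t) = 0 ∨ α (cartanVec a t) = 2 ∨ α (cartanVec a t) = -2 := by
  obtain ⟨s, e, rfl | rfl, h⟩ := mem_evenRoots_iff_coord.1 hα <;> by_cases hts : t = s <;>
    simp [h, hts]

lemma coord_ne_zero_of_mem_oddRoots (hγ : γ ∈ oddRoots a) (s : Fin 3) :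
    γ (cartanVec a s) ≠ 0 := by
  rcases (mem_oddRoots_iff_coord γ).1 hγ s with h | h <;> simp [h]

lemma notMem_evenRoots_of_coord_ne_zero {s t : Fin 3} (hst : s ≠ t)
    (hs : α (cartanVec a s) ≠ 0) (ht : α (cartanVec a t) ≠ 0) : α ∉ evenRoots a := by
  intro hα
  obtain ⟨u, e, -, h⟩ := mem_evenRoots_iff_coord.1 hα
  have eq_u {v : Fin 3} (hv : α (cartanVec a v) ≠ 0) : v = u := by
    by_contra hvu
    exact hv ((h v).trans (if_neg hvu))
  exact hst ((eq_u hs).trans (eq_u ht).symm)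

lemma notMem_oddRoots_of_mem_evenRoots (hα : α ∈ evenRoots a) : α ∉ oddRoots a := fun h =>
  notMem_evenRoots_of_coord_ne_zero (s := 0) (t := 1) (by decide)
    (coord_ne_zero_of_mem_oddRoots h 0) (coord_ne_zero_of_mem_oddRoots h 1) hα

lemma ne_zero_of_mem_oddRoots (hγ : γ ∈ oddRoots a) : γ ≠ 0 := by
  rintro rfl
  exact coord_ne_zero_of_mem_oddRoots hγ 0 rfl

lemma neg_mem_evenRoots (hα : α ∈ evenRoots a) : -α ∈ evenRoots a := by
  obtain ⟨s, e, he, h⟩ := mem_evenRoots_iff_coord.1 hα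
  refine mem_evenRoots_iff_coord.2 ⟨s, -e, by rcases he with rfl | rfl <;> simp, fun t => ?_⟩
  by_cases hts : t = s <;> simp [h, hts]

lemma even_add_even_notMem_roots (hα : α ∈ evenRoots a) (hβ : β ∈ evenRoots a)
    (h : α + β ≠ 0) : α + β ∉ roots a := by
  obtain ⟨s, e, he, hs⟩ := mem_evenRoots_iff_coord.1 hα
  obtain ⟨t, e', he', ht⟩ := mem_evenRoots_iff_coord.1 hβ
  rintro (hαβ | hαβ)
  · by_cases hst : s = t
    · subst hst
      have coord_s : (α + β) (cartanVec a s) = 2 * e + 2 * e' := by simp [hs, ht]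
      have e_add_ne_zero : e + e' ≠ 0 := fun hee => h <| dual_ext a fun u => by
        by_cases hu : u = s <;> simp [hs, ht, hu, ← mul_add, hee]
      have := coord_of_mem_evenRoots hαβ s
      rw [coord_s] at this
      obtain rfl : e = e' := by
        rcases he with rfl | rfl <;> rcases he' with rfl | rfl <;> simp at e_add_ne_zero ⊢
      rcases he with rfl | rfl <;> norm_num at this
    · refine notMem_evenRoots_of_coord_ne_zero hst ?_ ?_ hαβ
      · rcases he with rfl | rfl <;> simp [hs, ht, hst]
      · rcases he' with rfl | rfl <;> simp [hs, ht, Ne.symm hst]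
  · obtain ⟨u, hu, hu'⟩ := Fin.exists_ne_and_ne_of_two_lt s t (by norm_num)
    exact coord_ne_zero_of_mem_oddRoots hαβ u (by simp [hs, ht, hu, hu'])

lemma odd_add_self_ne_zero (hγ : γ ∈ oddRoots a) : γ + γ ≠ 0 := by
  rw [← two_smul K]
  exact smul_ne_zero two_ne_zero (ne_zero_of_mem_oddRoots hγ)

lemma odd_add_self_notMem_roots (hγ : γ ∈ oddRoots a) : γ + γ ∉ roots a := by
  rintro (h | h)
  · refine notMem_evenRoots_of_coord_ne_zero (s := 0) (t := 1) (by decide) ?_ ?_ h <;>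
      simpa using coord_ne_zero_of_mem_oddRoots hγ _
  · have coord_sum := (mem_oddRoots_iff_coord _).1 h 0
    rw [LinearMap.add_apply] at coord_sum
    rcases (mem_oddRoots_iff_coord _).1 hγ 0 with coord | coord <;> rw [coord] at coord_sum <;>
      norm_num at coord_sum

section EvenOdd

lemma exists_two_coords_odd_add_zsmul_even (hα : α ∈ evenRoots a) (hγ : γ ∈ oddRoots a) (k : ℤ) :
    ∃ s t : Fin 3, s ≠ t ∧ (γ + k • α) (cartanVec a s) ≠ 0 ∧
      (γ + k • α) (cartanVec a t) ≠ 0 := by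
  obtain ⟨u, e, -, hu⟩ := mem_evenRoots_iff_coord.1 hα
  obtain ⟨s, hsu, -⟩ := Fin.exists_ne_and_ne_of_two_lt u u (by norm_num)
  obtain ⟨t, htu, hts⟩ := Fin.exists_ne_and_ne_of_two_lt u s (by norm_num)
  refine ⟨s, t, hts.symm, ?_, ?_⟩
  · simpa [hu, hsu] using coord_ne_zero_of_mem_oddRoots hγ s
  · simpa [hu, htu] using coord_ne_zero_of_mem_oddRoots hγ t

lemma odd_add_zsmul_even_ne_zero (hα : α ∈ evenRoots a) (hγ : γ ∈ oddRoots a) (k : ℤ) :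
    γ + k • α ≠ 0 := by
  obtain ⟨s, -, -, hs, -⟩ := exists_two_coords_odd_add_zsmul_even hα hγ k
  exact fun h => hs (by rw [h]; rfl)

lemma odd_add_zsmul_even_notMem_evenRoots (hα : α ∈ evenRoots a) (hγ : γ ∈ oddRoots a) (k : ℤ) :
    γ + k • α ∉ evenRoots a := by
  obtain ⟨s, t, hst, hs, ht⟩ := exists_two_coords_odd_add_zsmul_even hα hγ k
  exact notMem_evenRoots_of_coord_ne_zero hst hs ht

lemma exists_sign_odd_add_zsmul_even_mem_oddRoots_iff (hα : α ∈ evenRoots a)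
    (hγ : γ ∈ oddRoots a) :
    ∃ d : ℤ, (d = 1 ∨ d = -1) ∧ ∀ k : ℤ, γ + k • α ∈ oddRoots a ↔ k = 0 ∨ k = d := by
  obtain ⟨s, e, he, hs⟩ := mem_evenRoots_iff_coord.1 hα
  have mem_iff (k : ℤ) : γ + k • α ∈ oddRoots a ↔
      γ (cartanVec a s) + k * (2 * e) = 1 ∨ γ (cartanVec a s) + k * (2 * e) = -1 := by
    have coord_s : (γ + k • α) (cartanVec a s) = γ (cartanVec a s) + k * (2 * e) := by simp [hs]
    rw [mem_oddRoots_iff_coord, ← coord_s]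
    refine ⟨fun h => h s, fun h t => ?_⟩
    by_cases ht : t = s
    · rwa [ht]
    · simpa [hs, ht] using (mem_oddRoots_iff_coord γ).1 hγ t
  have solve (x y : ℤ) (hx : x = 1 ∨ x = -1) (hy : y = 1 ∨ y = -1) (k : ℤ) :
      ((x : K) + k * (2 * (y : K)) = 1 ∨ (x : K) + k * (2 * (y : K)) = -1) ↔
        k = 0 ∨ k = -(x * y) := by
    norm_cast
    rcases hx with rfl | rfl <;> rcases hy with rfl | rfl <;> omega
  have exists_int {x : K} (hx : x = 1 ∨ x = -1) : ∃ y : ℤ, (y = 1 ∨ y = -1) ∧ x = y := by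
    rcases hx with rfl | rfl
    exacts [⟨1, by simp⟩, ⟨-1, by simp⟩]
  obtain ⟨x, hx, hγs⟩ := exists_int ((mem_oddRoots_iff_coord γ).1 hγ s)
  obtain ⟨y, hy, rfl⟩ := exists_int he
  refine ⟨-(x * y), ?_, fun k => by rw [mem_iff, hγs, solve x y hx hy]⟩
  rcases hx with rfl | rfl <;> rcases hy with rfl | rfl <;> simp

lemma even_add_odd_ne_zero (hα : α ∈ evenRoots a) (hγ : γ ∈ oddRoots a) : α + γ ≠ 0 := by
  simpa [add_comm] using odd_add_zsmul_even_ne_zero hα hγ 1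

lemma even_add_odd_notMem_evenRoots (hα : α ∈ evenRoots a) (hγ : γ ∈ oddRoots a) :
    α + γ ∉ evenRoots a := by
  simpa [add_comm] using odd_add_zsmul_even_notMem_evenRoots hα hγ 1

lemma even_add_even_add_odd_notMem_roots (hα : α ∈ evenRoots a) (hγ : γ ∈ oddRoots a) :
    α + (α + γ) ∉ roots a := by
  have eq_zsmul : α + (α + γ) = γ + (2 : ℤ) • α := by rw [two_smul]; abel
  rw [eq_zsmul]
  rintro (h | h)
  · exact odd_add_zsmul_even_notMem_evenRoots hα hγ 2 h
  · obtain ⟨d, hd, mem_iff⟩ := exists_sign_odd_add_zsmul_even_mem_oddRoots_iff hα hγ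
    rw [mem_iff] at h
    omega

lemma isString_of_even_add_odd (hα : α ∈ evenRoots a) (hγ : γ ∈ oddRoots a)
    (h : α + γ ∈ roots a) : IsString a α γ 0 1 := by
  have mem_iff (k : ℤ) : γ + k • α ∈ oddRoots a ↔ k = 0 ∨ k = 1 := by
    obtain ⟨d, hd, mem_iff⟩ := exists_sign_odd_add_zsmul_even_mem_oddRoots_iff hα hγ
    have one_eq : (1 : ℤ) = 0 ∨ 1 = d := (mem_iff 1).1 <| by
      rw [one_smul, add_comm]; exact h.resolve_left (even_add_odd_notMem_evenRoots hα hγ)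
    obtain rfl : 1 = d := by simpa using one_eq
    exact mem_iff k
  ext δ
  constructor
  · rintro ⟨hδ, k, rfl⟩
    have hk := (mem_iff k).1 <| (hδ.resolve_right (odd_add_zsmul_even_ne_zero hα hγ k)).resolve_left
      (odd_add_zsmul_even_notMem_evenRoots hα hγ k)
    exact ⟨k, by push_cast; omega, by push_cast; omega, rfl⟩
  · rintro ⟨k, hk, hk', rfl⟩
    refine ⟨Or.inl (Or.inr ((mem_iff k).2 ?_)), k, rfl⟩
    push_cast at hk hk'
    omega

end EvenOdd

lemma sigma_ne_zero (ha0 : a ≠ 0) (ha1 : a ≠ -1) (s : Fin 3) : sigma a s ≠ 0 := by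
  have one_add_ne_zero : 1 + a ≠ 0 := fun h => ha1 (by linear_combination h)
  rcases fin3_cases s with rfl | rfl | rfl
  · simpa [sigma, ← neg_add_rev, add_comm a] using one_add_ne_zero
  · simp [sigma]
  · simpa [sigma] using ha0

lemma two_mul_sigma_mem_intRing (s : Fin 3) : 2 * sigma a s ∈ intRing a := by
  rcases fin3_cases s with rfl | rfl | rfl
  · have : 2 * sigma a 0 = -(1 + a) := by simp only [sigma, Matrix.cons_val]; ring
    rw [this]
    exact neg_mem (add_mem (one_mem _) self_mem_intRing)
  · simp [sigma]
  · have : 2 * sigma a 2 = a := by simp only [sigma, Matrix.cons_val]; ring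
    rw [this]
    exact self_mem_intRing

lemma form_self_of_odd (hγ : γ ∈ oddRoots a) : form a γ γ = 0 := by
  have h (s : Fin 3) : γ (cartanVec a s) * γ (cartanVec a s) = 1 :=
    mul_self_eq_one_iff.2 ((mem_oddRoots_iff_coord γ).1 hγ s)
  simp only [form, mul_assoc, h, Fin.sum_univ_three, sigma, Matrix.cons_val]
  ring

lemma form_self_of_even (ha0 : a ≠ 0) (ha1 : a ≠ -1) (hα : α ∈ evenRoots a) :
    form a α α ≠ 0 := by
  obtain ⟨s, e, he, hs⟩ := mem_evenRoots_iff_coord.1 hα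
  have form_eq : form a α α = sigma a s * (2 * e) * (2 * e) := by
    simp only [form, hs, mul_ite, mul_zero, ite_mul, zero_mul, Finset.sum_ite_eq',
      Finset.mem_univ, if_true]
  have e_ne_zero : 2 * e ≠ 0 := by rcases he with rfl | rfl <;> simp
  rw [form_eq]
  exact mul_ne_zero (mul_ne_zero (sigma_ne_zero ha0 ha1 s) e_ne_zero) e_ne_zero

lemma coroot_of_even (ha0 : a ≠ 0) (ha1 : a ≠ -1) (hα : α ∈ evenRoots a) :
    ∃ (s : Fin 3) (e : K), (e = 1 ∨ e = -1) ∧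
      (∀ t, α (cartanVec a t) = if t = s then 2 * e else 0) ∧ coroot a α = e • cartanVec a s := by
  obtain ⟨s, h⟩ := (mem_evenRoots_iff a α).1 hα
  have hc := coroot_two_eps a s (sigma_ne_zero ha0 ha1 s)
  rcases h with rfl | rfl
  · exact ⟨s, 1, Or.inl rfl, fun t => by simp [eps_cartanVec, eq_comm], by rw [hc, one_smul]⟩
  · exact ⟨s, -1, Or.inr rfl, fun t => by
      by_cases h : t = s <;> simp [eps_cartanVec, h, eq_comm (a := s) (b := t)],
      by rw [coroot_neg, hc, neg_one_smul]⟩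

lemma root_apply_self_coroot (ha0 : a ≠ 0) (ha1 : a ≠ -1) (hα : α ∈ evenRoots a) :
    α (coroot a α) = 2 := by
  obtain ⟨s, e, he, hs, hc⟩ := coroot_of_even ha0 ha1 hα
  rw [hc, map_smul, hs]
  rcases he with rfl | rfl <;> simp

lemma root_apply_coroot_mem_of_even (ha0 : a ≠ 0) (ha1 : a ≠ -1) (hα : α ∈ roots a)
    (hβ : β ∈ evenRoots a) : α (coroot a β) ∈ intRing a := by
  obtain ⟨s, e, he, -, hc⟩ := coroot_of_even ha0 ha1 hβ
  rw [hc, map_smul, smul_eq_mul]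
  refine mul_mem (sign_mem _ he) ?_
  rcases hα with hα | hα
  · have two_mem : (2 : K) ∈ intRing a := ofNat_mem _ 2
    rcases coord_of_mem_evenRoots hα s with h | h | h <;> rw [h]
    exacts [zero_mem _, two_mem, neg_mem two_mem]
  · exact sign_mem _ ((mem_oddRoots_iff_coord α).1 hα s)

lemma apply_coroot_of_odd (α : Module.Dual K (cartan a)) (hβ : β ∈ oddRoots a) :
    α (coroot a β) = -∑ s, sigma a s * β (cartanVec a s) * α (cartanVec a s) := by
  rw [coroot, if_pos (form_self_of_odd hβ), map_neg]
  simp only [dualVec, map_sum, map_smul, smul_eq_mul]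

lemma even_apply_coroot_mem_of_odd (hα : α ∈ evenRoots a) (hβ : β ∈ oddRoots a) :
    α (coroot a β) ∈ intRing a := by
  obtain ⟨t, e, he, ht⟩ := mem_evenRoots_iff_coord.1 hα
  have apply_eq : α (coroot a β) = -((2 * sigma a t) * (β (cartanVec a t) * e)) := by
    simp only [apply_coroot_of_odd α hβ, ht, mul_ite, mul_zero, Finset.sum_ite_eq',
      Finset.mem_univ, if_true]
    ring
  rw [apply_eq]
  exact neg_mem (mul_mem (two_mul_sigma_mem_intRing t)
    (mul_mem (sign_mem _ ((mem_oddRoots_iff_coord β).1 hβ t)) (sign_mem _ he)))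

lemma odd_apply_coroot_mem_of_odd (hα : α ∈ oddRoots a) (hβ : β ∈ oddRoots a) :
    α (coroot a β) ∈ intRing a := by
  have prod_sign (s : Fin 3) : β (cartanVec a s) * α (cartanVec a s) = 1 ∨
      β (cartanVec a s) * α (cartanVec a s) = -1 := by
    rcases (mem_oddRoots_iff_coord β).1 hβ s with h | h <;>
      rcases (mem_oddRoots_iff_coord α).1 hα s with h' | h' <;> simp [h, h']
  have half_sub_mem {x y : K} (hx : x = 1 ∨ x = -1) (hy : y = 1 ∨ y = -1) :
      (x - y) / 2 ∈ intRing a := by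
    rcases hx with rfl | rfl <;> rcases hy with rfl | rfl <;> norm_num
  have sum_eq (x y z : K) : -(-(1 + a) / 2 * x + 1 / 2 * y + a / 2 * z) =
      (x - y) / 2 + a * ((x - z) / 2) := by ring
  simp only [apply_coroot_of_odd α hβ, mul_assoc, Fin.sum_univ_three, sigma, Matrix.cons_val]
  rw [sum_eq]
  exact add_mem (half_sub_mem (prod_sign 0) (prod_sign 1))
    (mul_mem self_mem_intRing (half_sub_mem (prod_sign 0) (prod_sign 2)))

lemma root_apply_coroot_mem (ha0 : a ≠ 0) (ha1 : a ≠ -1) (hα : α ∈ roots a) (hβ : β ∈ roots a) :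
    α (coroot a β) ∈ intRing a := by
  rcases hβ with hβ | hβ
  · exact root_apply_coroot_mem_of_even ha0 ha1 hα hβ
  · rcases hα with hα | hα
    · exact even_apply_coroot_mem_of_odd hα hβ
    · exact odd_apply_coroot_mem_of_odd hα hβ

end CharZero

end D21

end RootSystem

section CommutationRelations

namespace D21

open SuperEnveloping

variable {K : Type*} [Field K] {a : K}

lemma intRing_le_binomRing : intRing a ≤ binomRing a := fun p hp =>
  Subring.subset_closure ⟨p, hp, 1, by simp⟩

lemma binom_mem_binomRing {p : K} (hp : p ∈ intRing a) (n : ℕ) : binom K p n ∈ binomRing a :=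
  Subring.subset_closure ⟨p, hp, n, rfl⟩

lemma cartan_mem_part_zero (h : cartan a) : (h : D21 a) ∈ part a 0 :=
  ((mem_cartan_iff a _).1 h.2).1

lemma commute_toU_cartan (h h' : cartan a) :
    Commute (toU a (h : D21 a)) (toU a (h' : D21 a)) := by
  have commutator := ι_mul_sub_of_even_left (cartan_mem_part_zero h) (cartan_mem_part_zero h')
  exact sub_eq_zero.1 (commutator.trans <|
    (congrArg (toU a) (bracket_cartan_cartan a h.2 h'.2)).trans (map_zero _))

/-- The filtration of the Kostant superalgebra by degree, each factor `f s n` having degree `n`: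
the `ℤ_a`-span of the products of factors of total degree less than `d`. -/
abbrev filt (H : Fin 3 → cartan a) (X : roots a → D21 a) (d : ℕ) : Submodule (binomRing a) (U a) :=
  wordSpan (binomRing a) (factor a H X) d

variable {H : Fin 3 → cartan a} {X : roots a → D21 a}

lemma toU_X_mem_filt (α : roots a) : toU a (X α) ∈ filt H X 2 := by
  simpa only [factor, Sum.elim_inl, dividedPow_one] using
    factor_mem_wordSpan (R := binomRing a) (factor a H X) (s := Sum.inl α) one_lt_two

lemma factor_zero (s : roots a ⊕ Fin 3) : factor a H X s 0 = 1 := by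
  rcases s with α | i
  exacts [dividedPow_zero _, binom_zero _]

section CharZero

variable [CharZero K]

lemma binom_mem_filt {h : cartan a} (hh : h ∈ Submodule.span (intRing a) (Set.range H)) :
    ∀ n, binom K (toU a (h : D21 a)) n ∈ filt H X (n + 1) := by
  have binom_H_mem (i : Fin 3) (n : ℕ) :
      binom K (toU a (H i : D21 a)) n ∈ filt H X (n + 1) :=
    factor_mem_wordSpan (factor a H X) (s := Sum.inr i) n.lt_succ_self
  have binom_smul_mem {c : K} (hc : c ∈ intRing a) {x : cartan a}
      (hx : ∀ n, binom K (toU a (x : D21 a)) n ∈ filt H X (n + 1)) (n : ℕ) :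
      binom K (c • toU a (x : D21 a)) n ∈ filt H X (n + 1) :=
    binom_smul_mem_wordSpan hx
      (fun j n => binom_mem_binomRing (mul_mem hc (natCast_mem _ j)) n) n
  induction hh using Submodule.span_induction with
  | mem x hx => obtain ⟨i, rfl⟩ := hx; exact binom_H_mem i
  | zero => simpa using binom_smul_mem (zero_mem _) (binom_H_mem 0)
  | add x y _ _ hx hy =>
    rw [Submodule.coe_add, map_add]
    exact binom_add_mem_wordSpan (commute_toU_cartan x y) hx hy
  | smul c x _ hx =>
    rw [Subring.smul_def, Submodule.coe_smul, map_smul]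
    exact binom_smul_mem c.2 hx

lemma exists_factor_mul_factor_sub_smul_mem (s : roots a ⊕ Fin 3) (m n : ℕ) : ∃ c : binomRing a,
    factor a H X s m * factor a H X s n - c • factor a H X s (m + n) ∈ filt H X (m + n) := by
  rcases s with α | i
  · refine ⟨((m + n).choose m : binomRing a), ?_⟩
    simp only [factor, Sum.elim_inl, Subring.smul_def, Subring.coe_natCast,
      dividedPow_mul_dividedPow, sub_self, zero_mem]
  · exact exists_binom_mul_binom_sub_smul_mem_wordSpan
      (binom_mem_filt (Submodule.subset_span ⟨i, rfl⟩)) m n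

end CharZero

namespace IsChevalleyBasis

lemma bracket_cartan (hB : IsChevalleyBasis a H X) (h : cartan a) (α : roots a) :
    bracket a h (X α) = α.1 h • X α := by
  have mem_span : h ∈ Submodule.span K (Set.range H) := by rw [hB.span_H]; trivial
  induction mem_span using Submodule.span_induction with
  | mem x hx => obtain ⟨i, rfl⟩ := hx; exact hB.bracket_H_X i α
  | zero => simp
  | add x y _ _ hx hy => simp [hx, hy, add_smul]
  | smul c x _ hx => simp [hx, mul_smul]

lemma X_ne_zero (hB : IsChevalleyBasis a H X) (α : roots a) : X α ≠ 0 :=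
  hB.linearIndependent.ne_zero (Sum.inr α)

lemma toU_cartan_mul_sub (hB : IsChevalleyBasis a H X) (h : cartan a) (α : roots a) :
    toU a (h : D21 a) * toU a (X α) - toU a (X α) * toU a (h : D21 a) = α.1 h • toU a (X α) := by
  rw [← map_smul, ← hB.bracket_cartan]
  rcases hB.homogeneous α with hα | hα <;>
    exact ι_mul_sub_of_even_left (cartan_mem_part_zero h) hα

lemma coroot_mem_span (hB : IsChevalleyBasis a H X) (α : roots a) :
    coroot a α.1 ∈ Submodule.span (intRing a) (Set.range H) := by
  rw [hB.span_coroot]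
  exact Submodule.subset_span ⟨α.1, α.2, rfl⟩

section CharZero

variable [CharZero K] {α β γ δ : roots a}

lemma X_mem_part_zero (hB : IsChevalleyBasis a H X) (hα : α.1 ∈ evenRoots a) : X α ∈ part a 0 :=
  (hB.homogeneous α).resolve_right fun h => notMem_oddRoots_of_mem_evenRoots hα
    ⟨X α, h, hB.X_ne_zero α, fun h => hB.bracket_cartan h α⟩

lemma X_mem_part_one (hB : IsChevalleyBasis a H X) (hγ : γ.1 ∈ oddRoots a) : X γ ∈ part a 1 :=
  (hB.homogeneous γ).resolve_left fun h => notMem_oddRoots_of_mem_evenRoots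
    ⟨ne_zero_of_mem_oddRoots hγ, X γ, h, hB.X_ne_zero γ, fun h => hB.bracket_cartan h γ⟩ hγ

lemma toU_mul_sub_of_even_of_even (hB : IsChevalleyBasis a H X) (hα : α.1 ∈ evenRoots a)
    (hβ : β.1 ∈ evenRoots a) :
    toU a (X α) * toU a (X β) - toU a (X β) * toU a (X α) = toU a (bracket a (X α) (X β)) :=
  ι_mul_sub_of_even_left (hB.X_mem_part_zero hα) (hB.X_mem_part_zero hβ)

lemma toU_mul_sub_of_even_of_odd (hB : IsChevalleyBasis a H X) (hα : α.1 ∈ evenRoots a)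
    (hγ : γ.1 ∈ oddRoots a) :
    toU a (X α) * toU a (X γ) - toU a (X γ) * toU a (X α) = toU a (bracket a (X α) (X γ)) :=
  ι_mul_sub_of_even_left (hB.X_mem_part_zero hα) (hB.X_mem_part_one hγ)

lemma toU_mul_add_of_odd_of_odd (hB : IsChevalleyBasis a H X) (hγ : γ.1 ∈ oddRoots a)
    (hδ : δ.1 ∈ oddRoots a) :
    toU a (X γ) * toU a (X δ) + toU a (X δ) * toU a (X γ) = toU a (bracket a (X γ) (X δ)) :=
  ι_mul_add_of_odd (hB.X_mem_part_one hγ) (hB.X_mem_part_one hδ)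

lemma toU_mul_self_of_odd (hB : IsChevalleyBasis a H X) (hγ : γ.1 ∈ oddRoots a) :
    toU a (X γ) * toU a (X γ) = 0 := by
  have anticommutator := hB.toU_mul_add_of_odd_of_odd hγ hγ
  rw [hB.bracket_of_not_root γ γ (odd_add_self_ne_zero hγ) (odd_add_self_notMem_roots hγ),
    map_zero, ← two_smul K] at anticommutator
  exact (smul_eq_zero.1 anticommutator).resolve_left two_ne_zero

lemma factor_odd_eq_zero (hB : IsChevalleyBasis a H X) (hγ : γ.1 ∈ oddRoots a) {n : ℕ}
    (hn : 2 ≤ n) : factor a H X (Sum.inl γ) n = 0 := by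
  obtain ⟨k, rfl⟩ := Nat.exists_eq_add_of_le hn
  simp [factor, dividedPow, pow_add, pow_two, hB.toU_mul_self_of_odd hγ]

lemma toU_coroot_mem_filt (hB : IsChevalleyBasis a H X) (α : roots a) :
    toU a (coroot a α.1 : D21 a) ∈ filt H X 2 := by
  simpa only [binom_one] using binom_mem_filt (X := X) (hB.coroot_mem_span α) 1

lemma commute_of_even_of_even (hB : IsChevalleyBasis a H X) (hα : α.1 ∈ evenRoots a)
    (hβ : β.1 ∈ evenRoots a) (h : β.1 ≠ -α.1) : Commute (toU a (X α)) (toU a (X β)) := by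
  have add_ne_zero : α.1 + β.1 ≠ 0 := fun h0 => h (eq_neg_of_add_eq_zero_right h0)
  refine sub_eq_zero.1 ?_
  rw [hB.toU_mul_sub_of_even_of_even hα hβ, hB.bracket_of_not_root α β add_ne_zero
    (even_add_even_notMem_roots hα hβ add_ne_zero), map_zero]

lemma root_apply_H_mem (hB : IsChevalleyBasis a H X) (ha0 : a ≠ 0) (ha1 : a ≠ -1)
    (α : roots a) (i : Fin 3) : α.1 (H i) ∈ intRing a := by
  have mem_span : H i ∈ Submodule.span (intRing a) (coroot a '' roots a) := by
    rw [← hB.span_coroot]; exact Submodule.subset_span ⟨i, rfl⟩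
  generalize H i = x at mem_span
  induction mem_span using Submodule.span_induction with
  | mem x hx => obtain ⟨β, hβ, rfl⟩ := hx; exact root_apply_coroot_mem ha0 ha1 α.2 hβ
  | zero => simp
  | add x y _ _ hx hy => rw [map_add]; exact add_mem hx hy
  | smul c x _ hx =>
    rw [Subring.smul_def, map_smul, smul_eq_mul]
    exact mul_mem c.2 hx

lemma dividedPow_mul_dividedPow_neg (hB : IsChevalleyBasis a H X) (ha0 : a ≠ 0) (ha1 : a ≠ -1)
    (hα : α.1 ∈ evenRoots a) (h : β.1 = -α.1) (m n : ℕ) :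
    dividedPow K (toU a (X α)) m * dividedPow K (toU a (X β)) n =
      ∑ k ∈ Finset.range (m + 1),
        (if k ≤ n then dividedPow K (toU a (X β)) (n - k) else 0) *
          binom K (toU a (coroot a α.1 : D21 a) - n - m + 2 * k) k *
            dividedPow K (toU a (X α)) (m - k) := by
  have hβ : β.1 ∈ evenRoots a := h ▸ neg_mem_evenRoots hα
  have root_coroot := root_apply_self_coroot ha0 ha1 hα
  have hEF := hB.toU_mul_sub_of_even_of_even hα hβ
  rw [hB.bracket_neg α β h, rootSign,
    if_neg fun h => notMem_oddRoots_of_mem_evenRoots hα h.1, one_smul] at hEF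
  have hHE := hB.toU_cartan_mul_sub (coroot a α.1) α
  have hHF := hB.toU_cartan_mul_sub (coroot a α.1) β
  rw [root_coroot, Algebra.smul_def, map_ofNat] at hHE
  rw [h, LinearMap.neg_apply, root_coroot, Algebra.smul_def, map_neg, map_ofNat] at hHF
  exact dividedPow_mul_dividedPow_of_sl2 hEF hHE hHF m n

lemma dividedPow_mul_sub_mem_filt_of_eq_neg (hB : IsChevalleyBasis a H X) (ha0 : a ≠ 0)
    (ha1 : a ≠ -1) (hα : α.1 ∈ evenRoots a) (h : β.1 = -α.1) (m n : ℕ) :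
    dividedPow K (toU a (X α)) m * dividedPow K (toU a (X β)) n -
      dividedPow K (toU a (X β)) n * dividedPow K (toU a (X α)) m ∈ filt H X (m + n) := by
  have dividedPow_mem (γ : roots a) (j : ℕ) :
      dividedPow K (toU a (X γ)) j ∈ filt H X (j + 1) :=
    factor_mem_wordSpan (factor a H X) (s := Sum.inl γ) (Nat.lt_succ_self _)
  have binom_mem (k : ℕ) :
      binom K (toU a (coroot a α.1 : D21 a) - n - m + 2 * k) k ∈ filt H X (k + 1) := by
    have shift_mem : (-n - m + 2 * k : K) ∈ intRing a :=
      add_mem (sub_mem (neg_mem (natCast_mem _ n)) (natCast_mem _ m))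
        (mul_mem (ofNat_mem _ 2) (natCast_mem _ k))
    convert binom_add_algebraMap_mem_wordSpan (binom_mem_filt (X := X) (hB.coroot_mem_span α))
      (binom_mem_binomRing shift_mem) k using 2
    simp only [map_add, map_sub, map_neg, map_mul, map_natCast, map_ofNat]
    abel
  rw [hB.dividedPow_mul_dividedPow_neg ha0 ha1 hα h, Finset.sum_range_succ']
  simp only [zero_le, if_true, Nat.sub_zero, binom_zero, mul_one, add_sub_cancel_right]
  refine sum_mem fun k hk => ?_
  have hk : k < m := Finset.mem_range.1 hk
  split_ifs with hkn
  · exact mul_mem_wordSpan _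
      (mul_mem_wordSpan _ (dividedPow_mem β _) (binom_mem (k + 1)) (k := n + 1) (by omega))
      (dividedPow_mem α _) (by omega)
  · simp only [zero_mul, zero_mem]

lemma dividedPow_mul_sub_mem_filt_of_even_of_even (hB : IsChevalleyBasis a H X) (ha0 : a ≠ 0)
    (ha1 : a ≠ -1) (hα : α.1 ∈ evenRoots a) (hβ : β.1 ∈ evenRoots a) (m n : ℕ) :
    dividedPow K (toU a (X α)) m * dividedPow K (toU a (X β)) n -
      dividedPow K (toU a (X β)) n * dividedPow K (toU a (X α)) m ∈ filt H X (m + n) := by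
  by_cases h : β.1 = -α.1
  · exact hB.dividedPow_mul_sub_mem_filt_of_eq_neg ha0 ha1 hα h m n
  · have commute := hB.commute_of_even_of_even hα hβ h
    rw [(commute_dividedPow_left (commute_dividedPow_right commute n) m).eq, sub_self]
    exact zero_mem _

lemma dividedPow_mul_toU_sub_mem_filt_of_even_of_odd (hB : IsChevalleyBasis a H X)
    (ha0 : a ≠ 0) (ha1 : a ≠ -1) (hα : α.1 ∈ evenRoots a) (hγ : γ.1 ∈ oddRoots a) (m : ℕ) :
    dividedPow K (toU a (X α)) m * toU a (X γ) - toU a (X γ) * dividedPow K (toU a (X α)) m ∈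
      filt H X (m + 1) := by
  have commutator := hB.toU_mul_sub_of_even_of_odd hα hγ
  by_cases h : α.1 + γ.1 ∈ roots a
  · rcases m with _ | m
    · simp
    have hδ : α.1 + γ.1 ∈ oddRoots a := h.resolve_left (even_add_odd_notMem_evenRoots hα hγ)
    obtain ⟨c, hc, bracket_eq⟩ := hB.bracket_of_string α γ ⟨_, h⟩ rfl
      (Or.inl (form_self_of_even ha0 ha1 hα)) 0 1 (isString_of_even_add_odd hα hγ h)
    have hc_mem : c ∈ binomRing a := sign_mem _ (by simpa using hc)
    have commute_next : Commute (toU a (X α)) (toU a (X ⟨_, h⟩)) := by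
      refine sub_eq_zero.1 ?_
      rw [hB.toU_mul_sub_of_even_of_odd hα hδ, hB.bracket_of_not_root α ⟨_, h⟩
        (even_add_odd_ne_zero hα hδ) (even_add_even_add_odd_notMem_roots hα hγ), map_zero]
    rw [bracket_eq, map_smul] at commutator
    rw [dividedPow_succ_mul_sub commutator (commute_next.smul_right c), smul_mul_assoc]
    exact smul_mem_wordSpan hc_mem (mul_mem_wordSpan _ (toU_X_mem_filt _)
      (factor_mem_wordSpan (factor a H X) (s := Sum.inl α) (Nat.lt_succ_self m)) (by omega))
  · rw [hB.bracket_of_not_root α γ (even_add_odd_ne_zero hα hγ) h, map_zero] at commutator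
    rw [(commute_dividedPow_left (sub_eq_zero.1 commutator) m).eq, sub_self]
    exact zero_mem _

lemma toU_mul_add_mem_filt_of_odd_of_odd (hB : IsChevalleyBasis a H X) (ha0 : a ≠ 0)
    (ha1 : a ≠ -1) (hγ : γ.1 ∈ oddRoots a) (hδ : δ.1 ∈ oddRoots a) :
    toU a (X γ) * toU a (X δ) + toU a (X δ) * toU a (X γ) ∈ filt H X 2 := by
  rw [hB.toU_mul_add_of_odd_of_odd hγ hδ]
  by_cases h0 : γ.1 + δ.1 = 0
  · have sign : rootSign a γ.1 = 1 ∨ rootSign a γ.1 = -1 := by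
      rw [rootSign]
      split_ifs
      exacts [Or.inr rfl, Or.inl rfl]
    rw [hB.bracket_neg γ δ (eq_neg_of_add_eq_zero_right h0), map_smul]
    exact smul_mem_wordSpan (sign_mem _ sign) (hB.toU_coroot_mem_filt γ)
  by_cases h : γ.1 + δ.1 ∈ roots a
  · obtain ⟨c, hc, bracket_eq⟩ := hB.bracket_of_isotropic γ δ ⟨_, h⟩ rfl (form_self_of_odd hγ)
      (form_self_of_odd hδ)
    have hc_mem : c ∈ binomRing a := by
      have pairing_mem := intRing_le_binomRing (root_apply_coroot_mem ha0 ha1 δ.2 γ.2)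
      rcases hc with rfl | rfl
      exacts [pairing_mem, neg_mem pairing_mem]
    rw [bracket_eq, map_smul]
    exact smul_mem_wordSpan hc_mem (toU_X_mem_filt _)
  · rw [hB.bracket_of_not_root γ δ h0 h, map_zero]
    exact zero_mem _

lemma binom_mul_dividedPow_sub_mem_filt (hB : IsChevalleyBasis a H X) (ha0 : a ≠ 0)
    (ha1 : a ≠ -1) (i : Fin 3) (α : roots a) (m n : ℕ) :
    binom K (toU a (H i : D21 a)) m * dividedPow K (toU a (X α)) n -
      dividedPow K (toU a (X α)) n * binom K (toU a (H i : D21 a)) m ∈ filt H X (m + n) := by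
  have shift_mem : n * α.1 (H i) ∈ intRing a :=
    mul_mem (natCast_mem _ n) (hB.root_apply_H_mem ha0 ha1 α i)
  rw [← (semiconjBy_binom (semiconjBy_dividedPow_of_eigenvector
    (hB.toU_cartan_mul_sub (H i) α) n) m).eq, ← mul_sub]
  exact mul_mem_wordSpan _
    (factor_mem_wordSpan (factor a H X) (s := Sum.inl α) (Nat.lt_succ_self n))
    (binom_add_algebraMap_sub_mem_wordSpan (binom_mem_filt (Submodule.subset_span ⟨i, rfl⟩))
      (binom_mem_binomRing shift_mem) m) (by omega)

lemma factor_mul_sub_mem_filt_of_even_of_odd (hB : IsChevalleyBasis a H X) (ha0 : a ≠ 0)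
    (ha1 : a ≠ -1) (hα : α.1 ∈ evenRoots a) (hγ : γ.1 ∈ oddRoots a) (m n : ℕ) :
    factor a H X (Sum.inl α) m * factor a H X (Sum.inl γ) n -
      factor a H X (Sum.inl γ) n * factor a H X (Sum.inl α) m ∈ filt H X (m + n) := by
  rcases n with _ | _ | n
  · simp [factor_zero]
  · simpa [factor] using hB.dividedPow_mul_toU_sub_mem_filt_of_even_of_odd ha0 ha1 hα hγ m
  · simp [hB.factor_odd_eq_zero hγ (show 2 ≤ n + 1 + 1 by omega)]

lemma exists_factor_mul_sub_smul_mem_of_odd_of_odd (hB : IsChevalleyBasis a H X)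
    (ha0 : a ≠ 0) (ha1 : a ≠ -1) (hγ : γ.1 ∈ oddRoots a) (hδ : δ.1 ∈ oddRoots a) (m n : ℕ) :
    ∃ c : binomRing a, factor a H X (Sum.inl γ) m * factor a H X (Sum.inl δ) n -
      c • (factor a H X (Sum.inl δ) n * factor a H X (Sum.inl γ) m) ∈ filt H X (m + n) := by
  rcases m with _ | _ | m
  · exact ⟨1, by simp [factor_zero]⟩
  · rcases n with _ | _ | n
    · exact ⟨1, by simp [factor_zero]⟩
    · exact ⟨-1, by simpa [factor] using hB.toU_mul_add_mem_filt_of_odd_of_odd ha0 ha1 hγ hδ⟩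
    · exact ⟨1, by simp [hB.factor_odd_eq_zero hδ (show 2 ≤ n + 1 + 1 by omega)]⟩
  · exact ⟨1, by simp [hB.factor_odd_eq_zero hγ (show 2 ≤ m + 1 + 1 by omega)]⟩

lemma exists_factor_mul_factor_sub_smul_swap_mem (hB : IsChevalleyBasis a H X) (ha0 : a ≠ 0)
    (ha1 : a ≠ -1) (s t : roots a ⊕ Fin 3) (m n : ℕ) : ∃ c : binomRing a,
    factor a H X s m * factor a H X t n - c • (factor a H X t n * factor a H X s m) ∈
      filt H X (m + n) := by
  have of_commutator {x y : U a} (h : x * y - y * x ∈ filt H X (m + n)) :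
      ∃ c : binomRing a, x * y - c • (y * x) ∈ filt H X (m + n) := ⟨1, by rwa [one_smul]⟩
  have of_commutator_symm {x y : U a} (h : y * x - x * y ∈ filt H X (n + m)) :
      ∃ c : binomRing a, x * y - c • (y * x) ∈ filt H X (m + n) :=
    of_commutator (by rw [← neg_sub, add_comm]; exact neg_mem h)
  rcases s with α | i <;> rcases t with β | j
  · rcases α.2 with hα | hα <;> rcases β.2 with hβ | hβ
    · exact of_commutator (hB.dividedPow_mul_sub_mem_filt_of_even_of_even ha0 ha1 hα hβ m n)
    · exact of_commutator (hB.factor_mul_sub_mem_filt_of_even_of_odd ha0 ha1 hα hβ m n)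
    · exact of_commutator_symm (hB.factor_mul_sub_mem_filt_of_even_of_odd ha0 ha1 hβ hα n m)
    · exact hB.exists_factor_mul_sub_smul_mem_of_odd_of_odd ha0 ha1 hα hβ m n
  · exact of_commutator_symm (hB.binom_mul_dividedPow_sub_mem_filt ha0 ha1 j α n m)
  · exact of_commutator (hB.binom_mul_dividedPow_sub_mem_filt ha0 ha1 i β m n)
  · have commute : Commute (factor a H X (Sum.inr i) m) (factor a H X (Sum.inr j) n) :=
      commute_binom_left (commute_binom_right (commute_toU_cartan (H i) (H j)) n) m
    exact of_commutator (by rw [commute.eq, sub_self]; exact zero_mem _)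

end CharZero

end IsChevalleyBasis

end D21

end CommutationRelations

section OrderedMonomials

lemma filter_mem_sort_univ {ι : Type*} [Fintype ι] [DecidableEq ι] (r : ι → ι → Prop)
    [DecidableRel r] [IsTrans ι r] [Std.Antisymm r] [Std.Total r] (s : Finset ι) :
    (Finset.univ.sort r).filter (· ∈ s) = s.sort r := by
  refine List.Perm.eq_of_pairwise' (r := r)
    ((Finset.univ.pairwise_sort r).sublist List.filter_sublist) (s.pairwise_sort r) ?_
  refine (List.perm_ext_iff_of_nodup ((Finset.univ.sort_nodup r).filter _)
    (s.sort_nodup r)).2 fun x => ?_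
  simp

namespace D21

open SuperEnveloping

variable {K : Type*} [Field K] {a : K} {H : Fin 3 → cartan a} {X : roots a → D21 a}

open Classical in
/-- The parity of the factor with a given index: it is `1` for the odd roots, and `0` for the even
roots and for `H₁, H₂, H₃`. -/
def indexParity (s : roots a ⊕ Fin 3) : ZMod 2 :=
  Sum.elim (fun α => if α.1 ∈ oddRoots a then 1 else 0) (fun _ => 0) s

lemma indexParity_eq_one_iff {s : roots a ⊕ Fin 3} :
    indexParity s = 1 ↔ ∃ γ : roots a, γ.1 ∈ oddRoots a ∧ s = Sum.inl γ := by
  rcases s with α | i <;> simp [indexParity]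

lemma isSuperExponent_indexParity_iff {m : (roots a ⊕ Fin 3) →₀ ℕ} :
    IsSuperExponent indexParity m ↔ ∀ γ : roots a, γ.1 ∈ oddRoots a → m (Sum.inl γ) ≤ 1 := by
  simp only [IsSuperExponent, indexParity_eq_one_iff]
  exact ⟨fun h γ hγ => h _ ⟨γ, hγ, rfl⟩, by rintro h _ ⟨γ, hγ, rfl⟩; exact h γ hγ⟩

open Classical in
lemma monomial_eq_orderedProd [Fintype (roots a ⊕ Fin 3)]
    (r : roots a ⊕ Fin 3 → roots a ⊕ Fin 3 → Prop) [IsLinearOrder (roots a ⊕ Fin 3) r]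
    (n : Exponent a) :
    monomial a H X r n = orderedProd (factor a H X) (Finset.univ.sort r) n.1 := by
  rw [← orderedProd_filter_support (factor a H X) factor_zero, filter_mem_sort_univ]
  rfl

lemma factor_one (s : roots a ⊕ Fin 3) :
    factor a H X s 1 = toU a (Sum.elim (fun i => (H i : D21 a)) X s.swap) := by
  rcases s with α | i
  exacts [dividedPow_one _, binom_one _]

section CharZero

variable [CharZero K]

lemma exists_mem_filt_of_mem_kostant {u : U a} (hu : u ∈ kostant a H X) :
    ∃ d, u ∈ filt H X d := by
  induction hu using Algebra.adjoin_induction with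
  | mem x hx =>
    rcases hx with (⟨α, -, n, rfl⟩ | ⟨γ, -, rfl⟩) | ⟨h, hh, n, rfl⟩
    · exact ⟨n + 1, factor_mem_wordSpan (factor a H X) (s := Sum.inl α) n.lt_succ_self⟩
    · exact ⟨2, toU_X_mem_filt γ⟩
    · exact ⟨n + 1, binom_mem_filt hh n⟩
  | algebraMap c =>
    refine ⟨1, ?_⟩
    rw [Algebra.algebraMap_eq_smul_one]
    exact Submodule.smul_mem _ c (one_mem_wordSpan _ one_pos)
  | add x y _ _ hx hy =>
    obtain ⟨d, hd⟩ := hx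
    obtain ⟨e, he⟩ := hy
    exact ⟨max d e, add_mem (wordSpan_mono _ (le_max_left _ _) hd)
      (wordSpan_mono _ (le_max_right _ _) he)⟩
  | mul x y _ _ hx hy =>
    obtain ⟨d, hd⟩ := hx
    obtain ⟨e, he⟩ := hy
    exact ⟨d + e, mul_mem_wordSpan _ hd he (Nat.le_succ _)⟩

namespace IsChevalleyBasis

lemma isDividedPowerSequence_factor (hB : IsChevalleyBasis a H X) (s : roots a ⊕ Fin 3) :
    IsDividedPowerSequence (indexParity s) (factor a H X s) := by
  rcases s with α | i
  · by_cases h : α.1 ∈ oddRoots a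
    · rw [indexParity_eq_one_iff.2 ⟨α, h, rfl⟩]
      exact isDividedPowerSequence_dividedPow_of_odd (hB.X_mem_part_one h)
    · rw [show indexParity (Sum.inl α) = 0 from if_neg h]
      exact isDividedPowerSequence_dividedPow_of_even (hB.X_mem_part_zero (α.2.resolve_right h))
  · exact isDividedPowerSequence_binom_of_even (cartan_mem_part_zero (H i))

lemma linearIndependent_factor_one (hB : IsChevalleyBasis a H X) :
    LinearIndependent K fun s => factor a H X s 1 := by
  simp only [factor_one]
  exact (hB.linearIndependent.comp Sum.swap Sum.swap_leftInverse.injective).map_injOn (toU a)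
    (ι_injective bracket_injective).injOn

lemma linearIndependent_orderedProd_factor (hB : IsChevalleyBasis a H X)
    {L : List (roots a ⊕ Fin 3)} (hL : L.Nodup) (hmem : ∀ s, s ∈ L) :
    LinearIndependent K fun n : Exponent a => orderedProd (factor a H X) L n.1 :=
  (linearIndependent_orderedProd hB.isDividedPowerSequence_factor
    hB.linearIndependent_factor_one hL hmem).comp
      (fun n : Exponent a => ⟨n.1, isSuperExponent_indexParity_iff.2 n.2⟩)
      fun _ _ h => Subtype.ext (Subtype.mk.inj h)

lemma factor_mem_kostant (hB : IsChevalleyBasis a H X) (s : roots a ⊕ Fin 3) (n : ℕ) :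
    factor a H X s n ∈ kostant a H X := by
  rcases s with α | i
  · rcases α.2 with hα | hα
    · exact Algebra.subset_adjoin (Or.inl (Or.inl ⟨α, hα, n, rfl⟩))
    · rcases n with _ | _ | n
      · rw [factor_zero]; exact one_mem _
      · exact Algebra.subset_adjoin (Or.inl (Or.inr ⟨α, hα, dividedPow_one _⟩))
      · rw [hB.factor_odd_eq_zero hα (by omega)]; exact zero_mem _
  · exact Algebra.subset_adjoin (Or.inr ⟨H i, Submodule.subset_span ⟨i, rfl⟩, n, rfl⟩)

lemma orderedProd_mem_kostant (hB : IsChevalleyBasis a H X) (L : List (roots a ⊕ Fin 3))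
    (m : (roots a ⊕ Fin 3) →₀ ℕ) : orderedProd (factor a H X) L m ∈ kostant a H X := by
  refine list_prod_mem fun x hx => ?_
  obtain ⟨s, -, rfl⟩ := List.mem_map.1 hx
  exact hB.factor_mem_kostant s _

lemma kostant_le_span_orderedProd (hB : IsChevalleyBasis a H X) (ha0 : a ≠ 0) (ha1 : a ≠ -1)
    {L : List (roots a ⊕ Fin 3)} (hL : L.Nodup) (hmem : ∀ s, s ∈ L) :
    (kostant a H X).toSubmodule ≤ Submodule.span (binomRing a)
      (Set.range fun n : Exponent a => orderedProd (factor a H X) L n.1) := by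
  intro u hu
  obtain ⟨d, hd⟩ := exists_mem_filt_of_mem_kostant hu
  refine Submodule.span_le.2 ?_ (wordSpan_le_span_orderedProd
    (fun s t m n _ => hB.exists_factor_mul_factor_sub_smul_swap_mem ha0 ha1 s t m n)
    exists_factor_mul_factor_sub_smul_mem factor_zero hL hmem d hd)
  rintro _ ⟨m, rfl⟩
  by_cases hm : ∀ γ : roots a, γ.1 ∈ oddRoots a → m (Sum.inl γ) ≤ 1
  · exact Submodule.subset_span ⟨⟨m, hm⟩, rfl⟩
  · push Not at hm
    obtain ⟨γ, hγ, two_le⟩ := hm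
    have orderedProd_eq_zero : orderedProd (factor a H X) L m = 0 := List.prod_eq_zero
      (List.mem_map.2 ⟨Sum.inl γ, hmem _, hB.factor_odd_eq_zero hγ two_le⟩)
    rw [orderedProd_eq_zero]
    exact zero_mem _

lemma exists_basis_orderedProd (hB : IsChevalleyBasis a H X) (ha0 : a ≠ 0) (ha1 : a ≠ -1)
    {L : List (roots a ⊕ Fin 3)} (hL : L.Nodup) (hmem : ∀ s, s ∈ L) :
    ∃ b : Module.Basis (Exponent a) (binomRing a) (kostant a H X),
      ∀ n : Exponent a, (b n : U a) = orderedProd (factor a H X) L n.1 := by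
  let v : Exponent a → kostant a H X := fun n => ⟨_, hB.orderedProd_mem_kostant L n.1⟩
  let incl := (kostant a H X).val.toLinearMap
  have linearIndependent_v : LinearIndependent (binomRing a) v :=
    .of_comp incl <| (hB.linearIndependent_orderedProd_factor hL hmem).restrict_scalars
      fun c c' h => by simpa [Subring.smul_def] using h
  have span_v : ⊤ ≤ Submodule.span (binomRing a) (Set.range v) := by
    refine (Submodule.map_le_map_iff_of_injective (f := incl) Subtype.val_injective _ _).1 ?_
    rw [Submodule.map_span, ← Set.range_comp, Submodule.map_top]
    rintro _ ⟨u, rfl⟩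
    exact hB.kostant_le_span_orderedProd ha0 ha1 hL hmem u.2
  exact ⟨Module.Basis.mk linearIndependent_v span_v, fun n => by rw [Module.Basis.mk_apply]⟩

theorem exists_basis_monomial (hB : IsChevalleyBasis a H X) (ha0 : a ≠ 0) (ha1 : a ≠ -1)
    (r : roots a ⊕ Fin 3 → roots a ⊕ Fin 3 → Prop) [IsLinearOrder (roots a ⊕ Fin 3) r] :
    ∃ b : Module.Basis (Exponent a) (binomRing a) (kostant a H X),
      ∀ n : Exponent a, (b n : U a) = monomial a H X r n := by
  classical
  have := Fintype.ofFinite (roots a ⊕ Fin 3)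
  obtain ⟨b, hb⟩ := hB.exists_basis_orderedProd ha0 ha1 (Finset.sort_nodup Finset.univ r)
    fun s => (Finset.mem_sort r).2 (Finset.mem_univ s)
  exact ⟨b, fun n => by rw [hb, monomial_eq_orderedProd]⟩

end IsChevalleyBasis

end CharZero

end D21

end OrderedMonomials

end

theorem mainTheorem3_general {K : Type*} [Field K] [CharZero K] (a : K)
    (ha0 : a ≠ 0) (ha1 : a ≠ -1)
    (H : Fin 3 → D21.cartan a) (X : D21.roots a → D21 a) (hB : D21.IsChevalleyBasis a H X) :
    Module.Free (D21.binomRing a) (D21.kostant a H X) ∧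
    ∀ (r : D21.roots a ⊕ Fin 3 → D21.roots a ⊕ Fin 3 → Prop)
      [IsLinearOrder (D21.roots a ⊕ Fin 3) r],
      ∃ b : Module.Basis (D21.Exponent a) (D21.binomRing a) (D21.kostant a H X),
        ∀ n : D21.Exponent a, (b n : D21.U a) = D21.monomial a H X r n := by
  classical
  refine ⟨?_, fun r _ => hB.exists_basis_monomial ha0 ha1 r⟩
  let : LinearOrder (D21.roots a ⊕ Fin 3) := linearOrderOfSTO WellOrderingRel
  obtain ⟨b, -⟩ := hB.exists_basis_monomial ha0 ha1 (· ≤ ·)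
  exact Module.Free.of_basis b

theorem mainTheorem3 {K : Type*} [Field K] [IsAlgClosed K] [CharZero K] (a : K)
    (ha0 : a ≠ 0) (ha1 : a ≠ -1)
    (H : Fin 3 → D21.cartan a) (X : D21.roots a → D21 a) (hB : D21.IsChevalleyBasis a H X) :
    Module.Free (D21.binomRing a) (D21.kostant a H X) ∧
    ∀ (r : D21.roots a ⊕ Fin 3 → D21.roots a ⊕ Fin 3 → Prop)
      [IsLinearOrder (D21.roots a ⊕ Fin 3) r],
      ∃ b : Module.Basis (D21.Exponent a) (D21.binomRing a) (D21.kostant a H X),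
        ∀ n : D21.Exponent a, (b n : D21.U a) = D21.monomial a H X r n :=
  mainTheorem3_general a ha0 ha1 H X hB
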